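/- Notation. $\mathbb N$ is the set of positive integers. For $k\in\mathbb N$, $\pi(k)$ is the set of primes dividing $k$, $k_p$ is the largest power of the prime $p$ dividing $k$, $k_{2'}=k/k_2$, and $k_\nu=\prod_{p\in\nu}k_p$ for a set $\nu$ of primes. $\mathcal U_m$ is the group of units of $\mathbb Z/m\mathbb Z$, $\langle t\rangle_m\le\mathcal U_m$ is the subgroup generated by the class of $t$ (for $\gcd(t,m)=1$), and $\mathrm{Res}_q:\mathcal U_m\to\mathcal U_q$ is reduction ($q\mid m$). For a cyclic subgroup $T\le\mathcal U_m$ put $[T]=(r,\epsilon,o)$, where $r$ is the greatest divisor of $m$ with $\mathrm{Res}_{r_{2'}}(T)=1$ and $\mathrm{Res}_{r_2}(T)\subseteq\langle -1\rangle_{r_2}$; $\epsilon=-1$ if $\mathrm{Res}_{r_2}(T)\ne 1$ and $\epsilon=1$ otherwise; and $o=|\mathrm{Res}_{m_\nu}(T_{\nu'})|$ with $\nu=\pi(m)\setminus\pi(r)$ and $T_{\nu'}$ the Hall $\nu'$-subgroup of $T$. For $n,s\in\mathbb N$ put $[T,n,s]=m_\nu\prod_{p\in\pi(r)}m'_p$,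 where $m'_p=\min\left(m_p,\,o_pr_p,\,\max\left(r_p,s_p,r_p\frac{s_po_p}{n_p}\right)\right)$ if $\epsilon^{p-1}=1$, and, if $\epsilon=-1$ and $p=2$: $m'_2=r_2$ if $o_2\le 2$ or $m_2\le 2r_2$; $m'_2=\frac{m_2}{2}$ if $4\le o_2<n_2$, $4r_2\le m_2$ and ($s_2= n_2r_2$ or $2s_2=m_2<n_2r_2$); $m'_2=m_2$ otherwise. Let $G$ be a finite metacyclic group. A metacyclic factorization $G=AB$ consists of a normal cyclic subgroup $A$ and a cyclic subgroup $B$ with $G=AB$. Let $T_G(A)\le\mathcal U_{|A|}$ correspond to the group of automorphisms of $A$ induced by conjugation in $G$, with $u\in\mathcal U_{|A|}$ corresponding to $a\mapsto a^u$, and let $(r_G(A),\epsilon_G(A),o_G(A))=[T_G(A)]$. The factorization is minimal if $(|A|,r_G(A),[G:B])$ is lexicographically minimal among all metacyclic factorizations of $G$. The list of metacyclic invariants of $G$ is $(m,n,s,t)$, where, for a minimal factorization $G=AB$, $m=|A|$, $n=[G:A]$, $s=[G:B]$ and, with $m'=[T_G(A),n,s]$, $\Delta=\mathrm{Res}_{m'}(T_G(A))$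 and $(r,\epsilon,o)=[\Delta]$, $t$ is the least integer $\ge 0$ coprime to $m$ such that $\mathrm{Res}_{m'}(\langle t\rangle_m)=\Delta$ and $t\equiv\epsilon^{p-1}+r_p \bmod m_p$ for every $p\in\pi(r)$. Write $\epsilon_G=\epsilon_G(A)$ for a minimal factorization $G=AB$ (when $G$ is nilpotent it does not depend on the choice). Let $\mathcal G_{m,n,s,t}=\langle a,b\mid a^m=1,\ b^n=a^s,\ b^{-1}ab=a^t\rangle$. Statement. Let $m,n,s\in\mathbb N$ and $t\in\mathbb N\cup\{0\}$. Then $(m,n,s,t)$ is the list of metacyclic invariants of a finite nilpotent metacyclic group if and only if $s\mid m$, $t<m$ and one of the following conditions holds: 1. $m=1$. 2. $t=1$ and $s=m\mid n$. 3. There is a divisor $r\ne m$ of $m$ such that $\pi(r)=\pi(m)$, $t\equiv 1+r_p\bmod m_p$ for every $p\in\pi(m)$, $\mathrm{lcm}\left(r,\frac mr\right)\mid s\mid n$, and if $4\mid m$ then $4\mid r$. 4. There is a divisor $r$ of $s_{2'}m_2$ such that $\pi(r)=\pi(m)$, $4\mid r$, $t\equiv 1+r_p\bmod m_p$ for every odd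 $p\in\pi(m)$, $t\equiv -1+r_2\bmod m_2$, $\frac{m_{2'}}{r_{2'}}\mid s_{2'}\mid n_{2'}$, $\max\left(2,\frac{m_2}{r_2}\right)\le n_2$, $m_2\le 2s_2$, $s_2\ne n_2r_2$, and, if moreover $4\mid n$ and $8\mid m$, then $r_2\le s_2$. In that case $\mathcal G_{m,n,s,t}$ is a finite nilpotent metacyclic group and $(m,n,s,t)$ is its one and only list of metacyclic invariants. Moreover, if $G$ is a finite nilpotent group with list of metacyclic invariants $(m,n,s,t)$, then (1) holds if and only if $G$ is cyclic, (2) if and only if $G$ is abelian and not cyclic, (3) if and only if $G$ is non-abelian with $\epsilon_G=1$, and (4) if and only if $\epsilon_G=-1$. -/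

import Mathlib

open scoped Pointwise

/-- `k_p`: the largest power of the prime `p` dividing the positive integer `k`. -/
def pPart (p k : ℕ) : ℕ := p ^ k.factorization p

/-- `k_{2'}`: the largest odd divisor of the positive integer `k`. -/
def oddPart (k : ℕ) : ℕ := k / pPart 2 k

/-- `Res_q(T)`: the image of a subgroup `T` of the units modulo `m` in the units modulo a
divisor `q` of `m` (it is only used for divisors; the other branch is a dummy value). -/
noncomputable def resUnits {m : ℕ} (T : Subgroup (ZMod m)ˣ) (q : ℕ) : Subgroup (ZMod q)ˣ :=
  if h : q ∣ m then T.map (ZMod.unitsMap h) else ⊥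

open Classical in
/-- First entry `r` of `[T]`: the greatest divisor `r` of `m` such that `Res_{r_{2'}}(T) = 1` and
`Res_{r_2}(T) ⊆ ⟨-1⟩`. -/
noncomputable def invR {m : ℕ} (T : Subgroup (ZMod m)ˣ) : ℕ :=
  Nat.findGreatest (fun d => d ∣ m ∧ resUnits T (oddPart d) = ⊥ ∧
    resUnits T (pPart 2 d) ≤ Subgroup.zpowers (-1)) m

open Classical in
/-- Second entry `ε` of `[T]`: it is `-1` if `Res_{r_2}(T) ≠ 1` and `1` otherwise. -/
noncomputable def invEps {m : ℕ} (T : Subgroup (ZMod m)ˣ) : ℤ :=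
  if resUnits T (pPart 2 (invR T)) ≠ ⊥ then -1 else 1

/-- `ν = π(m) \ π(r)`. -/
noncomputable def invNu {m : ℕ} (T : Subgroup (ZMod m)ˣ) : Finset ℕ :=
  m.primeFactors \ (invR T).primeFactors

/-- `T_{ν'}`, the Hall `ν'`-subgroup of `T`: the elements of `T` whose order is divisible by no
prime of `ν` (here `ν` is a set of primes). -/
def hallCompl {m : ℕ} (T : Subgroup (ZMod m)ˣ) (ν : Finset ℕ) (hν : ∀ p ∈ ν, p.Prime) :
    Subgroup (ZMod m)ˣ where
  carrier := {u | u ∈ T ∧ ∀ p ∈ ν, ¬ p ∣ orderOf u}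
  one_mem' := ⟨T.one_mem, fun p hp h => (hν p hp).one_lt.ne' (by simpa using h)⟩
  mul_mem' := by
    rintro u v ⟨hu, hu'⟩ ⟨hv, hv'⟩
    refine ⟨T.mul_mem hu hv, fun p hp h => ?_⟩
    have h1 : p ∣ orderOf u * orderOf v :=
      h.trans ((Commute.all u v).orderOf_mul_dvd_mul_orderOf)
    rcases (hν p hp).dvd_mul.1 h1 with h2 | h2
    · exact hu' p hp h2
    · exact hv' p hp h2
  inv_mem' := by
    rintro u ⟨hu, hu'⟩
    exact ⟨T.inv_mem hu, fun p hp h => hu' p hp (by simpa using h)⟩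

theorem invNu_prime {m : ℕ} (T : Subgroup (ZMod m)ˣ) : ∀ p ∈ invNu T, p.Prime :=
  fun _ hp => Nat.prime_of_mem_primeFactors (Finset.mem_sdiff.1 hp).1

/-- `m_ν`. -/
noncomputable def nuPart {m : ℕ} (T : Subgroup (ZMod m)ˣ) : ℕ := ∏ p ∈ invNu T, pPart p m

/-- Third entry `o` of `[T]`: the order of `Res_{m_ν}(T_{ν'})`. -/
noncomputable def invO {m : ℕ} (T : Subgroup (ZMod m)ˣ) : ℕ :=
  Nat.card (resUnits (hallCompl T (invNu T) (invNu_prime T)) (nuPart T))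

/-- The number `m'_p` attached to `T`, `n`, `s` and a prime `p ∈ π(r)`.  In the first branch the
quotient is rounded down; this has no effect on the maximum, because all numbers involved are
powers of `p`. -/
noncomputable def mPrime {m : ℕ} (T : Subgroup (ZMod m)ˣ) (n s p : ℕ) : ℕ :=
  let mp := pPart p m
  let np := pPart p n
  let sp := pPart p s
  let rp := pPart p (invR T)
  let op := pPart p (invO T)
  if invEps T ^ (p - 1) = 1 then
    min mp (min (op * rp) (max rp (max sp (rp * (sp * op) / np))))
  else if op ≤ 2 ∨ mp ≤ 2 * rp then rp
  else if 4 ≤ op ∧ op < np ∧ 4 * rp ≤ mp ∧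
      (sp ≠ np * rp → 2 * sp = mp ∧ mp < np * rp) then mp / 2
  else mp

/-- `[T, n, s] = m_ν ∏_{p ∈ π(r)} m'_p`. -/
noncomputable def bracket {m : ℕ} (T : Subgroup (ZMod m)ˣ) (n s : ℕ) : ℕ :=
  nuPart T * ∏ p ∈ (invR T).primeFactors, mPrime T n s p

/-- A metacyclic factorization `G = AB`: `A` is a normal cyclic subgroup and `B` is a cyclic
subgroup. -/
structure MetacyclicFactorization (G : Type*) [Group G] where
  A : Subgroup G
  B : Subgroup G
  normal : A.Normal
  cyclic_A : IsCyclic A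
  cyclic_B : IsCyclic B
  mul_eq : (A : Set G) * (B : Set G) = Set.univ

namespace MetacyclicFactorization

variable {G : Type*} [Group G] (F : MetacyclicFactorization G)

/-- `|A|`. -/
noncomputable def m : ℕ := Nat.card F.A

/-- `[G : A]`. -/
noncomputable def n : ℕ := F.A.index

/-- `[G : B]`. -/
noncomputable def s : ℕ := F.B.index

/-- `T_G(A)`: the subgroup of the units modulo `|A|` that corresponds to the group of
automorphisms of `A` induced by conjugation in `G`, where a unit `u` corresponds to the
automorphism `a ↦ a ^ u`. -/
noncomputable def T : Subgroup (ZMod F.m)ˣ :=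
  haveI := F.normal
  haveI := F.cyclic_A
  (MulAut.conjNormal : G →* MulAut F.A).range.map (IsCyclic.mulAutMulEquiv F.A).toMonoidHom

/-- `r_G(A)`. -/
noncomputable def r : ℕ := invR F.T

/-- `ε_G(A)`. -/
noncomputable def eps : ℤ := invEps F.T

/-- `G = AB` is minimal if `(|A|, r_G(A), [G : B])` is lexicographically minimal among all
metacyclic factorizations of `G`. -/
def IsMinimal : Prop :=
  ∀ F' : MetacyclicFactorization G,
    toLex (F.m, toLex (F.r, F.s)) ≤ toLex (F'.m, toLex (F'.r, F'.s))

/-- `m' = [T, n, s]`. -/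
noncomputable def m' : ℕ := bracket F.T F.n F.s

/-- `Δ(AB) = Res_{m'}(T)`. -/
noncomputable def Delta : Subgroup (ZMod F.m')ˣ := resUnits F.T F.m'

/-- The natural numbers `t` coprime to `|A|` with `Res_{m'}(⟨t⟩) = Δ` and
`t ≡ ε^(p-1) + r_p` modulo `|A|_p` for every `p ∈ π(r)`, where `[Δ] = (r, ε, o)`. -/
def tSet : Set ℕ :=
  {t | (∃ h : Nat.Coprime t F.m,
      resUnits (Subgroup.zpowers (ZMod.unitOfCoprime t h)) F.m' = F.Delta) ∧
    ∀ p ∈ (invR F.Delta).primeFactors,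
      (t : ℤ) ≡ invEps F.Delta ^ (p - 1) + (pPart p (invR F.Delta) : ℤ) [ZMOD (pPart p F.m : ℤ)]}

end MetacyclicFactorization

/-- `(m, n, s, t)` is the list `(m_G, n_G, s_G, t_G)` of metacyclic invariants of `G`: it is
computed from a minimal metacyclic factorization of `G`. -/
def IsMetacyclicInvariants (G : Type*) [Group G] (m n s t : ℕ) : Prop :=
  ∃ F : MetacyclicFactorization G, F.IsMinimal ∧ F.m = m ∧ F.n = n ∧ F.s = s ∧ IsLeast F.tSet t

/-- The relators of `⟨a, b ∣ a^m = 1, b^n = a^s, b⁻¹ a b = a^t⟩`, where `a` and `b` are the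
generators with index `0` and `1`. -/
def metacyclicRels (m n s t : ℕ) : Set (FreeGroup (Fin 2)) :=
  let a := FreeGroup.of (0 : Fin 2)
  let b := FreeGroup.of (1 : Fin 2)
  {a ^ m, b ^ n * (a ^ s)⁻¹, b⁻¹ * a * b * (a ^ t)⁻¹}

/-- The group `𝒢_{m,n,s,t} = ⟨a, b ∣ a^m = 1, b^n = a^s, b⁻¹ a b = a^t⟩`. -/
abbrev MetacyclicGroup (m n s t : ℕ) : Type := PresentedGroup (metacyclicRels m n s t)

/-- The abelian non-cyclic case. -/
def AbelianCondition (m n s t : ℕ) : Prop := t = 1 ∧ s = m ∧ m ∣ n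

/-- The non-abelian case with `ε = 1`. -/
def PlusCondition (m n s t : ℕ) : Prop :=
  ∃ r : ℕ, r ∣ m ∧ r ≠ m ∧ r.primeFactors = m.primeFactors ∧
    (∀ p ∈ m.primeFactors, t ≡ 1 + pPart p r [MOD pPart p m]) ∧
    Nat.lcm r (m / r) ∣ s ∧ s ∣ n ∧ (4 ∣ m → 4 ∣ r)

/-- The case `ε = -1`. -/
def MinusCondition (m n s t : ℕ) : Prop :=
  ∃ r : ℕ, r ∣ oddPart s * pPart 2 m ∧ r.primeFactors = m.primeFactors ∧ 4 ∣ r ∧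
    (∀ p ∈ m.primeFactors, p ≠ 2 → t ≡ 1 + pPart p r [MOD pPart p m]) ∧
    (t : ℤ) ≡ -1 + (pPart 2 r : ℤ) [ZMOD (pPart 2 m : ℤ)] ∧
    oddPart m / oddPart r ∣ oddPart s ∧ oddPart s ∣ oddPart n ∧
    max 2 (pPart 2 m / pPart 2 r) ≤ pPart 2 n ∧
    pPart 2 m ≤ 2 * pPart 2 s ∧ pPart 2 s ≠ pPart 2 n * pPart 2 r ∧
    (4 ∣ n → 8 ∣ m → pPart 2 r ≤ pPart 2 s)

/-- `s ∣ m`, `t < m` and one of the four conditions holds (the case `m = 1` is the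
cyclic one). -/
def NilpotentConditions (m n s t : ℕ) : Prop :=
  s ∣ m ∧ t < m ∧
    (m = 1 ∨ AbelianCondition m n s t ∨ PlusCondition m n s t ∨ MinusCondition m n s t)

/-! ### p-parts, geometric sums and valuations. -/

section Arithmetic

/-! Write `A = ⟨a⟩`, `B = ⟨b⟩`, `b ^ n = a ^ k`, `b⁻¹ * a * b = a ^ t`; then `s = gcd(k, m)`.
Nilpotency means that every prime dividing `m` divides `t - 1`. Hence `π(r) = π(m)`, `ν` is empty,
`o = 1`, and every branch of `[T, n, s]` collapses to `r` (`Describes.m'_eq`). The invariant `t` is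
therefore the unique residue below `m` prescribed by `m`, `r`, `ε` through the Chinese remainder
theorem (`Describes.isLeast_tSet_iff`). What remains is to decide for which `m, n, s, r` a
factorization is minimal.

Necessity comes from changing generators. Replacing `b` by `b * a ^ y` moves `k` by a multiple of `1
+ t + ⋯ + t ^ (n - 1)`, so minimality makes `s` divide this sum. Lifting the exponent turns this
into `s_p ∣ n`, or into `s_2 ≠ n_2 r_2` when `ε = -1`. Replacing `a` by `b ^ x * a` is allowed once
the new cyclic group contains `a ^ (t - 1)`, hence all commutators. This shortens `A` unless the
p-part of `gcd(t - 1, m)` divides `s` (`IsMinimal.pPart_gcd_dvd`), and for `ε = -1` it can lower `r`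
while keeping `|A|` (`IsMinimal.pPart_two_s_ne`). The other conditions say that `b ^ n = a ^ k`
commutes with `a` and with `b`.

For sufficiency, the presented group is compared with a quotient of `ℤ/m ⋊ ℤ` by a central element,
so no unexpected collapse occurs (`MetacyclicGroup.metacyclicData`). With `g = gcd(t - 1, m)` it
maps onto `(ℤ/g)²`. For any other factorization with generators `a'`, `b'`, the image of `a'` has
order exactly `g`, while `a ^ g` is a product of commutators; so `a ^ g ∈ ⟨a' ^ g⟩` and `m ∣ m'`. If
`m' = m`, then `g` is the same for both, and bounds on the order of `b'` control `s`. For `ε = -1`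
the prime 2 needs separate work: `a'` and `b'` are written in terms of `a` and `b` to see how `b'`
acts modulo `r_2` and, when `m_2 ∣ s`, which power of `b'` vanishes.

Minimal factorizations share `m, r, s, n`, and `ε` depends only on `m` because `m / g` is the order
of the derived subgroup. This gives uniqueness and the four-way classification. -/

theorem pPart_dvd (p k : ℕ) : pPart p k ∣ k := Nat.ordProj_dvd k p

theorem pPart_pos {p : ℕ} (hp : p.Prime) (k : ℕ) : 0 < pPart p k := pow_pos hp.pos _

theorem prime_pow_dvd_pPart {p k e : ℕ} (hp : p.Prime) (hk : k ≠ 0) (h : p ^ e ∣ k) :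
    p ^ e ∣ pPart p k := (hp.pow_dvd_iff_dvd_ordProj hk).1 h

theorem pPart_dvd_pPart {a b : ℕ} (p : ℕ) (hb : b ≠ 0) (h : a ∣ b) : pPart p a ∣ pPart p b :=
  Nat.ordProj_dvd_ordProj_of_dvd hb h p

theorem pPart_mul {a b : ℕ} (p : ℕ) (ha : a ≠ 0) (hb : b ≠ 0) :
    pPart p (a * b) = pPart p a * pPart p b := Nat.ordProj_mul p ha hb

theorem pPart_of_coprime {p k : ℕ} (h : ¬ p ∣ k) : pPart p k = 1 := by
  simp [pPart, Nat.factorization_eq_zero_of_not_dvd h]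

theorem dvd_pPart {p k : ℕ} (hp : p.Prime) (hk : k ≠ 0) (h : p ∣ k) : p ∣ pPart p k :=
  Nat.dvd_ordProj_of_dvd hk hp h

theorem pPart_pow_self {p e : ℕ} (hp : p.Prime) : pPart p (p ^ e) = p ^ e :=
  Nat.ordProj_self_pow hp

theorem pPart_mul_of_not_dvd {p a e : ℕ} (hp : p.Prime) (ha : ¬ p ∣ a) :
    pPart p (a * p ^ e) = p ^ e := by
  have h0 : a ≠ 0 := by rintro rfl; simp at ha
  rw [pPart_mul p h0 (pow_ne_zero _ hp.ne_zero), pPart_of_coprime ha, pPart_pow_self hp, one_mul]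

theorem intDvd_of_forall_pPart {d : ℕ} {z : ℤ} (hd : d ≠ 0)
    (h : ∀ p ∈ d.primeFactors, (pPart p d : ℤ) ∣ z) : (d : ℤ) ∣ z := by
  rw [Int.natCast_dvd, Nat.dvd_iff_prime_pow_dvd_dvd]
  intro p e hp hpe
  rcases Nat.eq_zero_or_pos e with rfl | he
  · simp
  · have := h p (Nat.mem_primeFactors.2 ⟨hp, (dvd_pow_self p he.ne').trans hpe, hd⟩)
    rw [Int.natCast_dvd] at this
    exact (prime_pow_dvd_pPart hp hd hpe).trans this

theorem natDvd_of_forall_pPart {d z : ℕ} (hd : d ≠ 0)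
    (h : ∀ p ∈ d.primeFactors, pPart p d ∣ z) : d ∣ z := by
  have := intDvd_of_forall_pPart (z := z) hd (fun p hp => by exact_mod_cast h p hp)
  exact_mod_cast this

theorem intDvd_pPart_of_dvd {p k : ℕ} {z : ℤ} (h : (k : ℤ) ∣ z) : (pPart p k : ℤ) ∣ z :=
  (Int.natCast_dvd_natCast.2 (pPart_dvd p k)).trans h

theorem pPart_gcd {p m : ℕ} (hp : p.Prime) (hm : m ≠ 0) (z : ℤ) :
    pPart p (Int.gcd z m) = Int.gcd z (pPart p m) := by
  have hg : Int.gcd z m ≠ 0 := by simp [Int.gcd_eq_zero_iff, hm]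
  apply Nat.dvd_antisymm
  · apply Int.dvd_gcd
    · exact intDvd_pPart_of_dvd (Int.gcd_dvd_left ..)
    · refine Int.natCast_dvd_natCast.2 (pPart_dvd_pPart p hm ?_)
      exact Int.natCast_dvd_natCast.1 (Int.gcd_dvd_right ..)
  · have h1 : Int.gcd z (pPart p m) ∣ p ^ m.factorization p :=
      Int.natCast_dvd_natCast.1 (Int.gcd_dvd_right ..)
    obtain ⟨e, -, he⟩ := (Nat.dvd_prime_pow hp).1 h1
    rw [he]
    apply prime_pow_dvd_pPart hp hg
    rw [← he]
    apply Int.dvd_gcd (Int.gcd_dvd_left ..)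
    exact (Int.gcd_dvd_right ..).trans (Int.natCast_dvd_natCast.2 (pPart_dvd p m))

theorem pPart_mul_oddPart (k : ℕ) : pPart 2 k * oddPart k = k := Nat.ordProj_mul_ordCompl_eq_self k 2

theorem oddPart_mul_pPart (k : ℕ) : oddPart k * pPart 2 k = k := by
  rw [mul_comm, pPart_mul_oddPart]

theorem oddPart_dvd (k : ℕ) : oddPart k ∣ k := Nat.ordCompl_dvd k 2

theorem oddPart_dvd_oddPart {a b : ℕ} (h : a ∣ b) : oddPart a ∣ oddPart b :=
  Nat.ordCompl_dvd_ordCompl_of_dvd h 2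

theorem not_two_dvd_oddPart {k : ℕ} (hk : k ≠ 0) : ¬ 2 ∣ oddPart k :=
  Nat.not_dvd_ordCompl Nat.prime_two hk

theorem oddPart_pos {k : ℕ} (hk : k ≠ 0) : 0 < oddPart k := Nat.ordCompl_pos 2 hk

theorem oddPart_mul_of_not_dvd {a e : ℕ} (ha : ¬ 2 ∣ a) : oddPart (a * 2 ^ e) = a := by
  rw [oddPart, pPart_mul_of_not_dvd Nat.prime_two ha, Nat.mul_div_cancel _ (by positivity)]

theorem coprime_pPart_oddPart {k : ℕ} (hk : k ≠ 0) : Nat.Coprime (pPart 2 k) (oddPart k) :=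
  Nat.Coprime.pow_left _ (Nat.coprime_ordCompl Nat.prime_two hk)

theorem pPart_oddPart {p k : ℕ} (hp : p.Prime) (hp2 : p ≠ 2) (hk : k ≠ 0) :
    pPart p (oddPart k) = pPart p k := by
  conv_rhs => rw [← oddPart_mul_pPart k, pPart_mul p (oddPart_pos hk).ne'
    (pPart_pos Nat.prime_two k).ne']
  rw [pPart_of_coprime (p := p) (k := pPart 2 k), mul_one]
  intro h
  exact hp2 ((Nat.prime_dvd_prime_iff_eq hp Nat.prime_two).1 (hp.dvd_of_dvd_pow h))

theorem intDvd_of_pPart_two_of_oddPart {k : ℕ} {z : ℤ} (hk : k ≠ 0) (h2 : (pPart 2 k : ℤ) ∣ z)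
    (ho : (oddPart k : ℤ) ∣ z) : (k : ℤ) ∣ z := by
  rw [Int.natCast_dvd] at *
  rw [← pPart_mul_oddPart k]
  exact (coprime_pPart_oddPart hk).mul_dvd_of_dvd_of_dvd h2 ho

/-- Cut into `b` blocks of length `a`; each block is the first one times a power of `u ^ a`. -/
theorem geom_sum_range_mul {R : Type*} [CommSemiring R] (u : R) (a b : ℕ) :
    ∑ l ∈ Finset.range (a * b), u ^ l =
      (∑ l ∈ Finset.range a, u ^ l) * ∑ l ∈ Finset.range b, (u ^ a) ^ l := by
  induction b with
  | zero => simp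
  | succ b ih =>
    have h : ∑ l ∈ Finset.range a, u ^ (a * b + l) =
        (∑ l ∈ Finset.range a, u ^ l) * (u ^ a) ^ b := by
      rw [Finset.sum_mul]
      exact Finset.sum_congr rfl fun i _ => by rw [pow_add, pow_mul, mul_comm]
    rw [Nat.mul_succ, Finset.sum_range_add, ih, Finset.sum_range_succ _ b, mul_add, h]

theorem dvd_pow_sub_one {p u : ℤ} (h : p ∣ u - 1) (k : ℕ) : p ∣ u ^ k - 1 :=
  h.trans (by simpa using sub_dvd_pow_sub_pow u 1 k)

theorem geom_sum_sub_dvd {p u : ℤ} (h : p ∣ u - 1) (n : ℕ) :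
    p ∣ (∑ l ∈ Finset.range n, u ^ l) - n := by
  have : (∑ l ∈ Finset.range n, u ^ l) - (n : ℤ) = ∑ l ∈ Finset.range n, (u ^ l - 1) := by simp
  rw [this]
  exact Finset.dvd_sum fun l _ => dvd_pow_sub_one h l

/-- Peel off one prime `p` of `d` at a time: the first `p` terms are each 1 modulo `p`, and the
cofactor is a sum of the same kind for `u ^ p`. Being only a lower bound on valuations, it needs no
extra hypothesis at 2. -/
theorem dvd_geom_sum (d : ℕ) : ∀ (n : ℕ) (u : ℤ), d ∣ n →
    (∀ p : ℕ, p.Prime → p ∣ d → (p : ℤ) ∣ u - 1) → (d : ℤ) ∣ ∑ l ∈ Finset.range n, u ^ l := by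
  induction d using induction_on_primes with
  | zero => intro n u h _; simp [Nat.eq_zero_of_zero_dvd h]
  | one => intro n u _ _; simp
  | prime_mul p a hp ih =>
    rintro n u ⟨c, rfl⟩ h
    have hpu := h p hp (dvd_mul_right p a)
    rw [mul_assoc, geom_sum_range_mul, Nat.cast_mul]
    apply mul_dvd_mul
    · have := geom_sum_sub_dvd hpu p
      exact (dvd_sub_left (dvd_refl _)).1 this
    · exact ih _ _ (dvd_mul_right a c)
        fun q hq hqa => dvd_pow_sub_one (h q hq (hqa.mul_left p)) p

theorem dvd_pow_sub_one_of_forall_prime {d n : ℕ} {u : ℤ} (hdn : d ∣ n)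
    (h : ∀ p : ℕ, p.Prime → p ∣ d → (p : ℤ) ∣ u - 1) : (d : ℤ) ∣ u ^ n - 1 := by
  rw [← geom_sum_mul]
  exact (dvd_geom_sum d n u hdn h).mul_right _

/-- Lifting the exponent gives `v(u ^ n - 1) = v(u - 1) + v(n)`, so the geometric sum has exactly
the valuation of `n`. -/
theorem pow_dvd_of_dvd_geom_sum {p e n : ℕ} {u : ℤ} (hp : p.Prime) (hu : (p : ℤ) ∣ u - 1)
    (h4 : p = 2 → (4 : ℤ) ∣ u - 1) (h : (p ^ e : ℤ) ∣ ∑ l ∈ Finset.range n, u ^ l) : p ^ e ∣ n := by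
  -- For `u = 1` the valuation of `u - 1` is infinite and could not be cancelled below.
  by_cases hu1 : u = 1
  · subst hu1
    simp only [one_pow, Finset.sum_const, Finset.card_range, nsmul_eq_mul, mul_one] at h
    exact_mod_cast h
  have hpu : ¬ (p : ℤ) ∣ u := by
    intro h1
    have : (p : ℤ) ∣ 1 := by simpa using dvd_sub h1 hu
    exact hp.one_lt.ne' (by exact_mod_cast Int.eq_one_of_dvd_one (by positivity) this)
  have hlte : emultiplicity (p : ℤ) (u ^ n - 1) =
      emultiplicity (p : ℤ) (u - 1) + emultiplicity p n := by
    rcases eq_or_ne p 2 with rfl | hp2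
    · have := Int.two_pow_sub_pow' (x := u) (y := 1) n (h4 rfl) (by exact_mod_cast hpu)
      rw [one_pow] at this
      rw [← Int.natCast_emultiplicity]; exact this
    · have := Int.emultiplicity_pow_sub_pow hp (hp.odd_of_ne_two hp2) (x := u) (y := 1) hu hpu n
      rwa [one_pow] at this
  have hfin : FiniteMultiplicity (p : ℤ) (u - 1) :=
    Int.finiteMultiplicity_iff.2 ⟨by simpa using hp.one_lt.ne', sub_ne_zero.2 hu1⟩
  rw [← geom_sum_mul, emultiplicity_mul (Nat.prime_iff_prime_int.1 hp), add_comm,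
    hfin.emultiplicity_eq_multiplicity] at hlte
  have h1 : emultiplicity (p : ℤ) (∑ l ∈ Finset.range n, u ^ l) = emultiplicity p n :=
    ENat.add_right_injective_of_ne_top (ENat.natCast_ne_top _) hlte
  exact pow_dvd_of_le_emultiplicity (h1 ▸ le_emultiplicity_of_pow_dvd h)

/-- Pairing consecutive terms extracts `t + 1`, worth at most `ρ` factors 2. The cofactor is a
geometric sum in `t ^ 2 ≡ 1` modulo 4, which has the valuation of `n / 2`. -/
theorem pow_dvd_half_of_minus {e n : ℕ} {t : ℤ} {ρ : ℕ} (hn : 2 ∣ n) (h4 : (4 : ℤ) ∣ t + 1)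
    (hρ : ¬ (2 ^ (ρ + 1) : ℤ) ∣ t + 1) (h : (2 ^ (ρ + e) : ℤ) ∣ ∑ l ∈ Finset.range n, t ^ l) :
    2 ^ e ∣ n / 2 := by
  obtain ⟨c, rfl⟩ := hn
  rw [Nat.mul_div_cancel_left _ two_pos]
  rw [geom_sum_range_mul] at h
  have ht : (4 : ℤ) ∣ t ^ 2 - 1 := by
    have : t ^ 2 - 1 = (t + 1) * (t - 1) := by ring
    rw [this]; exact h4.mul_right _
  refine pow_dvd_of_dvd_geom_sum (u := t ^ 2) Nat.prime_two
    (dvd_trans (by norm_num) ht) (fun _ => ht) ?_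
  have hs : ∑ l ∈ Finset.range 2, t ^ l = t + 1 := by simp [Finset.sum_range_succ]; ring
  rw [hs] at h
  have h2 : Prime (2 : ℤ) := Int.prime_two
  have hfin : t + 1 ≠ 0 := by rintro h0; simp [h0] at hρ
  by_contra hcon
  have hS : FiniteMultiplicity (2 : ℤ) (t + 1) :=
    Int.finiteMultiplicity_iff.2 ⟨by norm_num, hfin⟩
  have a1 : emultiplicity (2 : ℤ) (t + 1) ≤ ρ := by
    have := emultiplicity_lt_iff_not_dvd.2 hρ
    exact Order.le_of_lt_add_one (by exact_mod_cast this)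
  have a2 := emultiplicity_lt_iff_not_dvd.2 (by exact_mod_cast hcon :
    ¬ (2 : ℤ) ^ e ∣ ∑ l ∈ Finset.range c, (t ^ 2) ^ l)
  have a3 := le_emultiplicity_of_pow_dvd h
  rw [emultiplicity_mul h2] at a3
  have : emultiplicity (2 : ℤ) (t + 1) + emultiplicity (2 : ℤ) (∑ l ∈ Finset.range c, (t ^ 2) ^ l) <
      (ρ : ℕ∞) + e := by
    refine ENat.add_lt_add_of_le_of_lt ?_ a1 a2
    exact ne_top_of_le_ne_top (ENat.natCast_ne_top ρ) a1
  exact absurd a3 (not_le.2 (by exact_mod_cast this))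

theorem gcd_dvd_of_forall_gcd_le {m : ℕ} (hm : m ≠ 0) {k S : ℤ}
    (h : ∀ y : ℕ, Int.gcd k m ≤ Int.gcd (k + y * S) m) : (Int.gcd k m : ℤ) ∣ S := by
  have hg : Int.gcd k m ≠ 0 := by simp [Int.gcd_eq_zero_iff, hm]
  by_contra hcon
  obtain ⟨p, hp, hpS⟩ : ∃ p ∈ (Int.gcd k m).primeFactors, ¬ (pPart p (Int.gcd k m) : ℤ) ∣ S := by
    by_contra! h'
    exact hcon (intDvd_of_forall_pPart hg h')
  have hp' := Nat.prime_of_mem_primeFactors hp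
  set y := m / pPart p m with hy
  have hcop : Nat.Coprime p y := Nat.coprime_ordCompl hp' hm
  have key : ¬ (pPart p (Int.gcd k m) : ℤ) ∣ k + y * S := by
    intro h1
    have h2 : (pPart p (Int.gcd k m) : ℤ) ∣ y * S :=
      (dvd_add_right (intDvd_pPart_of_dvd (Int.gcd_dvd_left ..))).1 h1
    refine hpS (IsCoprime.dvd_of_dvd_mul_left ?_ h2)
    exact Nat.isCoprime_iff_coprime.2 (hcop.pow_left _)
  have hdvd : Int.gcd (k + y * S) m ∣ Int.gcd k m := by
    rw [Nat.dvd_iff_prime_pow_dvd_dvd]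
    intro q e hq hqe
    have hqm : q ^ e ∣ m := hqe.trans (Int.natCast_dvd_natCast.1 (Int.gcd_dvd_right ..))
    have hqz : ((q ^ e : ℕ) : ℤ) ∣ k + y * S :=
      (Int.natCast_dvd_natCast.2 hqe).trans (Int.gcd_dvd_left ..)
    apply Int.dvd_gcd _ (Int.natCast_dvd_natCast.2 hqm)
    rcases eq_or_ne q p with rfl | hqp
    · rcases le_total e ((Int.gcd k m).factorization q) with hle | hle
      · exact (Int.natCast_dvd_natCast.2 ((pow_dvd_pow q hle).trans (pPart_dvd q _))).trans
          (Int.gcd_dvd_left ..)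
      · exact absurd ((Int.natCast_dvd_natCast.2 (pow_dvd_pow q hle)).trans hqz) key
    · have : q ^ e ∣ y := by
        have h3 : Nat.Coprime (q ^ e) (pPart p m) :=
          Nat.Coprime.pow _ _ ((Nat.coprime_primes hq hp').2 hqp)
        refine h3.dvd_of_dvd_mul_left ?_
        rw [hy, Nat.mul_div_cancel' (pPart_dvd p m)]; exact hqm
      exact (dvd_add_left ((Int.natCast_dvd_natCast.2 this).mul_right S)).1 hqz
  have heq := Nat.dvd_antisymm hdvd (by
    rw [Nat.le_antisymm (h y) (Nat.le_of_dvd (Nat.pos_of_ne_zero hg) hdvd)])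
  apply key
  rw [← heq]
  exact intDvd_pPart_of_dvd (Int.gcd_dvd_left ..)

/-- The exponent used to shrink a cyclic normal subgroup: the valuation of
`j * k + ∑ l < p ^ e, τ ^ (j * l)` can be made equal to `f`. -/
theorem exists_mul_add_geom_sum {p e f : ℕ} (hp : p.Prime) (hef : e < f) {k τ : ℤ}
    (hk : ((p ^ e : ℕ) : ℤ) ∣ k) (hk' : ¬ ((p ^ (e + 1) : ℕ) : ℤ) ∣ k)
    (hτ : ((p ^ f : ℕ) : ℤ) ∣ τ - 1) :
    ∃ j : ℕ, ((p ^ f : ℕ) : ℤ) ∣ j * k + ∑ l ∈ Finset.range (p ^ e), (τ ^ j) ^ l ∧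
      ¬ ((p ^ (f + 1) : ℕ) : ℤ) ∣ j * k + ∑ l ∈ Finset.range (p ^ e), (τ ^ j) ^ l := by
  obtain ⟨w, rfl⟩ := hk
  have hpw : ¬ (p : ℤ) ∣ w := by
    intro h; apply hk'; push_cast [pow_succ]; exact mul_dvd_mul_left _ h
  have hcop : IsCoprime (w : ℤ) ((p ^ (f + 1) : ℕ) : ℤ) := by
    push_cast
    exact (((Nat.prime_iff_prime_int.1 hp).coprime_iff_not_dvd.2 hpw).symm).pow_right
  obtain ⟨x, y, hxy⟩ := hcop
  have hP : (0 : ℤ) < ((p ^ (f + 1) : ℕ) : ℤ) := by exact_mod_cast pow_pos hp.pos _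
  -- `j₀ * w ≡ -1`
  obtain ⟨j₀, hj₀⟩ : ∃ j₀ : ℕ, ((p ^ (f + 1) : ℕ) : ℤ) ∣ (j₀ : ℤ) * w + 1 := by
    refine ⟨((-x) % ((p ^ (f + 1) : ℕ) : ℤ)).toNat, ?_⟩
    rw [Int.toNat_of_nonneg (Int.emod_nonneg _ hP.ne')]
    have : ((-x) % ((p ^ (f + 1) : ℕ) : ℤ)) = -x - ((p ^ (f + 1) : ℕ) : ℤ) * ((-x) / ((p ^ (f + 1) : ℕ) : ℤ)) := by
      rw [Int.emod_def]
    rw [this]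
    refine ⟨y - ((-x) / ((p ^ (f + 1) : ℕ) : ℤ)) * w, ?_⟩
    linear_combination -hxy
  have hf : ∀ j : ℕ, ((p ^ f : ℕ) : ℤ) ∣ (j : ℤ) * w + 1 →
      ((p ^ f : ℕ) : ℤ) ∣ j * (((p ^ e : ℕ) : ℤ) * w) + ∑ l ∈ Finset.range (p ^ e), (τ ^ j) ^ l := by
    intro j hj
    have h1 := geom_sum_sub_dvd (dvd_pow_sub_one hτ j) (p ^ e)
    have h2 := h1.add (hj.mul_right ((p ^ e : ℕ) : ℤ))
    have h3 : j * (((p ^ e : ℕ) : ℤ) * w) + ∑ l ∈ Finset.range (p ^ e), (τ ^ j) ^ l =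
        (∑ l ∈ Finset.range (p ^ e), (τ ^ j) ^ l) - ((p ^ e : ℕ) : ℤ) +
          ((j : ℤ) * w + 1) * ((p ^ e : ℕ) : ℤ) := by ring
    rw [h3]; exact h2
  have hj₀' : ((p ^ f : ℕ) : ℤ) ∣ (j₀ : ℤ) * w + 1 :=
    (Int.natCast_dvd_natCast.2 (pow_dvd_pow p (Nat.le_succ f))).trans hj₀
  -- If `j₀` overshoots, adding `p ^ (f - e)` to it moves the linear term by exactly `p ^ f * w` and
  -- the sum by a multiple of `p ^ (f + 1)`, so the valuation becomes `f`.
  by_cases hcase : ((p ^ (f + 1) : ℕ) : ℤ) ∣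
      j₀ * (((p ^ e : ℕ) : ℤ) * w) + ∑ l ∈ Finset.range (p ^ e), (τ ^ j₀) ^ l
  swap
  · exact ⟨j₀, hf _ hj₀', hcase⟩
  obtain ⟨d, rfl⟩ := Nat.exists_eq_add_of_lt hef
  set f := e + d + 1 with hfdef
  have hτ' : ((p ^ (f + 1) : ℕ) : ℤ) ∣ τ ^ (p ^ (d + 1)) - 1 := by
    rw [pow_succ p f, mul_comm, Nat.cast_mul, pow_succ p d, mul_comm (p ^ d) p, pow_mul]
    have h3 : (p : ℤ) ∣ τ - 1 := dvd_trans (by exact_mod_cast dvd_pow_self p (by omega)) hτ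
    have h1 : ((p : ℕ) : ℤ) * ((p ^ f : ℕ) : ℤ) ∣ τ ^ p - 1 := by
      rw [← geom_sum_mul]
      exact mul_dvd_mul (dvd_geom_sum p p τ dvd_rfl fun q hq hqp => by
        rwa [(Nat.prime_dvd_prime_iff_eq hq hp).1 hqp]) hτ
    exact dvd_pow_sub_one h1 _
  have hdiff : ((p ^ (f + 1) : ℕ) : ℤ) ∣ ∑ l ∈ Finset.range (p ^ e), (τ ^ (j₀ + p ^ (d + 1))) ^ l -
      ∑ l ∈ Finset.range (p ^ e), (τ ^ j₀) ^ l := by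
    rw [← Finset.sum_sub_distrib]
    refine Finset.dvd_sum fun l _ => ?_
    have : (τ ^ (j₀ + p ^ (d + 1))) ^ l - (τ ^ j₀) ^ l =
        (τ ^ j₀) ^ l * ((τ ^ (p ^ (d + 1))) ^ l - 1) := by ring
    rw [this]
    exact (dvd_pow_sub_one hτ' l).mul_left _
  have hpe : (((j₀ + p ^ (d + 1) : ℕ) : ℤ)) * (((p ^ e : ℕ) : ℤ) * w) =
      j₀ * (((p ^ e : ℕ) : ℤ) * w) + ((p ^ f : ℕ) : ℤ) * w := by
    rw [hfdef]; push_cast; ring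
  have hsum : ∀ q : ℤ, (q ∣ ((p ^ (f + 1) : ℕ) : ℤ)) → (q ∣ ((j₀ + p ^ (d + 1) : ℕ) : ℤ) * (((p ^ e : ℕ) : ℤ) * w) +
      ∑ l ∈ Finset.range (p ^ e), (τ ^ (j₀ + p ^ (d + 1))) ^ l ↔ q ∣ ((p ^ f : ℕ) : ℤ) * w) := by
    intro q hq
    have h5 := (hq.trans hcase).add (hq.trans hdiff)
    rw [hpe]
    rw [← dvd_add_right (c := ((p ^ f : ℕ) : ℤ) * w) h5]
    apply iff_of_eq; congr 1; ring
  refine ⟨j₀ + p ^ (d + 1), (hsum _ ?_).2 (dvd_mul_right _ _), fun h => hpw ?_⟩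
  · exact Int.natCast_dvd_natCast.2 (pow_dvd_pow p (Nat.le_succ f))
  · have h6 := (hsum _ dvd_rfl).1 h
    rw [pow_succ, Nat.cast_mul] at h6
    refine Int.dvd_of_mul_dvd_mul_left ?_ h6
    exact_mod_cast (pow_pos hp.pos _).ne'

end Arithmetic

/-! ### The invariants `r` and `ε` of a cyclic group of units. -/

section UnitInvariants

variable {m : ℕ} {u : (ZMod m)ˣ} {t : ℤ}

theorem coe_unitsMap_eq (hu : (u : ZMod m) = t) {q : ℕ} (h : q ∣ m) :
    (ZMod.unitsMap h u : ZMod q) = t := by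
  rw [ZMod.unitsMap_val, hu, ZMod.cast_intCast h]

theorem resUnits_zpowers (u : (ZMod m)ˣ) {q : ℕ} (h : q ∣ m) :
    resUnits (Subgroup.zpowers u) q = Subgroup.zpowers (ZMod.unitsMap h u) := by
  rw [resUnits, dif_pos h, MonoidHom.map_zpowers]

theorem units_eq_iff_dvd {q : ℕ} {v w : (ZMod q)ˣ} {x y : ℤ} (hv : (v : ZMod q) = x)
    (hw : (w : ZMod q) = y) : v = w ↔ (q : ℤ) ∣ x - y := by
  rw [Units.ext_iff, hv, hw, eq_comm, ZMod.intCast_eq_intCast_iff_dvd_sub]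

theorem resUnits_zpowers_eq_bot_iff (hu : (u : ZMod m) = t) {q : ℕ} (h : q ∣ m) :
    resUnits (Subgroup.zpowers u) q = ⊥ ↔ (q : ℤ) ∣ t - 1 := by
  rw [resUnits_zpowers u h, Subgroup.zpowers_eq_bot]
  exact units_eq_iff_dvd (coe_unitsMap_eq hu h) (by simp)

theorem resUnits_zpowers_le_iff (hu : (u : ZMod m) = t) {q : ℕ} (h : q ∣ m) :
    resUnits (Subgroup.zpowers u) q ≤ Subgroup.zpowers (-1) ↔
      (q : ℤ) ∣ t - 1 ∨ (q : ℤ) ∣ t + 1 := by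
  rw [resUnits_zpowers u h, Subgroup.zpowers_le]
  have h1 : ZMod.unitsMap h u = 1 ↔ (q : ℤ) ∣ t - 1 :=
    units_eq_iff_dvd (coe_unitsMap_eq hu h) (by simp)
  have h2 : ZMod.unitsMap h u = -1 ↔ (q : ℤ) ∣ t + 1 := by
    rw [← sub_neg_eq_add]
    exact units_eq_iff_dvd (coe_unitsMap_eq hu h) (by simp)
  rw [← h1, ← h2, Subgroup.mem_zpowers_iff]
  constructor
  · rintro ⟨k, hk⟩
    rcases Int.even_or_odd k with hk' | hk'
    · left; rw [← hk, hk'.neg_one_zpow]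
    · right; rw [← hk, hk'.neg_one_zpow]
  · rintro (h | h)
    · exact ⟨0, by simp [h]⟩
    · exact ⟨1, by simp [h]⟩

/-- `invR` is a maximum for size; the arithmetic supplies the stronger maximum for divisibility. -/
theorem invR_zpowers_eq (hm : m ≠ 0) (hu : (u : ZMod m) = t) {R : ℕ} (hR : R ∣ m)
    (ho : (oddPart R : ℤ) ∣ t - 1) (h2 : (pPart 2 R : ℤ) ∣ t - 1 ∨ (pPart 2 R : ℤ) ∣ t + 1)
    (hmax : ∀ d : ℕ, d ∣ m → (oddPart d : ℤ) ∣ t - 1 →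
      ((pPart 2 d : ℤ) ∣ t - 1 ∨ (pPart 2 d : ℤ) ∣ t + 1) → d ∣ R) :
    invR (Subgroup.zpowers u) = R := by
  classical
  have hR0 : 0 < R := Nat.pos_of_dvd_of_pos hR (Nat.pos_of_ne_zero hm)
  have hpred : ∀ d : ℕ, (d ∣ m ∧ resUnits (Subgroup.zpowers u) (oddPart d) = ⊥ ∧
      resUnits (Subgroup.zpowers u) (pPart 2 d) ≤ Subgroup.zpowers (-1)) ↔
      (d ∣ m ∧ (oddPart d : ℤ) ∣ t - 1 ∧
        ((pPart 2 d : ℤ) ∣ t - 1 ∨ (pPart 2 d : ℤ) ∣ t + 1)) := by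
    intro d
    refine and_congr_right fun hd => ?_
    rw [resUnits_zpowers_eq_bot_iff hu ((oddPart_dvd d).trans hd),
      resUnits_zpowers_le_iff hu ((pPart_dvd 2 d).trans hd)]
  unfold invR
  rw [Nat.findGreatest_eq_iff]
  refine ⟨Nat.le_of_dvd (Nat.pos_of_ne_zero hm) hR, fun _ => (hpred R).2 ⟨hR, ho, h2⟩, ?_⟩
  intro n hn _ h
  obtain ⟨h1, h2, h3⟩ := (hpred n).1 h
  exact absurd (Nat.le_of_dvd hR0 (hmax n h1 h2 h3)) (not_le.2 hn)

theorem invEps_zpowers (hu : (u : ZMod m) = t) {R : ℕ} (hR : R ∣ m)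
    (h : invR (Subgroup.zpowers u) = R) :
    invEps (Subgroup.zpowers u) = if (pPart 2 R : ℤ) ∣ t - 1 then 1 else -1 := by
  have h' := resUnits_zpowers_eq_bot_iff hu ((pPart_dvd 2 R).trans hR)
  unfold invEps
  rw [h]
  by_cases hc : (pPart 2 R : ℤ) ∣ t - 1
  · rw [if_pos hc, if_neg (not_not.2 (h'.2 hc))]
  · rw [if_neg hc, if_pos (fun h1 => hc (h'.1 h1))]

/-- The hypotheses force `e ≤ 1`, where only parity matters. -/
theorem two_pow_dvd_of_dvd_add_two {e : ℕ} {x y : ℤ} (hxy : (2 : ℤ) ∣ x - y)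
    (h : (2 ^ e : ℤ) ∣ x) (h4 : 2 ≤ e → ¬ (4 : ℤ) ∣ x) : (2 ^ e : ℤ) ∣ y := by
  rcases Nat.lt_or_ge e 2 with he | he
  · interval_cases e
    · simp
    · rw [pow_one] at *; omega
  · exact absurd (dvd_trans (by simpa using pow_dvd_pow (2 : ℤ) he) h) (h4 he)

/-- The odd and even parts of `r` in the case `ε = -1`. -/
def minusR (m : ℕ) (t : ℤ) : ℕ := Int.gcd (t - 1) (oddPart m) * Int.gcd (t + 1) (pPart 2 m)

theorem pPart_minusR_aux (hm : m ≠ 0) (t : ℤ) :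
    pPart 2 (minusR m t) = Int.gcd (t + 1) (pPart 2 m) ∧
      oddPart (minusR m t) = Int.gcd (t - 1) (oddPart m) := by
  obtain ⟨e, -, he⟩ : ∃ e, _ ∧ Int.gcd (t + 1) (pPart 2 m) = 2 ^ e :=
    (Nat.dvd_prime_pow Nat.prime_two).1 (Int.natCast_dvd_natCast.1 (Int.gcd_dvd_right ..))
  have ho : ¬ 2 ∣ Int.gcd (t - 1) (oddPart m) := fun h =>
    not_two_dvd_oddPart hm (h.trans (Int.natCast_dvd_natCast.1 (Int.gcd_dvd_right ..)))
  rw [minusR, he]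
  exact ⟨pPart_mul_of_not_dvd Nat.prime_two ho, oddPart_mul_of_not_dvd ho⟩

theorem pPart_two_minusR (hm : m ≠ 0) (t : ℤ) :
    pPart 2 (minusR m t) = Int.gcd (t + 1) (pPart 2 m) := (pPart_minusR_aux hm t).1

theorem oddPart_minusR (hm : m ≠ 0) (t : ℤ) :
    oddPart (minusR m t) = Int.gcd (t - 1) (oddPart m) := (pPart_minusR_aux hm t).2

theorem minusR_dvd (m : ℕ) (t : ℤ) : minusR m t ∣ m := by
  conv_rhs => rw [← oddPart_mul_pPart m]
  exact mul_dvd_mul (Int.natCast_dvd_natCast.1 (Int.gcd_dvd_right ..))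
    (Int.natCast_dvd_natCast.1 (Int.gcd_dvd_right ..))

theorem four_dvd_pPart_two {k : ℕ} (hk : k ≠ 0) (h : 4 ∣ k) : 4 ∣ pPart 2 k :=
  prime_pow_dvd_pPart (e := 2) Nat.prime_two hk h

theorem four_dvd_minusR (hm : m ≠ 0) (h4 : 4 ∣ m) (ht : (4 : ℤ) ∣ t + 1) : 4 ∣ minusR m t :=
  Dvd.dvd.mul_left (Int.dvd_gcd ht (Int.natCast_dvd_natCast.2 (four_dvd_pPart_two hm h4))) _

theorem gcd_sub_one_dvd (m : ℕ) (t : ℤ) : Int.gcd (t - 1) m ∣ m :=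
  Int.natCast_dvd_natCast.1 (Int.gcd_dvd_right ..)

/-- A 2-part dividing `t + 1` is at most 2 here, so allowing `-1` in the definition of `r` adds no
candidate beyond the divisors of the gcd. -/
theorem invR_plus (hm : m ≠ 0) (hu : (u : ZMod m) = t) (h4 : 4 ∣ m → (4 : ℤ) ∣ t - 1) :
    invR (Subgroup.zpowers u) = Int.gcd (t - 1) m := by
  have hd : ∀ d : ℤ, d ∣ (Int.gcd (t - 1) m : ℤ) → d ∣ t - 1 := fun d h =>
    h.trans (Int.gcd_dvd_left ..)
  refine invR_zpowers_eq hm hu (gcd_sub_one_dvd m t)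
    (hd _ (Int.natCast_dvd_natCast.2 (oddPart_dvd _)))
    (Or.inl (hd _ (Int.natCast_dvd_natCast.2 (pPart_dvd _ _)))) fun d hdm ho h2 => ?_
  apply Int.dvd_gcd _ (Int.natCast_dvd_natCast.2 hdm)
  refine intDvd_of_pPart_two_of_oddPart (ne_zero_of_dvd_ne_zero hm hdm) ?_ ho
  rcases h2 with h2 | h2
  · exact h2
  · rw [pPart, Nat.cast_pow] at *
    refine two_pow_dvd_of_dvd_add_two ⟨1, by ring⟩ h2 fun he h => ?_
    have : 4 ∣ m := (pow_dvd_pow 2 he).trans ((pPart_dvd 2 d).trans hdm)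
    have := h4 this
    omega

theorem invEps_plus (hm : m ≠ 0) (hu : (u : ZMod m) = t) (h4 : 4 ∣ m → (4 : ℤ) ∣ t - 1) :
    invEps (Subgroup.zpowers u) = 1 := by
  rw [invEps_zpowers hu (gcd_sub_one_dvd m t) (invR_plus hm hu h4), if_pos]
  exact (Int.natCast_dvd_natCast.2 (pPart_dvd _ _)).trans (Int.gcd_dvd_left ..)

theorem invR_minus (hm : m ≠ 0) (hu : (u : ZMod m) = t) (ht : (4 : ℤ) ∣ t + 1) :
    invR (Subgroup.zpowers u) = minusR m t := by
  refine invR_zpowers_eq hm hu (minusR_dvd m t) ?_ (Or.inr ?_) fun d hdm ho h2 => ?_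
  · rw [oddPart_minusR hm]; exact Int.gcd_dvd_left ..
  · rw [pPart_two_minusR hm]; exact Int.gcd_dvd_left ..
  · rw [← oddPart_mul_pPart d]
    refine mul_dvd_mul
      (Int.dvd_gcd ho (Int.natCast_dvd_natCast.2 (oddPart_dvd_oddPart hdm)))
      (Int.dvd_gcd ?_ (Int.natCast_dvd_natCast.2 (pPart_dvd_pPart 2 hm hdm)))
    rcases h2 with h2 | h2
    · rw [pPart, Nat.cast_pow] at *
      exact two_pow_dvd_of_dvd_add_two ⟨-1, by ring⟩ h2 fun he h => by omega
    · exact h2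

theorem invEps_minus (hm : m ≠ 0) (hu : (u : ZMod m) = t) (h4 : 4 ∣ m) (ht : (4 : ℤ) ∣ t + 1) :
    invEps (Subgroup.zpowers u) = -1 := by
  rw [invEps_zpowers hu (minusR_dvd m t) (invR_minus hm hu ht), if_neg]
  intro h
  have h1 : (4 : ℤ) ∣ t - 1 := dvd_trans (Int.natCast_dvd_natCast.2
    (four_dvd_pPart_two (ne_zero_of_dvd_ne_zero hm (minusR_dvd m t))
      (four_dvd_minusR hm h4 ht))) h
  omega

theorem pPart_minusR (hm : m ≠ 0) {p : ℕ} (hp : p.Prime) (hp2 : p ≠ 2) :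
    pPart p (minusR m t) = Int.gcd (t - 1) (pPart p m) := by
  rw [← pPart_oddPart hp hp2 (ne_zero_of_dvd_ne_zero hm (minusR_dvd m t)), oddPart_minusR hm,
    pPart_gcd hp (oddPart_pos hm).ne', pPart_oddPart hp hp2 hm]

/-- A unit modulo `m` is of one of two types, according to its residue modulo `4`. -/
theorem plus_or_minus (hu : (u : ZMod m) = t) :
    (4 ∣ m → (4 : ℤ) ∣ t - 1) ∨ (4 ∣ m ∧ (4 : ℤ) ∣ t + 1) := by
  by_cases h4 : 4 ∣ m
  · have h2 : ¬ (2 : ℤ) ∣ t := by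
      intro h
      have h1 : (2 : ℕ) ∣ m := dvd_trans (by norm_num) h4
      have h3 := coe_unitsMap_eq hu h1
      rw [(ZMod.intCast_zmod_eq_zero_iff_dvd t 2).2 h] at h3
      exact (ZMod.unitsMap h1 u).ne_zero h3
    by_cases h : (4 : ℤ) ∣ t - 1
    · exact Or.inl fun _ => h
    · exact Or.inr ⟨h4, by omega⟩
  · exact Or.inl fun h => absurd h h4

end UnitInvariants

/-! ### Generators of a metacyclic factorization and their numerical data. -/

section MetacyclicData

/-- Ties the abstract identification of automorphisms with units to exponents, by transport to
multiplication on `ZMod`. -/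
theorem mulAutMulEquiv_spec (C : Type*) [Group C] [IsCyclic C] [Finite C] (φ : MulAut C) (x : C) :
    φ x = x ^ (((IsCyclic.mulAutMulEquiv C φ : (ZMod (Nat.card C))ˣ) : ZMod (Nat.card C)).val) := by
  have : NeZero (Nat.card C) := ⟨Nat.card_pos.ne'⟩
  obtain ⟨v, rfl⟩ := (IsCyclic.mulAutMulEquiv C).symm.surjective φ
  rw [MulEquiv.apply_symm_apply]
  obtain ⟨y, rfl⟩ := (zmodCyclicMulEquiv (G := C) inferInstance).surjective x
  rw [IsCyclic.mulAutMulEquiv_symm_apply_apply, ← map_pow, MulEquiv.symm_apply_apply]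
  congr 1
  have h1 : ((AddEquiv.toMultiplicative (ZMod.AddAutEquivUnits (Nat.card C))).symm v)
      (Multiplicative.toAdd y) = (v : ZMod (Nat.card C)) * Multiplicative.toAdd y := rfl
  change Multiplicative.ofAdd (((AddEquiv.toMultiplicative
    (ZMod.AddAutEquivUnits (Nat.card C))).symm v) (Multiplicative.toAdd y)) = _
  rw [h1]
  apply Multiplicative.toAdd.injective
  rw [toAdd_ofAdd, toAdd_pow, nsmul_eq_mul, ZMod.natCast_zmod_val]

variable {G : Type*} [Group G]

section Conj

variable {a b : G} {t : ℤ}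

theorem zpow_mul_pow_of_conj (h : b⁻¹ * a * b = a ^ t) (i : ℤ) (j : ℕ) :
    a ^ i * b ^ j = b ^ j * a ^ (i * t ^ j) := by
  induction j generalizing i with
  | zero => simp
  | succ j ih =>
    have h1 : ∀ i : ℤ, a ^ i * b = b * a ^ (i * t) := by
      intro i
      have := conj_zpow (a := b⁻¹) (b := a) (i := i)
      rw [inv_inv, h, ← zpow_mul, mul_comm t i] at this
      rw [this]; group
    rw [pow_succ, ← mul_assoc, ih, mul_assoc, h1, ← mul_assoc]
    congr 2
    ring

theorem mul_mul_mul_of_conj (h : b⁻¹ * a * b = a ^ t) (j x : ℕ) (i y : ℤ) :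
    (b ^ j * a ^ i) * (b ^ x * a ^ y) = b ^ (j + x) * a ^ (i * t ^ x + y) := by
  rw [mul_assoc, ← mul_assoc (a ^ i), zpow_mul_pow_of_conj h, pow_add, zpow_add]
  group

theorem mul_pow_of_conj (h : b⁻¹ * a * b = a ^ t) (j : ℕ) (i : ℤ) (K : ℕ) :
    (b ^ j * a ^ i) ^ K = b ^ (j * K) * a ^ (i * ∑ l ∈ Finset.range K, (t ^ j) ^ l) := by
  induction K with
  | zero => simp
  | succ K ih =>
    rw [pow_succ', ih, mul_mul_mul_of_conj h, Finset.sum_range_succ, ← pow_mul, Nat.mul_succ,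
      add_comm j]
    congr 2
    ring

end Conj

/-- `a` and `b` generate the factors of a metacyclic factorization: `a` has order `m` and
`⟨a⟩` is normal of index `n`, with `b ^ n = a ^ k` and `b⁻¹ * a * b = a ^ t`. -/
structure MetacyclicData (a b : G) (m n : ℕ) (k t : ℤ) : Prop where
  order : orderOf a = m
  conj : b⁻¹ * a * b = a ^ t
  pow : b ^ n = a ^ k
  dvd_of_mem : ∀ j : ℕ, b ^ j ∈ Subgroup.zpowers a → n ∣ j
  gen : ∀ g : G, ∃ (j : ℕ) (i : ℤ), g = b ^ j * a ^ i

theorem zpow_eq_zpow_iff_dvd {a : G} {m : ℕ} (h : orderOf a = m) (x y : ℤ) :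
    a ^ x = a ^ y ↔ (m : ℤ) ∣ x - y := by
  rw [zpow_eq_zpow_iff_modEq, h, Int.modEq_comm, Int.modEq_iff_dvd]

theorem zpow_eq_one_iff_dvd {a : G} {m : ℕ} (h : orderOf a = m) (x : ℤ) :
    a ^ x = 1 ↔ (m : ℤ) ∣ x := by
  rw [← orderOf_dvd_iff_zpow_eq_one, h]

theorem zpow_mem_zpowers_zpow {a : G} {m : ℕ} (h : orderOf a = m) {x y : ℤ}
    (hxy : (Int.gcd x m : ℤ) ∣ y) : a ^ y ∈ Subgroup.zpowers (a ^ x) := by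
  obtain ⟨c, rfl⟩ := hxy
  rw [Subgroup.mem_zpowers_iff]
  refine ⟨Int.gcdA x m * c, ?_⟩
  rw [← zpow_mul, zpow_eq_zpow_iff_dvd h, Int.gcd_eq_gcd_ab]
  exact ⟨-(Int.gcdB x m * c), by ring⟩

theorem gcd_dvd_of_zpow_mem {a : G} {m : ℕ} (h : orderOf a = m) {x y : ℤ}
    (hxy : a ^ y ∈ Subgroup.zpowers (a ^ x)) : (Int.gcd x m : ℤ) ∣ y := by
  obtain ⟨c, hc⟩ := Subgroup.mem_zpowers_iff.1 hxy
  rw [← zpow_mul, zpow_eq_zpow_iff_dvd h] at hc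
  have h1 := (Int.gcd_dvd_right x m).trans hc
  exact (dvd_sub_right ((Int.gcd_dvd_left x m).mul_right c)).1 h1

theorem orderOf_zpow_eq {a : G} {m : ℕ} (h : orderOf a = m) (hm : m ≠ 0) (x : ℤ) :
    orderOf (a ^ x) = m / Int.gcd x m := by
  have hg : 0 < Int.gcd x m := Nat.pos_of_ne_zero (by simp [Int.gcd_eq_zero_iff, hm])
  have hgm : Int.gcd x m ∣ m := Int.natCast_dvd_natCast.1 (Int.gcd_dvd_right ..)
  have h1 : Subgroup.zpowers (a ^ x) = Subgroup.zpowers (a ^ (Int.gcd x m)) := by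
    apply le_antisymm
    · rw [Subgroup.zpowers_le, ← zpow_natCast]
      refine zpow_mem_zpowers_zpow h ?_
      refine dvd_trans ?_ (Int.gcd_dvd_left x m)
      exact Int.gcd_dvd_left ..
    · rw [Subgroup.zpowers_le, ← zpow_natCast]
      exact zpow_mem_zpowers_zpow h dvd_rfl
  rw [← Nat.card_zpowers, h1, Nat.card_zpowers, orderOf_pow_of_dvd hg.ne' (h ▸ hgm), h]

/-- The quotient is cyclic, generated by the image of `b`, whose order is therefore the index. -/
theorem pow_mem_zpowers_iff_index_dvd {a b : G} (hN : (Subgroup.zpowers a).Normal)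
    (hgen : ∀ g : G, ∃ (j : ℕ) (i : ℤ), g = b ^ j * a ^ i) (j : ℕ) :
    b ^ j ∈ Subgroup.zpowers a ↔ (Subgroup.zpowers a).index ∣ j := by
  let q : G ⧸ Subgroup.zpowers a := (b : G)
  have hq : ∀ y : G ⧸ Subgroup.zpowers a, y ∈ Subgroup.zpowers q := by
    intro y
    obtain ⟨g, rfl⟩ := QuotientGroup.mk_surjective y
    obtain ⟨j, i, rfl⟩ := hgen g
    refine ⟨j, ?_⟩
    have : ((a ^ i : G) : G ⧸ Subgroup.zpowers a) = 1 :=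
      (QuotientGroup.eq_one_iff _).2 (Subgroup.zpow_mem_zpowers ..)
    rw [QuotientGroup.mk_mul, this, mul_one, QuotientGroup.mk_pow]
    exact zpow_natCast _ _
  have h1 : orderOf q = (Subgroup.zpowers a).index := orderOf_eq_card_of_forall_mem_zpowers hq
  rw [← h1, orderOf_dvd_iff_pow_eq_one, ← QuotientGroup.eq_one_iff, QuotientGroup.mk_pow]

namespace MetacyclicData

variable {a b : G} {m n : ℕ} {k t : ℤ}

theorem pow_mem_iff (d : MetacyclicData a b m n k t) (j : ℕ) :
    b ^ j ∈ Subgroup.zpowers a ↔ n ∣ j := by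
  refine ⟨d.dvd_of_mem j, ?_⟩
  rintro ⟨c, rfl⟩
  rw [pow_mul, d.pow, ← zpow_natCast, ← zpow_mul]
  exact Subgroup.zpow_mem_zpowers ..

theorem normal_zpowers_zpow (d : MetacyclicData a b m n k t) [Finite G] (x : ℤ) :
    (Subgroup.zpowers (a ^ x)).Normal := by
  have hb : ∀ j : ℕ, ∀ y ∈ Subgroup.zpowers (a ^ x), (b ^ j)⁻¹ * y * b ^ j ∈
      Subgroup.zpowers (a ^ x) := by
    intro j y hy
    obtain ⟨c, rfl⟩ := Subgroup.mem_zpowers_iff.1 hy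
    rw [← zpow_mul, mul_assoc, zpow_mul_pow_of_conj d.conj, inv_mul_cancel_left]
    exact ⟨c * t ^ j, by simp only [← zpow_mul]; congr 1; ring⟩
  constructor
  intro y hy g
  obtain ⟨j, i, hji⟩ := d.gen g⁻¹
  have hg : g = (a ^ i)⁻¹ * (b ^ j)⁻¹ := by rw [← mul_inv_rev, ← hji, inv_inv]
  have := hb j y hy
  obtain ⟨c, hc⟩ := Subgroup.mem_zpowers_iff.1 this
  have h2 : g * y * g⁻¹ = (a ^ i)⁻¹ * ((b ^ j)⁻¹ * y * b ^ j) * a ^ i := by rw [hji, hg]; group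
  rw [h2, ← hc]
  refine ⟨c, ?_⟩
  simp only [← zpow_mul]; group

/-- `b ^ n`, being a power of `a`, commutes with `a`. -/
theorem dvd_pow_sub_one (d : MetacyclicData a b m n k t) : (m : ℤ) ∣ t ^ n - 1 := by
  have h := zpow_mul_pow_of_conj d.conj 1 n
  rw [d.pow, ← zpow_add, ← zpow_add, zpow_eq_zpow_iff_dvd d.order] at h
  rw [← dvd_neg]
  have h2 : 1 + k - (k + 1 * t ^ n) = -(t ^ n - 1) := by ring
  rwa [h2] at h

/-- `a ^ k`, being a power of `b`, commutes with `b`. -/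
theorem dvd_mul_sub_one (d : MetacyclicData a b m n k t) : (m : ℤ) ∣ k * (t - 1) := by
  have h := zpow_mul_pow_of_conj d.conj k 1
  rw [← d.pow, pow_one, ← pow_succ, pow_succ', d.pow, mul_right_inj,
    zpow_eq_zpow_iff_dvd d.order] at h
  rw [← dvd_neg]
  have h2 : k - k * t ^ 1 = -(k * (t - 1)) := by ring
  rwa [h2] at h

theorem n_ne_zero (d : MetacyclicData a b m n k t) [Finite G] : n ≠ 0 := by
  rintro rfl
  have := d.dvd_of_mem (orderOf b) (by rw [pow_orderOf_eq_one]; exact one_mem _)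
  exact (orderOf_pos b).ne' (Nat.eq_zero_of_zero_dvd this)

theorem m_ne_zero (d : MetacyclicData a b m n k t) [Finite G] : m ≠ 0 := by
  rw [← d.order]; exact (orderOf_pos a).ne'

theorem index_zpowers (d : MetacyclicData a b m n k t) [Finite G] :
    (Subgroup.zpowers a).index = n := by
  have hN : (Subgroup.zpowers a).Normal := by simpa using d.normal_zpowers_zpow 1
  have h := pow_mem_zpowers_iff_index_dvd hN d.gen
  exact Nat.dvd_antisymm ((h n).1 ((d.pow_mem_iff n).2 dvd_rfl))
    ((d.pow_mem_iff _).1 ((h _).2 dvd_rfl))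

theorem card_eq (d : MetacyclicData a b m n k t) [Finite G] : Nat.card G = m * n := by
  rw [← (Subgroup.zpowers a).card_mul_index, d.index_zpowers, Nat.card_zpowers, d.order]

theorem orderOf_b (d : MetacyclicData a b m n k t) [Finite G] :
    orderOf b = n * (m / Int.gcd k m) := by
  have hn : n ∣ orderOf b := d.dvd_of_mem _ (by rw [pow_orderOf_eq_one]; exact one_mem _)
  have h := orderOf_pow_of_dvd d.n_ne_zero hn
  rw [d.pow, orderOf_zpow_eq d.order d.m_ne_zero] at h
  rw [h, Nat.mul_div_cancel' hn]

theorem index_zpowers_b (d : MetacyclicData a b m n k t) [Finite G] :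
    (Subgroup.zpowers b).index = Int.gcd k m := by
  have h := (Subgroup.zpowers b).card_mul_index
  have hg : Int.gcd k m ∣ m := Int.natCast_dvd_natCast.1 (Int.gcd_dvd_right ..)
  rw [Nat.card_zpowers, d.orderOf_b, d.card_eq] at h
  obtain ⟨c, hc⟩ := hg
  have hgp : 0 < Int.gcd k m := Nat.pos_of_ne_zero (by simp [Int.gcd_eq_zero_iff, d.m_ne_zero])
  have hc' : m / Int.gcd k m = c := Nat.div_eq_of_eq_mul_right hgp hc
  rw [hc'] at h
  have hcp : c ≠ 0 := by rintro rfl; exact d.m_ne_zero (by rw [hc, mul_zero])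
  have hpos : 0 < n * c := Nat.mul_pos (Nat.pos_of_ne_zero d.n_ne_zero) (Nat.pos_of_ne_zero hcp)
  apply Nat.eq_of_mul_eq_mul_left hpos
  rw [h]
  conv_lhs => rw [hc]
  ring

end MetacyclicData

namespace MetacyclicFactorization

/-- The factorization with factors `⟨a⟩` and `⟨b⟩`. -/
def ofGenerators (a b : G) (h : (Subgroup.zpowers a).Normal)
    (hg : ∀ g : G, ∃ (j : ℕ) (i : ℤ), g = b ^ j * a ^ i) : MetacyclicFactorization G where
  A := Subgroup.zpowers a
  B := Subgroup.zpowers b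
  normal := h
  cyclic_A := inferInstance
  cyclic_B := inferInstance
  mul_eq := by
    rw [Set.eq_univ_iff_forall]
    intro g
    obtain ⟨j, i, hji⟩ := hg g⁻¹
    have : g = a ^ (-i) * b ^ (-(j : ℤ)) := by
      rw [← inv_inv g, hji]; simp [mul_inv_rev]
    rw [this]
    exact Set.mul_mem_mul (Subgroup.zpow_mem_zpowers ..) (Subgroup.zpow_mem_zpowers ..)

theorem m_ofGenerators (a b : G) (h : (Subgroup.zpowers a).Normal)
    (hg : ∀ g : G, ∃ (j : ℕ) (i : ℤ), g = b ^ j * a ^ i) :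
    (ofGenerators a b h hg).m = orderOf a := Nat.card_zpowers a

variable [Finite G]

theorem m_ne_zero (F : MetacyclicFactorization G) : F.m ≠ 0 := Nat.card_pos.ne'

/-- The data `D` describes the factorization `F`. -/
structure Describes (F : MetacyclicFactorization G) (a b : G) (k t : ℤ) : Prop where
  data : MetacyclicData a b F.m F.n k t
  hA : F.A = Subgroup.zpowers a
  hB : F.B = Subgroup.zpowers b
  hs : F.s = Int.gcd k F.m
  hT : ∃ u : (ZMod F.m)ˣ, (u : ZMod F.m) = t ∧ F.T = Subgroup.zpowers u

/-- `A` is abelian and acts trivially on itself, so in `G = AB` the induced automorphisms all come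
from powers of `b`. -/
theorem T_eq_zpowers (F : MetacyclicFactorization G) {a b : G}
    (hA : F.A = Subgroup.zpowers a) (hB : F.B = Subgroup.zpowers b) :
    ∃ u : (ZMod F.m)ˣ, F.T = Subgroup.zpowers u ∧
      b⁻¹ * a * b = a ^ ((u : ZMod F.m).val) := by
  have := F.normal
  have := F.cyclic_A
  have haA : a ∈ F.A := hA ▸ Subgroup.mem_zpowers a
  refine ⟨IsCyclic.mulAutMulEquiv F.A (MulAut.conjNormal b⁻¹), ?_, ?_⟩
  · have hr : (MulAut.conjNormal : G →* MulAut F.A).range =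
        Subgroup.zpowers (MulAut.conjNormal b⁻¹) := by
      apply le_antisymm
      · rintro _ ⟨g, rfl⟩
        obtain ⟨x, hx, y, hy, hxy⟩ : g⁻¹⁻¹ ∈ (F.A : Set G) * (F.B : Set G) := by
          rw [F.mul_eq]; trivial
        have hg : g = x * y := by simpa using hxy.symm
        have hx1 : (MulAut.conjNormal x : MulAut F.A) = 1 := by
          ext z
          obtain ⟨z, hz⟩ := z
          rw [hA] at hz
          have hx' : x ∈ Subgroup.zpowers a := hA ▸ hx
          obtain ⟨i, rfl⟩ := Subgroup.mem_zpowers_iff.1 hx'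
          obtain ⟨l, rfl⟩ := Subgroup.mem_zpowers_iff.1 hz
          rw [MulAut.conjNormal_apply]
          simp only [MulAut.one_apply]
          group
        have hy' : y ∈ Subgroup.zpowers b := hB ▸ hy
        obtain ⟨i, rfl⟩ := Subgroup.mem_zpowers_iff.1 hy'
        rw [hg, map_mul, hx1, one_mul, map_zpow]
        refine ⟨-i, ?_⟩
        simp
      · rw [Subgroup.zpowers_le]
        exact ⟨_, rfl⟩
    unfold T
    rw [hr]
    exact MonoidHom.map_zpowers (IsCyclic.mulAutMulEquiv F.A).toMonoidHom _
  · have h := mulAutMulEquiv_spec F.A (MulAut.conjNormal b⁻¹) ⟨a, haA⟩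
    have h' := congrArg (Subtype.val) h
    rw [MulAut.conjNormal_apply, inv_inv] at h'
    exact h'

theorem exists_describes_of_zpowers (F : MetacyclicFactorization G) {a b : G}
    (hA : F.A = Subgroup.zpowers a) (hB : F.B = Subgroup.zpowers b) :
    ∃ k t, F.Describes a b k t := by
  have := F.normal
  have hne : NeZero F.m := ⟨F.m_ne_zero⟩
  obtain ⟨u, hT, hc⟩ := F.T_eq_zpowers hA hB
  have hN : (Subgroup.zpowers a).Normal := hA ▸ F.normal
  have hgen : ∀ g : G, ∃ (j : ℕ) (i : ℤ), g = b ^ j * a ^ i := by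
    intro g
    obtain ⟨x, hx, y, hy, hxy⟩ : g⁻¹ ∈ (F.A : Set G) * (F.B : Set G) := by
      rw [F.mul_eq]; trivial
    have hx' : x ∈ Subgroup.zpowers a := hA ▸ hx
    have hy' : y⁻¹ ∈ Subgroup.zpowers b := inv_mem (hB ▸ hy)
    obtain ⟨i, rfl⟩ := Subgroup.mem_zpowers_iff.1 hx'
    obtain ⟨j, hj⟩ := (mem_powers_iff_mem_zpowers).2 hy'
    refine ⟨j, -i, ?_⟩
    simp only at hj hxy
    rw [hj, zpow_neg, ← mul_inv_rev, hxy, inv_inv]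
  have hpow : ∀ j : ℕ, b ^ j ∈ Subgroup.zpowers a ↔ F.n ∣ j := by
    rw [n, hA]
    exact pow_mem_zpowers_iff_index_dvd hN hgen
  obtain ⟨k, hk⟩ := Subgroup.mem_zpowers_iff.1 ((hpow F.n).2 dvd_rfl)
  have hd : MetacyclicData a b F.m F.n k ((u : ZMod F.m).val : ℤ) :=
    { order := by rw [← Nat.card_zpowers, m, hA]
      conj := by rw [hc, zpow_natCast]
      pow := hk.symm
      dvd_of_mem := fun j => (hpow j).1
      gen := hgen }
  refine ⟨k, ((u : ZMod F.m).val : ℤ), hd, hA, hB, ?_, u, ?_, hT⟩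
  · rw [← hd.index_zpowers_b, s, hB]
  · rw [Int.cast_natCast, ZMod.natCast_zmod_val]

theorem exists_describes (F : MetacyclicFactorization G) : ∃ a b k t, F.Describes a b k t := by
  obtain ⟨a, ha⟩ := F.A.isCyclic_iff_exists_zpowers_eq_top.1 F.cyclic_A
  obtain ⟨b, hb⟩ := F.B.isCyclic_iff_exists_zpowers_eq_top.1 F.cyclic_B
  exact ⟨a, b, F.exists_describes_of_zpowers ha.symm hb.symm⟩

end MetacyclicFactorization

namespace MetacyclicData

variable [Finite G] {a b : G} {m n : ℕ} {k t : ℤ}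

open MetacyclicFactorization in
theorem exists_factorization (d : MetacyclicData a b m n k t) :
    ∃ F : MetacyclicFactorization G, F.m = m ∧ F.n = n ∧ F.Describes a b k t := by
  have hN : (Subgroup.zpowers a).Normal := by simpa using d.normal_zpowers_zpow 1
  let F := ofGenerators a b hN d.gen
  have hm : F.m = m := by rw [← d.order]; exact m_ofGenerators a b hN d.gen
  have hn : F.n = n := d.index_zpowers
  have hne : NeZero F.m := ⟨F.m_ne_zero⟩
  refine ⟨F, hm, hn, by rw [hm, hn]; exact d, rfl, rfl, by rw [hm]; exact d.index_zpowers_b, ?_⟩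
  obtain ⟨u, hu, hc⟩ := F.T_eq_zpowers (a := a) (b := b) rfl rfl
  refine ⟨u, ?_, hu⟩
  rw [d.conj, ← zpow_natCast, zpow_eq_zpow_iff_dvd d.order, ← hm,
    ← ZMod.intCast_eq_intCast_iff_dvd_sub] at hc
  rw [← hc, Int.cast_natCast, ZMod.natCast_zmod_val]

end MetacyclicData

end MetacyclicData

/-! ### Nilpotency, and the collapse of `m'` to `r`. -/

section Nilpotent

open scoped commutatorElement

variable {G : Type*} [Group G]

namespace MetacyclicData

variable {a b : G} {m n : ℕ} {k t : ℤ}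

/-- All commutators lie in `⟨a ^ (t - 1)⟩`: the two products have the same exponent of `b`, and
their exponents of `a` agree modulo `t - 1`. -/
theorem exists_mul_eq_mul_mul_zpow (d : MetacyclicData a b m n k t) (g h : G) :
    ∃ c : ℤ, g * h = h * g * a ^ ((t - 1) * c) := by
  obtain ⟨j, i, rfl⟩ := d.gen g
  obtain ⟨x, y, rfl⟩ := d.gen h
  obtain ⟨c₁, hc₁⟩ := _root_.dvd_pow_sub_one (dvd_refl (t - 1)) x
  obtain ⟨c₂, hc₂⟩ := _root_.dvd_pow_sub_one (dvd_refl (t - 1)) j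
  refine ⟨i * c₁ - y * c₂, ?_⟩
  rw [mul_mul_mul_of_conj d.conj, mul_mul_mul_of_conj d.conj, mul_assoc, ← zpow_add, add_comm x j]
  congr 2
  linear_combination i * hc₁ - y * hc₂

/-- Each commutator with `b⁻¹` multiplies the exponent of `a` by `1 - t`; when the lower central
series ends, `m` divides a power of `1 - t`. -/
theorem prime_dvd_sub_one (d : MetacyclicData a b m n k t) [hG : Group.IsNilpotent G] {p : ℕ}
    (hp : p.Prime) (hpm : p ∣ m) : (p : ℤ) ∣ t - 1 := by
  obtain ⟨N, hN⟩ := Subgroup.nilpotent_iff_lowerCentralSeries.1 hG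
  have key : ∀ i : ℕ, a ^ ((1 - t) ^ i) ∈ (⊤ : Subgroup G).lowerCentralSeries i := by
    intro i
    induction i with
    | zero => simp
    | succ i ih =>
      have h1 : a ^ ((1 - t) ^ (i + 1)) = ⁅a ^ ((1 - t) ^ i), b⁻¹⁆ := by
        have h2 := zpow_mul_pow_of_conj d.conj (-(1 - t) ^ i) 1
        rw [pow_one, pow_one, zpow_neg] at h2
        rw [commutatorElement_def, inv_inv, mul_assoc, mul_assoc, h2, inv_mul_cancel_left,
          ← zpow_add]
        congr 1; ring
      rw [h1, Subgroup.lowerCentralSeries_succ]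
      exact Subgroup.commutator_mem_commutator ih (Subgroup.mem_top _)
  have h := key N
  rw [hN, Subgroup.mem_bot, zpow_eq_one_iff_dvd d.order] at h
  have h1 : (p : ℤ) ∣ (1 - t) ^ N := (Int.natCast_dvd_natCast.2 hpm).trans h
  have h2 := (Nat.prime_iff_prime_int.1 hp).dvd_of_dvd_pow h1
  rw [← dvd_neg]; simpa using h2

variable [Finite G]

theorem isNilpotent (d : MetacyclicData a b m n k t)
    (h : ∀ p : ℕ, p.Prime → p ∣ m → (p : ℤ) ∣ t - 1) : Group.IsNilpotent G := by
  rw [Subgroup.nilpotent_iff_lowerCentralSeries]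
  have key : ∀ i : ℕ, (⊤ : Subgroup G).lowerCentralSeries (i + 1) ≤
      Subgroup.zpowers (a ^ ((t - 1) ^ (i + 1))) := by
    intro i
    induction i with
    | zero =>
      have hN := d.normal_zpowers_zpow (t - 1)
      rw [Subgroup.lowerCentralSeries_succ, Subgroup.commutator_le]
      rintro g - h -
      obtain ⟨c, hc⟩ := d.exists_mul_eq_mul_mul_zpow g h
      have : ⁅g, h⁆ = (h * g) * a ^ ((t - 1) * c) * (h * g)⁻¹ := by
        rw [commutatorElement_def, hc]; group
      rw [this, zero_add, pow_one]
      exact hN.conj_mem _ (by rw [zpow_mul]; exact Subgroup.zpow_mem_zpowers ..) _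
    | succ i ih =>
      have hN := d.normal_zpowers_zpow ((t - 1) ^ (i + 1 + 1))
      rw [Subgroup.lowerCentralSeries_succ, Subgroup.commutator_le]
      rintro g hg h -
      obtain ⟨y, rfl⟩ := Subgroup.mem_zpowers_iff.1 (ih hg)
      obtain ⟨j, l, rfl⟩ := d.gen h
      obtain ⟨c, hc⟩ := _root_.dvd_pow_sub_one (dvd_refl (t - 1)) j
      have h1 := zpow_mul_pow_of_conj d.conj ((t - 1) ^ (i + 1) * y) j
      rw [zpow_mul] at h1
      have h2 : ⁅(a ^ (t - 1) ^ (i + 1)) ^ y, b ^ j * a ^ l⁆ = (b ^ j * a ^ l) *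
          a ^ ((t - 1) ^ (i + 1 + 1) * (y * c)) * (b ^ j * a ^ l)⁻¹ := by
        have h3 : (t - 1) ^ (i + 1 + 1) * (y * c) =
            (t - 1) ^ (i + 1) * y * t ^ j - (t - 1) ^ (i + 1) * y := by
          linear_combination -(t - 1) ^ (i + 1) * y * hc
        rw [commutatorElement_def, ← mul_assoc, h1, h3, zpow_sub, ← zpow_mul]
        group
      rw [h2]
      exact hN.conj_mem _ (by rw [zpow_mul]; exact Subgroup.zpow_mem_zpowers ..) _
  -- Every prime exponent in `m` is less than `m`, so this many factors `t - 1` suffice.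
  refine ⟨m + 1, ?_⟩
  rw [eq_bot_iff]
  refine (key m).trans ?_
  rw [Subgroup.zpowers_le, Subgroup.mem_bot, zpow_eq_one_iff_dvd d.order]
  apply intDvd_of_forall_pPart d.m_ne_zero
  intro p hp
  have h1 := h p (Nat.prime_of_mem_primeFactors hp) (Nat.dvd_of_mem_primeFactors hp)
  rw [pPart, Nat.cast_pow]
  refine dvd_trans (pow_dvd_pow_of_dvd h1 _) (pow_dvd_pow _ ?_)
  exact (Nat.factorization_lt p d.m_ne_zero).le.trans (Nat.le_succ m)

end MetacyclicData

theorem natCard_subgroup_units_zmod_one {q : ℕ} (hq : q = 1) (H : Subgroup (ZMod q)ˣ) :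
    Nat.card H = 1 := by
  subst hq
  have : Subsingleton H := ⟨fun x y => Subtype.ext (Subsingleton.elim _ _)⟩
  exact Nat.card_unique

theorem prod_pPart_primeFactors {k : ℕ} (hk : k ≠ 0) : ∏ p ∈ k.primeFactors, pPart p k = k :=
  Nat.prod_factorization_pow_eq_self hk

namespace MetacyclicFactorization

variable {F : MetacyclicFactorization G} {a b : G} {k t : ℤ}

theorem Describes.plus_or_minus (d : F.Describes a b k t) :
    (4 ∣ F.m → (4 : ℤ) ∣ t - 1) ∨ (4 ∣ F.m ∧ (4 : ℤ) ∣ t + 1) := by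
  obtain ⟨u, hu, hT⟩ := d.hT
  exact _root_.plus_or_minus hu

variable [Finite G]

theorem Describes.plus (d : F.Describes a b k t) (h4 : 4 ∣ F.m → (4 : ℤ) ∣ t - 1) :
    F.r = Int.gcd (t - 1) F.m ∧ F.eps = 1 := by
  obtain ⟨u, hu, hT⟩ := d.hT
  rw [r, eps, hT]
  exact ⟨invR_plus F.m_ne_zero hu h4, invEps_plus F.m_ne_zero hu h4⟩

theorem Describes.minus (d : F.Describes a b k t) (h4 : 4 ∣ F.m) (ht : (4 : ℤ) ∣ t + 1) :
    F.r = minusR F.m t ∧ F.eps = -1 := by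
  obtain ⟨u, hu, hT⟩ := d.hT
  rw [r, eps, hT]
  exact ⟨invR_minus F.m_ne_zero hu ht, invEps_minus F.m_ne_zero hu h4 ht⟩

theorem Describes.eps_eq_one_iff (d : F.Describes a b k t) :
    F.eps = 1 ↔ (4 ∣ F.m → (4 : ℤ) ∣ t - 1) := by
  rcases d.plus_or_minus with h | ⟨h, h'⟩
  · simp only [(d.plus h).2, true_iff]; exact h
  · rw [(d.minus h h').2]
    refine iff_of_false (by norm_num) fun h1 => ?_
    have := h1 h
    omega

theorem Describes.r_dvd (d : F.Describes a b k t) : F.r ∣ F.m := by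
  rcases d.plus_or_minus with h | ⟨h, h'⟩
  · rw [(d.plus h).1]; exact gcd_sub_one_dvd _ _
  · rw [(d.minus h h').1]; exact minusR_dvd _ _

theorem Describes.primeFactors_r (d : F.Describes a b k t)
    (hp : ∀ p : ℕ, p.Prime → p ∣ F.m → (p : ℤ) ∣ t - 1) :
    F.r.primeFactors = F.m.primeFactors := by
  apply Finset.Subset.antisymm (Nat.primeFactors_mono d.r_dvd F.m_ne_zero)
  intro p hpm
  have hp' := Nat.prime_of_mem_primeFactors hpm
  have hpd := Nat.dvd_of_mem_primeFactors hpm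
  refine Nat.mem_primeFactors.2 ⟨hp', ?_, ne_zero_of_dvd_ne_zero F.m_ne_zero d.r_dvd⟩
  have h1 : p ∣ Int.gcd (t - 1) (pPart p F.m) :=
    Int.dvd_gcd (hp p hp' hpd) (Int.natCast_dvd_natCast.2 (dvd_pPart hp' F.m_ne_zero hpd))
  rcases d.plus_or_minus with h | ⟨h, h'⟩
  · rw [(d.plus h).1]
    rw [← pPart_gcd hp' F.m_ne_zero] at h1
    exact h1.trans (pPart_dvd _ _)
  · rw [(d.minus h h').1]
    rcases eq_or_ne p 2 with rfl | h2
    · exact dvd_trans (by norm_num) (four_dvd_minusR F.m_ne_zero h h')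
    · rw [← pPart_minusR F.m_ne_zero hp' h2] at h1
      exact h1.trans (pPart_dvd _ _)

theorem Describes.oddPart_r_dvd (d : F.Describes a b k t) : (oddPart F.r : ℤ) ∣ t - 1 := by
  rcases d.plus_or_minus with h | ⟨h, h'⟩
  · rw [(d.plus h).1]
    exact (Int.natCast_dvd_natCast.2 (oddPart_dvd _)).trans (Int.gcd_dvd_left ..)
  · rw [(d.minus h h').1, oddPart_minusR F.m_ne_zero]; exact Int.gcd_dvd_left ..

theorem Describes.pPart_two_r_dvd (d : F.Describes a b k t) :
    (pPart 2 F.r : ℤ) ∣ t - F.eps := by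
  rcases d.plus_or_minus with h | ⟨h, h'⟩
  · rw [(d.plus h).1, (d.plus h).2]
    exact (Int.natCast_dvd_natCast.2 (pPart_dvd _ _)).trans (Int.gcd_dvd_left ..)
  · rw [(d.minus h h').1, (d.minus h h').2, sub_neg_eq_add, pPart_two_minusR F.m_ne_zero]
    exact Int.gcd_dvd_left ..

theorem Describes.eps_eq (d : F.Describes a b k t) : F.eps = 1 ∨ F.eps = -1 := by
  rcases d.plus_or_minus with h | ⟨h, h'⟩
  · exact Or.inl (d.plus h).2
  · exact Or.inr (d.minus h h').2

theorem Describes.eps_pow (d : F.Describes a b k t) {p : ℕ} (hp : p.Prime) (h2 : p ≠ 2) :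
    F.eps ^ (p - 1) = 1 := by
  have he : Even (p - 1) := (hp.odd_of_ne_two h2).tsub_odd odd_one
  rcases d.eps_eq with h | h <;> rw [h]
  · simp
  · exact he.neg_one_pow

theorem Describes.pPart_r_dvd (d : F.Describes a b k t) {p : ℕ} (hp : p.Prime) :
    (pPart p F.r : ℤ) ∣ t - F.eps ^ (p - 1) := by
  rcases eq_or_ne p 2 with rfl | h2
  · simpa using d.pPart_two_r_dvd
  · rw [d.eps_pow hp h2,
      ← pPart_oddPart hp h2 (ne_zero_of_dvd_ne_zero F.m_ne_zero d.r_dvd)]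
    exact intDvd_pPart_of_dvd d.oddPart_r_dvd

/-- `π(r) = π(m)` empties `ν`, so `o` is the order of a group of units modulo 1. With `o = 1` the
minimum with `o_p r_p` decides the first branch and `o_p ≤ 2` the second. -/
theorem Describes.m'_eq (d : F.Describes a b k t)
    (hp : ∀ p : ℕ, p.Prime → p ∣ F.m → (p : ℤ) ∣ t - 1) : F.m' = F.r := by
  have hr0 := ne_zero_of_dvd_ne_zero F.m_ne_zero d.r_dvd
  have hpf := d.primeFactors_r hp
  have hnu : invNu F.T = ∅ := by
    rw [invNu]
    change F.m.primeFactors \ F.r.primeFactors = ∅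
    rw [hpf, Finset.sdiff_self]
  have hnp : nuPart F.T = 1 := by rw [nuPart, hnu, Finset.prod_empty]
  have ho : invO F.T = 1 := natCard_subgroup_units_zmod_one hnp _
  have hmp : ∀ p ∈ F.r.primeFactors, mPrime F.T F.n F.s p = pPart p F.r := by
    intro p hp
    have hp' := Nat.prime_of_mem_primeFactors hp
    have h1 : pPart p 1 = 1 := by simp [pPart]
    have hle : pPart p F.r ≤ pPart p F.m :=
      Nat.le_of_dvd (pPart_pos hp' _) (pPart_dvd_pPart p F.m_ne_zero d.r_dvd)
    unfold mPrime
    simp only [ho, h1]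
    change (if F.eps ^ (p - 1) = 1 then min (pPart p F.m) (min (1 * pPart p F.r)
      (max (pPart p F.r) _)) else if 1 ≤ 2 ∨ _ then pPart p F.r else _) = pPart p F.r
    split_ifs with h2 h3
    · rw [one_mul, min_eq_left (le_max_left _ _), min_eq_right hle]
    · rfl
    · exact absurd (Or.inl (by norm_num)) h3
    · exact absurd (Or.inl (by norm_num)) h3
  rw [m', bracket, hnp, one_mul]
  exact (Finset.prod_congr rfl hmp).trans (prod_pPart_primeFactors hr0)

theorem Describes.invariants_resUnits (d : F.Describes a b k t) {q : ℕ} (hq : q = F.r) :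
    invR (resUnits F.T q) = F.r ∧ invEps (resUnits F.T q) = F.eps := by
  have hr0 := ne_zero_of_dvd_ne_zero F.m_ne_zero d.r_dvd
  have hqm : q ∣ F.m := hq ▸ d.r_dvd
  obtain ⟨u, hu, hT⟩ := d.hT
  rw [hT, resUnits_zpowers u hqm]
  have hv := coe_unitsMap_eq hu hqm
  have hR : invR (Subgroup.zpowers (ZMod.unitsMap hqm u)) = F.r := by
    refine invR_zpowers_eq (hq ▸ hr0) hv (hq ▸ dvd_rfl) d.oddPart_r_dvd ?_
      fun e he _ _ => hq ▸ he
    rcases d.eps_eq with h | h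
    · left; simpa [h] using d.pPart_two_r_dvd
    · right; simpa [h] using d.pPart_two_r_dvd
  refine ⟨hR, ?_⟩
  rw [invEps_zpowers hv (hq ▸ dvd_rfl) hR]
  rw [eps, hT, invEps_zpowers hu d.r_dvd (by rw [← hT]; rfl)]

/-- The congruences give `x ≡ ε ^ (p - 1)` modulo `r_p`. This already forces `x` to be prime to `m`
and to agree with `t` modulo `r = m'`, so the condition on `Δ` is automatic. -/
theorem Describes.mem_tSet_iff (d : F.Describes a b k t)
    (hp : ∀ p : ℕ, p.Prime → p ∣ F.m → (p : ℤ) ∣ t - 1) (x : ℕ) :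
    x ∈ F.tSet ↔ ∀ p ∈ F.m.primeFactors,
      (x : ℤ) ≡ F.eps ^ (p - 1) + (pPart p F.r : ℤ) [ZMOD (pPart p F.m : ℤ)] := by
  have hm' := d.m'_eq hp
  have hr0 := ne_zero_of_dvd_ne_zero F.m_ne_zero d.r_dvd
  obtain ⟨hR, hE⟩ := d.invariants_resUnits hm'
  have hpf := d.primeFactors_r hp
  unfold tSet
  rw [Set.mem_ofPred_eq]
  unfold Delta
  rw [hR, hE, hpf]
  refine and_iff_right_of_imp fun hx => ?_
  have hmod : ∀ p ∈ F.m.primeFactors, (pPart p F.r : ℤ) ∣ x - F.eps ^ (p - 1) := by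
    intro p hpm
    have h1 := Int.modEq_iff_dvd.1 (hx p hpm).symm
    have h2 : (pPart p F.r : ℤ) ∣ pPart p F.m :=
      Int.natCast_dvd_natCast.2 (pPart_dvd_pPart p F.m_ne_zero d.r_dvd)
    have h3 := (h2.trans h1).add (dvd_refl (pPart p F.r : ℤ))
    have h4 : (x : ℤ) - F.eps ^ (p - 1) =
        x - (F.eps ^ (p - 1) + pPart p F.r) + pPart p F.r := by ring
    rw [h4]; exact h3
  have hcop : Nat.Coprime x F.m := by
    refine Nat.coprime_of_dvd fun p hp' hpx hpm => ?_
    have hmem := Nat.mem_primeFactors.2 ⟨hp', hpm, F.m_ne_zero⟩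
    have h1 : p ∣ F.r := Nat.dvd_of_mem_primeFactors (hpf ▸ hmem)
    have h2 : (p : ℤ) ∣ x - F.eps ^ (p - 1) :=
      (Int.natCast_dvd_natCast.2 (dvd_pPart hp' hr0 h1)).trans (hmod p hmem)
    have h3 : (p : ℤ) ∣ F.eps ^ (p - 1) :=
      (dvd_sub_right (Int.natCast_dvd_natCast.2 hpx)).1 h2
    have h4 := (Nat.prime_iff_prime_int.1 hp').dvd_of_dvd_pow h3
    rcases d.eps_eq with h | h <;> rw [h] at h4
    · exact (Nat.prime_iff_prime_int.1 hp').not_isUnit (isUnit_of_dvd_one h4)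
    · exact (Nat.prime_iff_prime_int.1 hp').not_isUnit (isUnit_of_dvd_unit h4 (by simp))
  refine ⟨hcop, ?_⟩
  obtain ⟨u, hu, hT⟩ := d.hT
  have hqm : F.m' ∣ F.m := hm' ▸ d.r_dvd
  rw [hT, resUnits_zpowers _ hqm, resUnits_zpowers _ hqm]
  congr 1
  rw [units_eq_iff_dvd (x := x) (y := t) (coe_unitsMap_eq (by simp) hqm) (coe_unitsMap_eq hu hqm),
    hm']
  apply intDvd_of_forall_pPart hr0
  intro p hpr
  have h1 := (hmod p (hpf ▸ hpr)).sub (d.pPart_r_dvd (Nat.prime_of_mem_primeFactors hpr))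
  rwa [sub_sub_sub_cancel_right] at h1

/-- The congruences fix a single class modulo `m`. -/
theorem Describes.isLeast_tSet_iff (d : F.Describes a b k t)
    (hp : ∀ p : ℕ, p.Prime → p ∣ F.m → (p : ℤ) ∣ t - 1) (x : ℕ) :
    IsLeast F.tSet x ↔ x < F.m ∧ ∀ p ∈ F.m.primeFactors,
      (x : ℤ) ≡ F.eps ^ (p - 1) + (pPart p F.r : ℤ) [ZMOD (pPart p F.m : ℤ)] := by
  rw [← d.mem_tSet_iff hp]
  constructor
  · rintro ⟨h1, h2⟩
    refine ⟨?_, h1⟩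
    have h3 : x % F.m ∈ F.tSet := by
      rw [d.mem_tSet_iff hp] at h1 ⊢
      intro p hpm
      refine Int.ModEq.trans ?_ (h1 p hpm)
      rw [Int.modEq_iff_dvd, Int.natCast_mod]
      refine (Int.natCast_dvd_natCast.2 (pPart_dvd p F.m)).trans ?_
      exact Int.dvd_self_sub_emod
    exact (h2 h3).trans_lt (Nat.mod_lt _ (Nat.pos_of_ne_zero F.m_ne_zero))
  · rintro ⟨h1, h2⟩
    refine ⟨h2, fun y hy => ?_⟩
    by_contra! hlt
    rw [d.mem_tSet_iff hp] at h2 hy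
    have h3 : (F.m : ℤ) ∣ x - y := by
      apply intDvd_of_forall_pPart F.m_ne_zero
      intro p hpm
      exact Int.modEq_iff_dvd.1 ((hy p hpm).trans (h2 p hpm).symm)
    have h4 := Int.le_of_dvd (by omega) h3
    omega

end MetacyclicFactorization

end Nilpotent

/-! ### Changes of generators and what minimality forbids. -/

section Minimal

variable {G : Type*} [Group G]

namespace MetacyclicData

variable {a b : G} {m n : ℕ} {k t : ℤ}

theorem mul_zpow_right (d : MetacyclicData a b m n k t) (y : ℤ) :
    MetacyclicData a (b * a ^ y) m n (k + y * ∑ l ∈ Finset.range n, t ^ l) t := by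
  have hpow : ∀ j : ℕ, (b * a ^ y) ^ j = b ^ j * a ^ (y * ∑ l ∈ Finset.range j, t ^ l) := by
    intro j
    have := mul_pow_of_conj d.conj 1 y j
    simpa using this
  refine ⟨d.order, ?_, ?_, fun j hj => d.dvd_of_mem j ?_, fun g => ?_⟩
  · have h1 : (b * a ^ y)⁻¹ * a * (b * a ^ y) = (a ^ y)⁻¹ * (b⁻¹ * a * b) * a ^ y := by group
    rw [h1, d.conj]; group
  · rw [hpow, d.pow, ← zpow_add]
  · rw [hpow] at hj
    exact (Subgroup.mul_mem_cancel_right _ (Subgroup.zpow_mem_zpowers ..)).1 hj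
  · obtain ⟨j, i, rfl⟩ := d.gen g
    refine ⟨j, i - y * ∑ l ∈ Finset.range j, t ^ l, ?_⟩
    rw [hpow, mul_assoc, ← zpow_add]
    congr 2; ring

/-- Such a subgroup contains every commutator. This makes new choices of `A` available. -/
theorem normal_of_zpow_mem (d : MetacyclicData a b m n k t) {H : Subgroup G}
    (h : a ^ (t - 1) ∈ H) : H.Normal := by
  constructor
  intro x hx g
  obtain ⟨c, hc⟩ := d.exists_mul_eq_mul_mul_zpow x g⁻¹
  have : g * x * g⁻¹ = x * (a ^ (t - 1)) ^ c := by
    rw [mul_assoc, hc, zpow_mul]; group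
  rw [this]
  exact H.mul_mem hx (H.zpow_mem h c)

theorem gen_of_eq_pow_mul [Finite G] (d : MetacyclicData a b m n k t) {a' : G}
    (hN : (Subgroup.zpowers a').Normal) {x : ℕ} (hx : a' = b ^ x * a) (g : G) :
    ∃ (j : ℕ) (i : ℤ), g = b ^ j * a' ^ i := by
  have ha : a ∈ Subgroup.zpowers b ⊔ Subgroup.zpowers a' := by
    have : a = (b ^ x)⁻¹ * a' := by rw [hx]; group
    rw [this]
    exact mul_mem (inv_mem (pow_mem (Subgroup.mem_sup_left (Subgroup.mem_zpowers b)) x))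
      (Subgroup.mem_sup_right (Subgroup.mem_zpowers a'))
  have hg : g ∈ Subgroup.zpowers b ⊔ Subgroup.zpowers a' := by
    obtain ⟨j, i, rfl⟩ := d.gen g
    exact mul_mem (pow_mem (Subgroup.mem_sup_left (Subgroup.mem_zpowers b)) j) (zpow_mem ha i)
  obtain ⟨y, hy, z, hz, rfl⟩ := Subgroup.mem_sup_of_normal_right.1 hg
  obtain ⟨i, rfl⟩ := Subgroup.mem_zpowers_iff.1 hz
  obtain ⟨j, hj⟩ := (mem_powers_iff_mem_zpowers).2 hy
  exact ⟨j, i, by rw [← hj]⟩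

end MetacyclicData

namespace MetacyclicFactorization

variable {F : MetacyclicFactorization G} {a b : G} {k t : ℤ}

theorem IsMinimal.m_le (h : F.IsMinimal) (F' : MetacyclicFactorization G) : F.m ≤ F'.m := by
  rcases Prod.Lex.toLex_le_toLex.1 (h F') with h | ⟨h, -⟩
  · exact h.le
  · exact h.le

theorem IsMinimal.r_le (h : F.IsMinimal) {F' : MetacyclicFactorization G} (hm : F'.m = F.m) :
    F.r ≤ F'.r := by
  rcases Prod.Lex.toLex_le_toLex.1 (h F') with h | ⟨-, h⟩
  · exact absurd hm h.ne'
  · rcases Prod.Lex.toLex_le_toLex.1 h with h | ⟨h, -⟩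
    · exact h.le
    · exact h.le

theorem IsMinimal.s_le (h : F.IsMinimal) {F' : MetacyclicFactorization G} (hm : F'.m = F.m)
    (hr : F'.r = F.r) : F.s ≤ F'.s := by
  rcases Prod.Lex.toLex_le_toLex.1 (h F') with h | ⟨-, h⟩
  · exact absurd hm h.ne'
  · rcases Prod.Lex.toLex_le_toLex.1 h with h | ⟨-, h⟩
    · exact absurd hr h.ne'
    · exact h

theorem Describes.s_dvd_m (d : F.Describes a b k t) : F.s ∣ F.m := by
  rw [d.hs]; exact Int.natCast_dvd_natCast.1 (Int.gcd_dvd_right ..)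

theorem Describes.m_dvd (d : F.Describes a b k t) : F.m ∣ F.s * Int.gcd (t - 1) F.m := by
  have h := d.data.dvd_mul_sub_one
  have h1 : (F.m : ℤ) ∣ (Int.gcd k F.m : ℤ) * (t - 1) := by
    rw [Int.gcd_eq_gcd_ab, add_mul]
    refine dvd_add ?_ ((dvd_mul_right _ _).mul_right _)
    have : k * k.gcdA F.m * (t - 1) = k * (t - 1) * k.gcdA F.m := by ring
    rw [this]; exact h.mul_right _
  have h2 : (F.m : ℤ) ∣ (F.s : ℤ) * (Int.gcd (t - 1) F.m : ℤ) := by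
    rw [d.hs, Int.gcd_eq_gcd_ab (t - 1), mul_add]
    refine dvd_add ?_ ?_
    · rw [← mul_assoc]; exact h1.mul_right _
    · exact ((dvd_mul_right _ _).mul_left _)
  exact_mod_cast h2

variable [Finite G]

theorem Describes.r_eq_of_m_eq {F' : MetacyclicFactorization G} {a' b' : G} {k' : ℤ}
    (d : F.Describes a b k t) (d' : F'.Describes a' b' k' t) (hm : F'.m = F.m) : F'.r = F.r := by
  rcases d.plus_or_minus with h | ⟨h, h'⟩
  · rw [(d.plus h).1, (d'.plus (hm ▸ h)).1, hm]
  · rw [(d.minus h h').1, (d'.minus (hm ▸ h) h').1, hm]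

/-- Replacing `b` by `b * a ^ y` keeps `m` and `r` and adds `y` times the sum to `k`; apply
`gcd_dvd_of_forall_gcd_le`. -/
theorem IsMinimal.s_dvd_geom_sum (hF : F.IsMinimal) (d : F.Describes a b k t) :
    (F.s : ℤ) ∣ ∑ l ∈ Finset.range F.n, t ^ l := by
  rw [d.hs]
  refine gcd_dvd_of_forall_gcd_le F.m_ne_zero fun y => ?_
  obtain ⟨F', hm, hn, d'⟩ := (d.data.mul_zpow_right (y : ℤ)).exists_factorization
  have h := hF.s_le hm (d.r_eq_of_m_eq d' hm)
  rwa [d.hs, d'.hs, hm] at h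

/-- Let `p ^ e` and `p ^ f` be the p-parts of `s` and of the gcd, with `e < f`. A suitable `a' = b ^
(c * j) * a` has `a' ^ (p ^ e) = a ^ E` with `p ^ f` the exact p-part of `E`. Its order is then at
most `p ^ e * (m / p ^ f) < m`, yet `⟨a'⟩` still contains `a ^ (t - 1)` and so is normal. -/
theorem IsMinimal.pPart_gcd_dvd (hF : F.IsMinimal) (d : F.Describes a b k t)
    (hnil : ∀ p : ℕ, p.Prime → p ∣ F.m → (p : ℤ) ∣ t - 1) {p : ℕ} (hp : p.Prime)
    (hsn : pPart p F.s ∣ F.n) : pPart p (Int.gcd (t - 1) F.m) ∣ F.s := by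
  have hm0 := F.m_ne_zero
  have hn0 := d.data.n_ne_zero
  have hs0 : F.s ≠ 0 := ne_zero_of_dvd_ne_zero hm0 d.s_dvd_m
  have hg0 : Int.gcd (t - 1) F.m ≠ 0 := ne_zero_of_dvd_ne_zero hm0 (gcd_sub_one_dvd _ _)
  by_contra hcon
  set e := F.s.factorization p with he
  set f := (Int.gcd (t - 1) F.m).factorization p with hf
  have hef : e < f := by
    by_contra! h
    exact hcon ((pow_dvd_pow p h).trans (pPart_dvd p F.s))
  have hft : ((p ^ f : ℕ) : ℤ) ∣ t - 1 :=
    (Int.natCast_dvd_natCast.2 (pPart_dvd p _)).trans (Int.gcd_dvd_left ..)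
  have hfm : p ^ f ∣ F.m := (pPart_dvd p _).trans (gcd_sub_one_dvd _ _)
  set M := F.m / pPart p F.m with hM
  have hMm : pPart p F.m * M = F.m := Nat.mul_div_cancel' (pPart_dvd p F.m)
  have hMd : M ∣ F.m := ⟨_, by rw [mul_comm]; exact hMm.symm⟩
  have hpM : Nat.Coprime p M := Nat.coprime_ordCompl hp hm0
  obtain ⟨c₀, hc₀⟩ := hsn
  change F.n = p ^ e * c₀ at hc₀
  -- `c * p ^ e = n * M` puts `b ^ (c * p ^ e)` in `A`, and the factor `M` makes `t ^ c ≡ 1` modulo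
  -- the prime-to-p part `M` of `m`.
  set c := c₀ * M with hc
  have hcn : c * p ^ e = F.n * M := by rw [hc₀, hc]; ring
  have hk1 : ((p ^ e : ℕ) : ℤ) ∣ k * M := by
    refine Dvd.dvd.mul_right ?_ _
    refine (Int.natCast_dvd_natCast.2 (pPart_dvd p F.s)).trans ?_
    rw [d.hs]; exact Int.gcd_dvd_left ..
  have hk2 : ¬ ((p ^ (e + 1) : ℕ) : ℤ) ∣ k * M := by
    intro h
    have h1 : ((p ^ (e + 1) : ℕ) : ℤ) ∣ k :=
      IsCoprime.dvd_of_dvd_mul_right (Nat.isCoprime_iff_coprime.2 (hpM.pow_left _)) h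
    have h2 : p ^ (e + 1) ∣ F.s := by
      rw [d.hs]
      exact Int.dvd_gcd h1 (Int.natCast_dvd_natCast.2 ((pow_dvd_pow p hef).trans hfm))
    have := (hp.pow_dvd_iff_le_factorization hs0).1 h2
    omega
  obtain ⟨j, hj1, hj2⟩ := exists_mul_add_geom_sum hp hef hk1 hk2 (_root_.dvd_pow_sub_one hft c)
  set E : ℤ := j * (k * M) + ∑ l ∈ Finset.range (p ^ e), ((t ^ c) ^ j) ^ l with hE
  set a' := b ^ (c * j) * a with ha'
  have hpow : a' ^ (p ^ e) = a ^ E := by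
    have h1 := mul_pow_of_conj d.data.conj (c * j) 1 (p ^ e)
    rw [zpow_one] at h1
    have h2 : c * j * p ^ e = F.n * (M * j) := by rw [mul_right_comm, hcn]; ring
    have h3 : b ^ (F.n * (M * j)) = a ^ (k * ((M * j : ℕ) : ℤ)) := by
      rw [pow_mul, d.data.pow, ← zpow_natCast, ← zpow_mul]
    rw [ha', h1, h2, h3, ← zpow_add, hE]
    simp only [pow_mul]
    congr 1
    push_cast
    ring
  -- At `p` this is the choice of `j`. At a prime `q ∣ M` one has `E ≡ p ^ e` modulo `q`, which is
  -- not zero.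
  have hgE : Int.gcd E F.m ∣ p ^ f := by
    rw [Nat.dvd_iff_prime_pow_dvd_dvd]
    intro q i hq hqi
    have hqE : ((q ^ i : ℕ) : ℤ) ∣ E :=
      (Int.natCast_dvd_natCast.2 hqi).trans (Int.gcd_dvd_left ..)
    have hqm : q ^ i ∣ F.m := hqi.trans (Int.natCast_dvd_natCast.1 (Int.gcd_dvd_right ..))
    rcases eq_or_ne q p with rfl | hqp
    · refine pow_dvd_pow q ?_
      by_contra! hlt
      exact hj2 ((Int.natCast_dvd_natCast.2 (pow_dvd_pow q hlt)).trans hqE)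
    · rcases Nat.eq_zero_or_pos i with rfl | hi
      · simp
      exfalso
      have hqE' : (q : ℤ) ∣ E := (Int.natCast_dvd_natCast.2 (dvd_pow_self q hi.ne')).trans hqE
      have hqM : q ∣ M := by
        have h1 : q ∣ pPart p F.m * M := by rw [hMm]; exact (dvd_pow_self q hi.ne').trans hqm
        rcases hq.dvd_mul.1 h1 with h | h
        · exact absurd ((Nat.prime_dvd_prime_iff_eq hq hp).1 (hq.dvd_of_dvd_pow h)) hqp
        · exact h
      have h1 : (M : ℤ) ∣ t ^ c - 1 := dvd_pow_sub_one_of_forall_prime (dvd_mul_left _ _)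
        fun q hq hqM => hnil q hq (hqM.trans hMd)
      have h2 := geom_sum_sub_dvd (_root_.dvd_pow_sub_one h1 j) (p ^ e)
      have h3 : (q : ℤ) ∣ E - ((p ^ e : ℕ) : ℤ) := by
        have h4 := ((Int.natCast_dvd_natCast.2 hqM).trans h2).add
          (((Int.natCast_dvd_natCast.2 hqM).mul_left k).mul_left (j : ℤ))
        have h5 : E - ((p ^ e : ℕ) : ℤ) = ∑ l ∈ Finset.range (p ^ e), ((t ^ c) ^ j) ^ l -
          ((p ^ e : ℕ) : ℤ) + j * (k * M) := by rw [hE]; ring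
        rw [h5]; exact h4
      have h6 := (dvd_sub_right hqE').1 h3
      exact hqp ((Nat.prime_dvd_prime_iff_eq hq hp).1
        (hq.dvd_of_dvd_pow (Int.natCast_dvd_natCast.1 h6)))
  have hmem : a ^ (t - 1) ∈ Subgroup.zpowers a' := by
    have h1 : a ^ (t - 1) ∈ Subgroup.zpowers (a ^ E) :=
      zpow_mem_zpowers_zpow d.data.order ((Int.natCast_dvd_natCast.2 hgE).trans hft)
    refine (Subgroup.zpowers_le.2 ?_) h1
    rw [← hpow]; exact Subgroup.npow_mem_zpowers ..
  have hN := d.data.normal_of_zpow_mem hmem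
  have hle := hF.m_le (ofGenerators a' b hN (d.data.gen_of_eq_pow_mul hN ha'))
  rw [m_ofGenerators] at hle
  obtain ⟨w, hw⟩ := hfm
  have hw0 : 0 < w := Nat.pos_of_ne_zero (by rintro rfl; exact hm0 (by simpa using hw))
  have hord : orderOf a' ∣ p ^ e * w := by
    rw [orderOf_dvd_iff_pow_eq_one, pow_mul, hpow, ← zpow_natCast, ← zpow_mul,
      zpow_eq_one_iff_dvd d.data.order, hw, Nat.cast_mul]
    exact mul_dvd_mul_right hj1 _
  have h1 := Nat.le_of_dvd (Nat.mul_pos (pow_pos hp.pos e) hw0) hord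
  have h2 : p ^ e * w < p ^ f * w :=
    Nat.mul_lt_mul_of_pos_right (Nat.pow_lt_pow_right hp.one_lt hef) hw0
  omega

end MetacyclicFactorization

end Minimal

/-! ### The numerical conditions forced by minimality. -/

section Forward

variable {G : Type*} [Group G]

namespace MetacyclicFactorization

variable {F : MetacyclicFactorization G} {a b : G} {k t : ℤ}

theorem oddPart_dvd_pow_sub_one (hnil : ∀ p : ℕ, p.Prime → p ∣ F.m → (p : ℤ) ∣ t - 1) {N : ℕ}
    (hN : oddPart F.m ∣ N) : (oddPart F.m : ℤ) ∣ t ^ N - 1 :=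
  dvd_pow_sub_one_of_forall_prime hN fun p hp hpm => hnil p hp (hpm.trans (oddPart_dvd _))

theorem two_dvd_n_of_minus (d : F.Describes a b k t) (h4 : 4 ∣ F.m) (ht : (4 : ℤ) ∣ t + 1) :
    2 ∣ F.n := by
  by_contra h
  have hodd : Odd F.n := Nat.not_even_iff_odd.1 fun h' => h h'.two_dvd
  have h1 : (4 : ℤ) ∣ t ^ F.n - 1 := (Int.natCast_dvd_natCast.2 h4).trans d.data.dvd_pow_sub_one
  have h2 : t + 1 ∣ t ^ F.n + 1 := by simpa using hodd.add_dvd_pow_add_pow t 1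
  have := ht.trans h2
  omega

variable [Finite G]

/-- A factorization with `ε = -1` in which `r` and `s` have the `2`-parts of `m` and of `m / 2`
is not minimal. -/
theorem IsMinimal.pPart_two_s_ne (hF : F.IsMinimal) (d : F.Describes a b k t)
    (hnil : ∀ p : ℕ, p.Prime → p ∣ F.m → (p : ℤ) ∣ t - 1) (ht : (4 : ℤ) ∣ t + 1)
    (hn4 : 4 ∣ F.n) (hm8 : 8 ∣ F.m) (hr : (pPart 2 F.m : ℤ) ∣ t + 1) :
    2 * pPart 2 F.s ≠ pPart 2 F.m := by
  intro hs
  have hm0 := F.m_ne_zero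
  have hs0 : F.s ≠ 0 := ne_zero_of_dvd_ne_zero hm0 d.s_dvd_m
  set M := oddPart F.m with hM
  have hMm : pPart 2 F.m * M = F.m := pPart_mul_oddPart F.m
  have hMo : ¬ 2 ∣ M := not_two_dvd_oddPart hm0
  obtain ⟨m₁, hm₁⟩ : 2 ∣ F.m := dvd_trans (by norm_num) hm8
  have hm₁' : m₁ = pPart 2 F.s * M := by
    have : 2 * m₁ = 2 * (pPart 2 F.s * M) := by rw [← hm₁, ← mul_assoc, hs, hMm]
    omega
  have hm₁4 : 4 ∣ m₁ := by omega
  obtain ⟨n₁, hn₁⟩ : 2 ∣ F.n := dvd_trans (by norm_num) hn4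
  have hn₁2 : 2 ∣ n₁ := by omega
  -- `k * M ≡ m / 2` modulo `m`
  have hkM : (F.m : ℤ) ∣ k * M - m₁ := by
    have h1 : (pPart 2 F.s : ℤ) ∣ k := by
      refine (Int.natCast_dvd_natCast.2 (pPart_dvd 2 F.s)).trans ?_
      rw [d.hs]; exact Int.gcd_dvd_left ..
    obtain ⟨w, hw⟩ := h1
    have hwo : ¬ (2 : ℤ) ∣ w := by
      rintro ⟨w', rfl⟩
      have h2 : (pPart 2 F.m : ℤ) ∣ k := by
        rw [hw, ← hs]; push_cast; exact ⟨w', by ring⟩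
      have h3 : pPart 2 F.m ∣ F.s := by
        rw [d.hs]; exact Int.dvd_gcd h2 (Int.natCast_dvd_natCast.2 (pPart_dvd 2 F.m))
      have h4 := Nat.le_of_dvd (pPart_pos Nat.prime_two _)
        (prime_pow_dvd_pPart Nat.prime_two hs0 h3)
      have h5 := pPart_pos Nat.prime_two F.s
      have h6 : 2 * pPart 2 F.s ≤ pPart 2 F.s := hs ▸ h4
      omega
    obtain ⟨v, hv⟩ : (2 : ℤ) ∣ w - 1 := by omega
    refine ⟨v, ?_⟩
    rw [hw, hm₁, hm₁']
    push_cast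
    linear_combination (pPart 2 F.s : ℤ) * M * hv
  have hord := d.data.order
  -- `β` is a square root of `a ^ (m / 2)` that commutes with `a`; the factor `M` kills the odd part
  -- of `k` modulo `m` and of `t ^ n₁ - 1`.
  set β := b ^ (n₁ * M) with hβ
  have hβ2 : β ^ 2 = a ^ (m₁ : ℤ) := by
    rw [hβ, ← pow_mul, mul_right_comm, mul_comm n₁ 2, ← hn₁, pow_mul, d.data.pow, ← zpow_natCast,
      ← zpow_mul, zpow_eq_zpow_iff_dvd hord]
    exact hkM
  have hβ2' : β ^ (2 : ℤ) = a ^ (m₁ : ℤ) := by rw [← hβ2]; exact zpow_ofNat β 2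
  have htβ : (F.m : ℤ) ∣ t ^ (n₁ * M) - 1 := by
    apply intDvd_of_pPart_two_of_oddPart hm0
    · obtain ⟨n₂, rfl⟩ := hn₁2
      rw [mul_assoc, pow_mul]
      apply dvd_pow_sub_one
      have : t ^ 2 - 1 = (t + 1) * (t - 1) := by ring
      rw [this]; exact hr.mul_right _
    · exact oddPart_dvd_pow_sub_one hnil (dvd_mul_left _ _)
  have hcomm : Commute β a := by
    have h1 := zpow_mul_pow_of_conj d.data.conj 1 (n₁ * M)
    rw [zpow_one, one_mul] at h1
    have h2 : a ^ (t ^ (n₁ * M)) = a := by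
      conv_rhs => rw [← zpow_one a]
      exact (zpow_eq_zpow_iff_dvd hord _ _).2 htβ
    rw [h2] at h1
    exact h1.symm
  have hβm : β ^ F.m = 1 ∧ ∀ x : ℤ, β ^ (4 * x) = 1 := by
    have h4 : ∀ x : ℤ, β ^ (4 * x) = 1 := by
      intro x
      have : β ^ (4 * x) = (β ^ 2) ^ (2 * x) := by
        rw [← zpow_natCast, ← zpow_mul]; congr 1; push_cast; ring
      rw [this, hβ2, ← zpow_mul, zpow_eq_one_iff_dvd hord, hm₁]
      exact ⟨x, by push_cast; ring⟩
    refine ⟨?_, h4⟩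
    obtain ⟨x, hx⟩ : 4 ∣ F.m := dvd_trans (by norm_num) hm8
    rw [hx, ← zpow_natCast, Nat.cast_mul]; exact h4 x
  obtain ⟨hβm, hβ4⟩ := hβm
  -- Since `β ^ 4 = 1` and `8 ∣ m`, the twist by `β` does not change the order of `a`.
  set a' := β * a with ha'
  have hpow : ∀ x : ℤ, a' ^ x = β ^ x * a ^ x := fun x => hcomm.mul_zpow x
  have hord' : orderOf a' = F.m := by
    apply orderOf_eq_of_pow_and_pow_div_prime (Nat.pos_of_ne_zero hm0)
    · rw [← zpow_natCast, hpow, zpow_natCast, zpow_natCast, hβm, ← hord, pow_orderOf_eq_one, one_mul]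
    · intro p hp hpm
      obtain ⟨c, hc⟩ := hpm
      have hdiv : F.m / p = c := Nat.div_eq_of_eq_mul_right hp.pos hc
      have h4c : 4 ∣ c := by
        rcases eq_or_ne p 2 with rfl | hp2
        · omega
        · have hcop : Nat.Coprime 4 p := (Nat.coprime_pow_left_iff two_pos 2 p).2
            ((Nat.coprime_primes Nat.prime_two hp).2 hp2.symm)
          exact hcop.dvd_of_dvd_mul_left (hc ▸ dvd_trans (by norm_num) hm8)
      obtain ⟨x, hx⟩ := h4c
      rw [hdiv, ← zpow_natCast, hpow]
      have : β ^ (c : ℤ) = 1 := by rw [hx, Nat.cast_mul]; exact hβ4 x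
      rw [this, one_mul, Ne, zpow_eq_one_iff_dvd hord, Int.natCast_dvd_natCast, hc]
      intro h
      have hc0 : 0 < c := Nat.pos_of_ne_zero (by rintro rfl; simp at hc; exact hm0 hc)
      have := Nat.le_of_dvd hc0 h
      have := Nat.mul_lt_mul_of_pos_right hp.one_lt hc0
      omega
  obtain ⟨w, hw⟩ : (2 : ℤ) ∣ t - 1 := by omega
  have hmem : a ^ (t - 1) ∈ Subgroup.zpowers a' := by
    have h1 : a ^ (2 : ℤ) = a' ^ (2 + (m₁ : ℤ)) := by
      obtain ⟨x, hx⟩ := hm₁4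
      have h2 : β ^ (2 + (m₁ : ℤ)) = a ^ (m₁ : ℤ) := by
        rw [zpow_add]
        have : β ^ (m₁ : ℤ) = 1 := by rw [hx, Nat.cast_mul]; exact hβ4 x
        rw [this, mul_one, hβ2']
      rw [hpow, h2, ← zpow_add, zpow_eq_zpow_iff_dvd hord, hm₁]
      exact ⟨-1, by push_cast; ring⟩
    rw [hw, zpow_mul, h1]
    exact zpow_mem (Subgroup.zpow_mem_zpowers ..) w
  have hN := d.data.normal_of_zpow_mem hmem
  have hgen := d.data.gen_of_eq_pow_mul hN ha'
  obtain ⟨k', t', d'⟩ := (ofGenerators a' b hN hgen).exists_describes_of_zpowers (a := a') (b := b)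
    rfl rfl
  set F' := ofGenerators a' b hN hgen
  have hm' : F'.m = F.m := by rw [← hord']; exact m_ofGenerators ..
  -- As `t ≡ 3` modulo 4, `β ^ t = β * a ^ (m / 2)`; the action on `a'` thus has exponent `t + m /
  -- 2` instead of `t`.
  have hconj : a' ^ (t + m₁) = a' ^ t' := by
    rw [← d'.data.conj]
    have h1 : b⁻¹ * a' * b = β * a ^ t := by
      have h2 : b⁻¹ * β = β * b⁻¹ := by
        rw [hβ, ((Commute.refl b).pow_left (n₁ * M)).inv_right.eq]
      rw [← d.data.conj, ha', ← mul_assoc b⁻¹, h2]; group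
    have h3 : β ^ (t + (m₁ : ℤ)) = β * a ^ (m₁ : ℤ) := by
      obtain ⟨x, hx⟩ := hm₁4
      obtain ⟨v, hv⟩ : (2 : ℤ) ∣ w - 1 := by omega
      have : t + (m₁ : ℤ) = 1 + 2 + 4 * (v + x) := by rw [hx]; push_cast; linarith
      rw [this, zpow_add, hβ4, mul_one, zpow_add, zpow_one, hβ2']
    rw [h1, hpow, h3, mul_assoc, mul_right_inj, ← zpow_add, zpow_eq_zpow_iff_dvd hord, hm₁]
    exact ⟨1, by push_cast; ring⟩
  rw [zpow_eq_zpow_iff_dvd hord'] at hconj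
  have h8 : (8 : ℤ) ∣ t + m₁ - t' := dvd_trans (by exact_mod_cast hm8) hconj
  have hm4 : 4 ∣ F.m := dvd_trans (by norm_num) hm8
  have ht' : (4 : ℤ) ∣ t' + 1 := by omega
  have hle := hF.r_le hm'
  rw [(d.minus hm4 ht).1, (d'.minus (hm' ▸ hm4) ht').1, hm', minusR, minusR] at hle
  have hg1 : Int.gcd (t' - 1) (oddPart F.m) = Int.gcd (t - 1) (oddPart F.m) := by
    have h1 : (M : ℤ) ∣ t' - t := by
      have h2 : (M : ℤ) ∣ m₁ := by rw [hm₁']; push_cast; exact dvd_mul_left _ _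
      have h3 : (M : ℤ) ∣ F.m := by rw [hm₁]; push_cast; exact h2.mul_left _
      have h4 : t' - t = m₁ - (t + m₁ - t') := by ring
      rw [h4]; exact h2.sub (h3.trans hconj)
    obtain ⟨c, hc⟩ := h1
    have : t' - 1 = t - 1 + c * M := by linear_combination hc
    rw [this]; exact Int.gcd_add_mul_right_left ..
  have hg2 : Int.gcd (t + 1) (pPart 2 F.m) = pPart 2 F.m :=
    Nat.dvd_antisymm (Int.natCast_dvd_natCast.1 (Int.gcd_dvd_right ..))
      (Int.dvd_gcd hr dvd_rfl)
  -- Now `t' + 1 ≡ m / 2` modulo `m_2`, so the new `r` has a smaller 2-part and the same odd part.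
  have hg3 : Int.gcd (t' + 1) (pPart 2 F.m) < pPart 2 F.m := by
    refine lt_of_le_of_ne (Nat.le_of_dvd (pPart_pos Nat.prime_two _)
      (Int.natCast_dvd_natCast.1 (Int.gcd_dvd_right ..))) fun h => ?_
    have h1 : (pPart 2 F.m : ℤ) ∣ t' + 1 := by
      conv_lhs => rw [← h]
      exact Int.gcd_dvd_left ..
    have h2 : (pPart 2 F.m : ℤ) ∣ m₁ := by
      have h4 : (m₁ : ℤ) = (t + m₁ - t') - (t + 1) + (t' + 1) := by ring
      rw [h4]
      exact (((Int.natCast_dvd_natCast.2 (pPart_dvd 2 F.m)).trans hconj).sub hr).add h1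
    rw [Int.natCast_dvd_natCast, ← hs, hm₁', mul_comm 2] at h2
    exact hMo (Nat.dvd_of_mul_dvd_mul_left (pPart_pos Nat.prime_two _) h2)
  rw [hg1, hg2] at hle
  have hpos : 0 < Int.gcd (t - 1) (oddPart F.m) :=
    Nat.pos_of_ne_zero (by simp [Int.gcd_eq_zero_iff, (oddPart_pos hm0).ne'])
  exact absurd hle (not_le.2 (Nat.mul_lt_mul_of_pos_left hg3 hpos))

/-- `s` divides the geometric sum of length `n`, whose p-valuation is that of `n`. -/
theorem IsMinimal.pPart_s_dvd_n (hF : F.IsMinimal) (d : F.Describes a b k t)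
    (hnil : ∀ p : ℕ, p.Prime → p ∣ F.m → (p : ℤ) ∣ t - 1) {p : ℕ} (hp : p.Prime)
    (h4 : p = 2 → 4 ∣ F.m → (4 : ℤ) ∣ t - 1) : pPart p F.s ∣ F.n := by
  have hs0 : F.s ≠ 0 := ne_zero_of_dvd_ne_zero F.m_ne_zero d.s_dvd_m
  by_cases hps : p ∣ F.s
  swap
  · rw [pPart_of_coprime hps]; exact one_dvd _
  have hu := hnil p hp (hps.trans d.s_dvd_m)
  have hS : ((pPart p F.s : ℕ) : ℤ) ∣ ∑ l ∈ Finset.range F.n, t ^ l :=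
    intDvd_pPart_of_dvd (hF.s_dvd_geom_sum d)
  -- Lifting the exponent fails at 2 without `4 ∣ t - 1`, but here `s_2 = 2` and parity is enough.
  by_cases hc : p = 2 ∧ ¬ 4 ∣ F.m
  · obtain ⟨rfl, hc⟩ := hc
    have h1 : pPart 2 F.s = 2 := by
      have : F.s.factorization 2 < 2 := by
        by_contra! h
        exact hc (((pow_dvd_pow 2 h).trans (pPart_dvd 2 F.s)).trans d.s_dvd_m)
      have h2 := (Nat.prime_two.dvd_iff_one_le_factorization hs0).1 hps
      rw [pPart, show F.s.factorization 2 = 1 by omega, pow_one]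
    rw [h1] at hS ⊢
    exact Int.natCast_dvd_natCast.1 ((dvd_sub_right hS).1 (geom_sum_sub_dvd hu F.n))
  · rw [pPart, Nat.cast_pow] at hS
    refine pow_dvd_of_dvd_geom_sum hp hu (fun h => h4 h ?_) hS
    by_contra h'
    exact hc ⟨h, h'⟩

theorem IsMinimal.plus_conditions (hF : F.IsMinimal) (d : F.Describes a b k t)
    (hnil : ∀ p : ℕ, p.Prime → p ∣ F.m → (p : ℤ) ∣ t - 1) (h4 : 4 ∣ F.m → (4 : ℤ) ∣ t - 1) :
    F.s ∣ F.n ∧ Nat.lcm F.r (F.m / F.r) ∣ F.s := by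
  have hs0 : F.s ≠ 0 := ne_zero_of_dvd_ne_zero F.m_ne_zero d.s_dvd_m
  have hr0 : F.r ≠ 0 := ne_zero_of_dvd_ne_zero F.m_ne_zero d.r_dvd
  have hsn : ∀ p : ℕ, p.Prime → pPart p F.s ∣ F.n := fun p hp =>
    hF.pPart_s_dvd_n d hnil hp fun _ => h4
  refine ⟨natDvd_of_forall_pPart hs0 fun p hp => hsn p (Nat.prime_of_mem_primeFactors hp),
    Nat.lcm_dvd ?_ ?_⟩
  · refine natDvd_of_forall_pPart hr0 fun p hp => ?_
    have hp' := Nat.prime_of_mem_primeFactors hp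
    rw [(d.plus h4).1]
    exact hF.pPart_gcd_dvd d hnil hp' (hsn p hp')
  · have h := d.m_dvd
    rw [← (d.plus h4).1] at h
    exact (Nat.div_dvd_iff_dvd_mul d.r_dvd (Nat.pos_of_ne_zero hr0)).2 (by rwa [mul_comm])

/-- In `m ∣ s * gcd(t - 1, m)` the second factor has 2-part at most 2. -/
theorem Describes.pPart_two_m_dvd (d : F.Describes a b k t) (ht : (4 : ℤ) ∣ t + 1) :
    pPart 2 F.m ∣ 2 * pPart 2 F.s := by
  have hs0 : F.s ≠ 0 := ne_zero_of_dvd_ne_zero F.m_ne_zero d.s_dvd_m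
  have hg0 : Int.gcd (t - 1) F.m ≠ 0 := ne_zero_of_dvd_ne_zero F.m_ne_zero (gcd_sub_one_dvd _ _)
  have h := pPart_dvd_pPart 2 (mul_ne_zero hs0 hg0) d.m_dvd
  rw [pPart_mul 2 hs0 hg0, mul_comm] at h
  refine h.trans (mul_dvd_mul_right ?_ _)
  have h1 : (pPart 2 (Int.gcd (t - 1) F.m) : ℤ) ∣ t - 1 :=
    (Int.natCast_dvd_natCast.2 (pPart_dvd _ _)).trans (Int.gcd_dvd_left ..)
  rw [pPart, Nat.cast_pow, Nat.cast_two] at h1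
  rw [← Int.natCast_dvd_natCast, pPart, Nat.cast_pow, Nat.cast_two]
  have h2 := two_pow_dvd_of_dvd_add_two (y := -2) (x := t - 1) (by omega) h1 (fun _ => by omega)
  rwa [dvd_neg] at h2

/-- The conditions on `(m, n, s, r)` in the case `ε = -1`. -/
structure MinusNumbers (m n s r : ℕ) : Prop where
  oddPart_s_dvd : oddPart s ∣ oddPart n
  oddPart_r_dvd : oddPart r ∣ oddPart s
  oddPart_dvd : oddPart m / oddPart r ∣ oddPart s
  max_le : max 2 (pPart 2 m / pPart 2 r) ≤ pPart 2 n
  pPart_m_le : pPart 2 m ≤ 2 * pPart 2 s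
  ne : pPart 2 s ≠ pPart 2 n * pPart 2 r
  le : 4 ∣ n → 8 ∣ m → pPart 2 r ≤ pPart 2 s

theorem IsMinimal.minus_conditions (hF : F.IsMinimal) (d : F.Describes a b k t)
    (hnil : ∀ p : ℕ, p.Prime → p ∣ F.m → (p : ℤ) ∣ t - 1) (h4 : 4 ∣ F.m) (ht : (4 : ℤ) ∣ t + 1) :
    MinusNumbers F.m F.n F.s F.r := by
  have hm0 := F.m_ne_zero
  have hn0 := d.data.n_ne_zero
  have hs0 : F.s ≠ 0 := ne_zero_of_dvd_ne_zero hm0 d.s_dvd_m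
  have hr0 : F.r ≠ 0 := ne_zero_of_dvd_ne_zero hm0 d.r_dvd
  have hodd : ∀ {p : ℕ}, p.Prime → ∀ {x : ℕ}, x ≠ 0 → p ∣ oddPart x → p ≠ 2 := by
    rintro p - x hx h rfl
    exact not_two_dvd_oddPart hx h
  have hsn : ∀ p : ℕ, p.Prime → p ≠ 2 → pPart p F.s ∣ F.n := fun p hp h2 =>
    hF.pPart_s_dvd_n d hnil hp fun h => absurd h h2
  have hr : F.r = minusR F.m t := (d.minus h4 ht).1
  have hro : oddPart F.r = Int.gcd (t - 1) (oddPart F.m) := by rw [hr, oddPart_minusR hm0]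
  have hr2 : pPart 2 F.r = Int.gcd (t + 1) (pPart 2 F.m) := by rw [hr, pPart_two_minusR hm0]
  have h2n := two_dvd_n_of_minus d h4 ht
  have h2r : pPart 2 F.r ∣ pPart 2 F.m := pPart_dvd_pPart 2 hm0 d.r_dvd
  -- Unless truncated by `m_2`, `r_2` is the full 2-part of `t + 1`.
  have hρ : pPart 2 F.r ≠ pPart 2 F.m →
      ¬ ((2 : ℤ) ^ (F.r.factorization 2 + 1)) ∣ t + 1 := by
    intro hne h
    have hlt : F.r.factorization 2 < F.m.factorization 2 := by
      refine lt_of_le_of_ne ((Nat.factorization_le_iff_dvd hr0 hm0).2 d.r_dvd 2) fun h' => hne ?_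
      rw [pPart, pPart, h']
    have h1 : 2 ^ (F.r.factorization 2 + 1) ∣ pPart 2 F.r := by
      rw [hr2]
      exact Int.dvd_gcd (by exact_mod_cast h) (Int.natCast_dvd_natCast.2 (pow_dvd_pow 2 hlt))
    exact absurd ((Nat.pow_dvd_pow_iff_le_right (by norm_num)).1 h1) (by omega)
  have hhalf : ¬ 2 ^ F.n.factorization 2 ∣ F.n / 2 := by
    intro h
    obtain ⟨c, hc⟩ := h2n
    rw [hc, Nat.mul_div_cancel_left _ two_pos, ← hc] at h
    have h1 : 2 ^ (F.n.factorization 2 + 1) ∣ F.n := by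
      rw [pow_succ, mul_comm]
      conv_rhs => rw [hc]
      exact mul_dvd_mul_left 2 h
    have := (Nat.prime_two.pow_dvd_iff_le_factorization hn0).1 h1
    omega
  have h2n' : 2 ≤ pPart 2 F.n :=
    Nat.le_of_dvd (pPart_pos Nat.prime_two _) (dvd_pPart Nat.prime_two hn0 h2n)
  refine ⟨?_, ?_, ?_, max_le h2n' ?_, Nat.le_of_dvd (by have := pPart_pos Nat.prime_two F.s; omega)
    (d.pPart_two_m_dvd ht), fun heq => ?_, fun hn4 hm8 => ?_⟩
  · refine natDvd_of_forall_pPart (oddPart_pos hs0).ne' fun p hp => ?_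
    have hp' := Nat.prime_of_mem_primeFactors hp
    have h2 := hodd hp' hs0 (Nat.dvd_of_mem_primeFactors hp)
    rw [pPart_oddPart hp' h2 hs0]
    refine (prime_pow_dvd_pPart hp' hn0 (hsn p hp' h2)).trans ?_
    rw [← pPart_oddPart hp' h2 hn0]
    exact pPart_dvd _ _
  · refine natDvd_of_forall_pPart (oddPart_pos hr0).ne' fun p hp => ?_
    have hp' := Nat.prime_of_mem_primeFactors hp
    have h2 := hodd hp' hr0 (Nat.dvd_of_mem_primeFactors hp)
    have h3 := hF.pPart_gcd_dvd d hnil hp' (hsn p hp' h2)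
    rw [hro, pPart_gcd hp' (oddPart_pos hm0).ne', pPart_oddPart hp' h2 hm0, ← pPart_gcd hp' hm0]
    refine (prime_pow_dvd_pPart hp' hs0 h3).trans ?_
    rw [← pPart_oddPart hp' h2 hs0]
    exact pPart_dvd _ _
  · rw [Nat.div_dvd_iff_dvd_mul (oddPart_dvd_oddPart d.r_dvd) (oddPart_pos hr0)]
    have h1 := oddPart_dvd_oddPart d.m_dvd
    have h2 : oddPart (F.s * Int.gcd (t - 1) F.m) = oddPart F.s * oddPart (Int.gcd (t - 1) F.m) :=
      Nat.ordCompl_mul _ _ 2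
    have h3 : oddPart (Int.gcd (t - 1) F.m) ∣ oddPart F.r := by
      rw [hro]
      exact Int.dvd_gcd ((Int.natCast_dvd_natCast.2 (oddPart_dvd _)).trans (Int.gcd_dvd_left ..))
        (Int.natCast_dvd_natCast.2 (oddPart_dvd_oddPart (gcd_sub_one_dvd _ _)))
    have h4 : oddPart F.m ∣ oddPart F.s * oddPart (Int.gcd (t - 1) F.m) := h2 ▸ h1
    exact h4.trans (by rw [mul_comm]; exact mul_dvd_mul_right h3 _)
  -- If `r_2 n_2 < m_2`, then `m ∣ t ^ n - 1` and the single factor 2 in `t - 1` make the geometric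
  -- sum divisible by `r_2 n_2`, twice its actual 2-part.
  · by_cases hne : pPart 2 F.r = pPart 2 F.m
    · rw [hne, Nat.div_self (pPart_pos Nat.prime_two _)]; omega
    by_contra! hlt
    have h1 : pPart 2 F.r * pPart 2 F.n < pPart 2 F.m := by
      rw [mul_comm]; exact (Nat.lt_div_iff_mul_lt' h2r _).1 hlt |> fun h => by rwa [mul_comm] at h
    have h2 : 2 ^ (F.r.factorization 2 + F.n.factorization 2 + 1) ∣ F.m := by
      refine (pow_dvd_pow 2 ?_).trans (pPart_dvd 2 F.m)
      rw [pPart, pPart, pPart, ← pow_add] at h1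
      exact (Nat.pow_lt_pow_iff_right (by norm_num)).1 h1
    have h3 : (2 ^ (F.r.factorization 2 + F.n.factorization 2) * 2 : ℤ) ∣
        (∑ l ∈ Finset.range F.n, t ^ l) * (t - 1) := by
      rw [geom_sum_mul]
      refine dvd_trans ?_ d.data.dvd_pow_sub_one
      rw [← pow_succ]; exact_mod_cast h2
    obtain ⟨w, hw⟩ : (2 : ℤ) ∣ t - 1 := by omega
    have hwo : ¬ (2 : ℤ) ∣ w := by omega
    rw [hw, mul_comm (2 : ℤ) w, ← mul_assoc] at h3
    have h5 := Int.dvd_of_mul_dvd_mul_right (by norm_num) h3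
    have h6 : IsCoprime ((2 : ℤ) ^ (F.r.factorization 2 + F.n.factorization 2)) w :=
      (Int.prime_two.coprime_iff_not_dvd.2 hwo).pow_left
    exact hhalf (pow_dvd_half_of_minus h2n ht (hρ hne) (h6.dvd_of_dvd_mul_right h5))
  -- Here minimality of `s` makes the sum divisible by `s_2 = r_2 n_2`, the same contradiction.
  · have hne : pPart 2 F.r ≠ pPart 2 F.m := by
      intro h
      have h1 : pPart 2 F.s ≤ pPart 2 F.m :=
        Nat.le_of_dvd (pPart_pos Nat.prime_two _) (pPart_dvd_pPart 2 hm0 d.s_dvd_m)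
      have h3 := pPart_pos Nat.prime_two F.m
      rw [heq, h] at h1
      nlinarith
    have h1 : (pPart 2 F.s : ℤ) ∣ ∑ l ∈ Finset.range F.n, t ^ l :=
      intDvd_pPart_of_dvd (hF.s_dvd_geom_sum d)
    rw [heq, mul_comm, pPart, pPart, ← pow_add] at h1
    exact hhalf (pow_dvd_half_of_minus h2n ht (hρ hne) (by exact_mod_cast h1))
  -- `s_2 < r_2` squeezes to `r_2 = m_2 = 2 s_2`, the configuration excluded by
  -- `IsMinimal.pPart_two_s_ne`.
  · by_contra! hlt
    have h1 := d.pPart_two_m_dvd ht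
    have h2 : 2 * pPart 2 F.s ∣ pPart 2 F.r := by
      rw [pPart, pPart] at hlt ⊢
      rw [← pow_succ']
      exact pow_dvd_pow 2 ((Nat.pow_lt_pow_iff_right (by norm_num)).1 hlt)
    have h3 : pPart 2 F.r = pPart 2 F.m := Nat.dvd_antisymm h2r (h1.trans h2)
    refine hF.pPart_two_s_ne d hnil ht hn4 hm8 ?_ (Nat.dvd_antisymm (h2.trans h2r) h1)
    rw [← h3, hr2]; exact Int.gcd_dvd_left ..

end MetacyclicFactorization

end Forward

/-! ### The presented group has the expected order and relations. -/

section Presented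

theorem lift_mem_metacyclicRels {H : Type*} [Group H] {m n s t : ℕ} {x y : H} (h1 : x ^ m = 1)
    (h2 : y ^ n = x ^ s) (h3 : y⁻¹ * x * y = x ^ t) :
    ∀ r ∈ metacyclicRels m n s t, FreeGroup.lift ![x, y] r = 1 := by
  rintro r (rfl | rfl | rfl)
  · simp [h1]
  · simp [h2]
  · simp [h3]

namespace MetacyclicGroup

variable {m n s t : ℕ}

/-- The generator `a`. -/
def genA (m n s t : ℕ) : MetacyclicGroup m n s t := PresentedGroup.of 0

/-- The generator `b`. -/
def genB (m n s t : ℕ) : MetacyclicGroup m n s t := PresentedGroup.of 1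

theorem genA_pow : genA m n s t ^ m = 1 :=
  PresentedGroup.one_of_mem (rels := metacyclicRels m n s t) (Or.inl rfl)

theorem genB_pow : genB m n s t ^ n = genA m n s t ^ s := by
  have := PresentedGroup.one_of_mem (rels := metacyclicRels m n s t) (Or.inr (Or.inl rfl))
  exact mul_inv_eq_one.1 this

theorem conj_genA : (genB m n s t)⁻¹ * genA m n s t * genB m n s t = genA m n s t ^ t := by
  have := PresentedGroup.one_of_mem (rels := metacyclicRels m n s t) (Or.inr (Or.inr rfl))
  exact mul_inv_eq_one.1 this

theorem conj_genA' : (genB m n s t)⁻¹ * genA m n s t * genB m n s t = genA m n s t ^ (t : ℤ) := by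
  rw [zpow_natCast]; exact conj_genA

theorem exists_hom {H : Type*} [Group H] {x y : H} (h1 : x ^ m = 1) (h2 : y ^ n = x ^ s)
    (h3 : y⁻¹ * x * y = x ^ t) :
    ∃ f : MetacyclicGroup m n s t →* H, f (genA m n s t) = x ∧ f (genB m n s t) = y :=
  ⟨PresentedGroup.toGroup (lift_mem_metacyclicRels h1 h2 h3),
    PresentedGroup.toGroup.of _, PresentedGroup.toGroup.of _⟩

theorem genB_pow_mul : genB m n s t ^ (n * m) = 1 := by
  rw [pow_mul, genB_pow, ← pow_mul, mul_comm, pow_mul, genA_pow, one_pow]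

/-- Words of this shape form a subgroup; `b ^ (n * m) = 1` turns inverses of powers of `b` into
natural powers. -/
theorem exists_eq_pow_mul_zpow (hm : m ≠ 0) (hn : n ≠ 0) (g : MetacyclicGroup m n s t) :
    ∃ (j : ℕ) (i : ℤ), g = genB m n s t ^ j * genA m n s t ^ i := by
  let H : Subgroup (MetacyclicGroup m n s t) :=
    { carrier := {g | ∃ (j : ℕ) (i : ℤ), g = genB m n s t ^ j * genA m n s t ^ i}
      one_mem' := ⟨0, 0, by simp⟩
      mul_mem' := by
        rintro _ _ ⟨j, i, rfl⟩ ⟨x, y, rfl⟩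
        exact ⟨_, _, mul_mul_mul_of_conj conj_genA' j x i y⟩
      inv_mem' := by
        rintro _ ⟨j, i, rfl⟩
        have h1 : (genB m n s t ^ j)⁻¹ = genB m n s t ^ ((n * m - 1) * j) := by
          rw [inv_eq_iff_mul_eq_one, ← pow_add]
          have h2 : 1 ≤ n * m := Nat.one_le_iff_ne_zero.2 (mul_ne_zero hn hm)
          have : j + (n * m - 1) * j = n * m * j := by
            obtain ⟨N, hN⟩ := Nat.exists_eq_add_of_le h2
            rw [hN, Nat.add_sub_cancel_left]; ring
          rw [this, pow_mul, genB_pow_mul, one_pow]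
        refine ⟨(n * m - 1) * j, -i * (t : ℤ) ^ ((n * m - 1) * j), ?_⟩
        rw [mul_inv_rev, h1, ← zpow_neg, zpow_mul_pow_of_conj conj_genA'] }
  have hH : H = ⊤ := by
    rw [eq_top_iff, ← PresentedGroup.closure_range_of, Subgroup.closure_le]
    rintro _ ⟨i, rfl⟩
    fin_cases i
    · exact ⟨0, 1, by simp [genA]⟩
    · exact ⟨1, 0, by simp [genB]⟩
  have : g ∈ H := hH ▸ Subgroup.mem_top g
  exact this

theorem finite (hm : m ≠ 0) (hn : n ≠ 0) : Finite (MetacyclicGroup m n s t) := by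
  have h1 : Finite (Subgroup.zpowers (genA m n s t)) :=
    (finite_zpowers.2 (isOfFinOrder_iff_pow_eq_one.2 ⟨m, Nat.pos_of_ne_zero hm, genA_pow⟩))
  have h2 : Finite (Subgroup.zpowers (genB m n s t)) :=
    (finite_zpowers.2 (isOfFinOrder_iff_pow_eq_one.2
      ⟨n * m, Nat.pos_of_ne_zero (mul_ne_zero hn hm), genB_pow_mul⟩))
  refine Finite.of_surjective (fun p : Subgroup.zpowers (genB m n s t) ×
    Subgroup.zpowers (genA m n s t) => (p.1 : MetacyclicGroup m n s t) * p.2) fun g => ?_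
  obtain ⟨j, i, rfl⟩ := exists_eq_pow_mul_zpow hm hn g
  exact ⟨(⟨_, Subgroup.npow_mem_zpowers _ j⟩, ⟨_, Subgroup.zpow_mem_zpowers _ i⟩), rfl⟩

end MetacyclicGroup

/-- Multiplication by a unit, as an automorphism of the cyclic group of order `m`. -/
def mulUnitAut {m : ℕ} (u : (ZMod m)ˣ) : MulAut (Multiplicative (ZMod m)) :=
  (MulAutMultiplicative (ZMod m)).symm (Multiplicative.ofAdd (AddAut.mulLeft u))

theorem mulUnitAut_ofAdd {m : ℕ} (u : (ZMod m)ˣ) (x : ZMod m) :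
    mulUnitAut u (Multiplicative.ofAdd x) = Multiplicative.ofAdd ((u : ZMod m) * x) := rfl

/-- The semidirect product of `ℤ / m` by `ℤ` in which the generator acts by a unit. -/
abbrev CyclicByInt {m : ℕ} (u : (ZMod m)ˣ) : Type :=
  Multiplicative (ZMod m) ⋊[zpowersHom _ (mulUnitAut u)⁻¹] Multiplicative ℤ

namespace CyclicByInt

variable {m : ℕ} (u : (ZMod m)ˣ)

/-- The generator of order `m`. -/
def genA : CyclicByInt u := SemidirectProduct.inl (Multiplicative.ofAdd 1)

/-- The generator of infinite order. -/
def genB : CyclicByInt u := SemidirectProduct.inr (Multiplicative.ofAdd 1)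

theorem genA_zpow (i : ℤ) :
    genA u ^ i = SemidirectProduct.inl (Multiplicative.ofAdd (i : ZMod m)) := by
  rw [genA, ← map_zpow, ← ofAdd_zsmul, zsmul_one]

theorem genB_zpow (i : ℤ) : genB u ^ i = SemidirectProduct.inr (Multiplicative.ofAdd i) := by
  rw [genB, ← map_zpow, ← ofAdd_zsmul, zsmul_one, Int.cast_id]

theorem genA_zpow_eq_one_iff (i : ℤ) : genA u ^ i = 1 ↔ (m : ℤ) ∣ i := by
  rw [genA_zpow, map_eq_one_iff _ SemidirectProduct.inl_injective, ← ZMod.intCast_zmod_eq_zero_iff_dvd]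
  exact ofAdd_eq_one

theorem conj {t : ℤ} (hu : (u : ZMod m) = t) :
    (genB u)⁻¹ * genA u * genB u = genA u ^ t := by
  have h := SemidirectProduct.inl_aut_inv (φ := zpowersHom _ (mulUnitAut u)⁻¹)
    (Multiplicative.ofAdd (1 : ℤ)) (Multiplicative.ofAdd (1 : ZMod m))
  rw [genA_zpow, genA, genB, ← map_inv, ← h, zpowersHom_apply, toAdd_ofAdd, zpow_one, inv_inv,
    mulUnitAut_ofAdd, mul_one, hu]

theorem rightHom_genA : SemidirectProduct.rightHom (genA u) = 1 :=
  SemidirectProduct.rightHom_inl _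

theorem rightHom_genB : SemidirectProduct.rightHom (genB u) = Multiplicative.ofAdd 1 :=
  SemidirectProduct.rightHom_inr _

theorem exists_eq (x : CyclicByInt u) : ∃ i j : ℤ, x = genA u ^ i * genB u ^ j := by
  obtain ⟨i, hi⟩ := ZMod.intCast_surjective (Multiplicative.toAdd x.left)
  refine ⟨i, Multiplicative.toAdd x.right, ?_⟩
  rw [genA_zpow, genB_zpow, hi]
  exact (SemidirectProduct.inl_left_mul_inr_right x).symm

end CyclicByInt

namespace MetacyclicGroup

variable {m n s t : ℕ}

/-- Only a model without collapse is needed: `ℤ/m ⋊ ℤ` modulo `z = B ^ n * A ^ (-s)`, where the two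
divisibilities say that `z` commutes with `A` and with `B`. -/
theorem metacyclicData (hm : m ≠ 0) (hn : n ≠ 0) (hcop : Nat.Coprime t m)
    (h1 : (m : ℤ) ∣ (t : ℤ) ^ n - 1) (h2 : (m : ℤ) ∣ s * ((t : ℤ) - 1)) :
    MetacyclicData (genA m n s t) (genB m n s t) m n s t := by
  set u := ZMod.unitOfCoprime t hcop with hu
  have hu' : (u : ZMod m) = ((t : ℤ) : ZMod m) := by simp [hu]
  let A := CyclicByInt.genA u
  let B := CyclicByInt.genB u
  have hconj : B⁻¹ * A * B = A ^ (t : ℤ) := CyclicByInt.conj u hu'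
  have hA : ∀ x y : ℤ, A ^ x = A ^ y ↔ (m : ℤ) ∣ x - y := fun x y => by
    rw [← mul_inv_eq_one, ← zpow_sub]; exact CyclicByInt.genA_zpow_eq_one_iff u _
  let z := B ^ n * A ^ (-(s : ℤ))
  have hzA : Commute A z := by
    have h3 := zpow_mul_pow_of_conj hconj 1 n
    rw [one_mul, (hA _ 1).2 h1, zpow_one] at h3
    exact Commute.mul_right h3 ((Commute.refl A).zpow_right _)
  have hzB : Commute B z := by
    refine Commute.mul_right ((Commute.refl B).pow_right n) ?_
    have h3 := zpow_mul_pow_of_conj hconj (-(s : ℤ)) 1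
    have h4 : A ^ (-(s : ℤ) * (t : ℤ) ^ 1) = A ^ (-(s : ℤ)) := by
      rw [hA, ← dvd_neg]
      have : -(-(s : ℤ) * (t : ℤ) ^ 1 - -(s : ℤ)) = s * ((t : ℤ) - 1) := by ring
      rwa [this]
    rw [h4, pow_one] at h3
    exact h3.symm
  have hz : ∀ x, Commute x z := by
    intro x
    obtain ⟨i, j, rfl⟩ := CyclicByInt.exists_eq u x
    exact (hzA.zpow_left i).mul_left (hzB.zpow_left j)
  have hN : (Subgroup.zpowers z).Normal := by
    constructor
    intro y hy g
    obtain ⟨i, rfl⟩ := Subgroup.mem_zpowers_iff.1 hy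
    rw [((hz g).zpow_right i).eq, mul_inv_cancel_right]
    exact hy
  -- `z` projects to `n ≠ 0` in `ℤ`. So a power of `A` in `⟨z⟩` is trivial, and `B ^ j * A ^ (-i)`
  -- can lie in `⟨z⟩` only if `n ∣ j`.
  have hker : ∀ x ∈ Subgroup.zpowers z, ∃ l : ℤ,
      SemidirectProduct.rightHom x = Multiplicative.ofAdd (n * l) ∧ x = z ^ l := by
    intro x hx
    obtain ⟨l, rfl⟩ := Subgroup.mem_zpowers_iff.1 hx
    refine ⟨l, ?_, rfl⟩
    simp only [z, map_zpow, map_mul, map_pow, A, B, CyclicByInt.rightHom_genA,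
      CyclicByInt.rightHom_genB, one_zpow, mul_one]
    rw [← ofAdd_nsmul, ← ofAdd_zsmul]
    congr 1
    simp [mul_comm]
  let π := QuotientGroup.mk' (Subgroup.zpowers z)
  obtain ⟨f, hfa, hfb⟩ := exists_hom (m := m) (n := n) (s := s) (t := t) (x := π A) (y := π B)
    (by
      rw [← map_pow, ← zpow_natCast, (CyclicByInt.genA_zpow_eq_one_iff u _).2 dvd_rfl, map_one])
    (by
      rw [← map_pow, ← map_pow, ← mul_inv_eq_one, ← map_inv, ← map_mul]
      refine (QuotientGroup.eq_one_iff _).2 ?_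
      have : B ^ n * (A ^ s)⁻¹ = z := by simp [z]
      rw [this]; exact Subgroup.mem_zpowers z)
    (by rw [← map_inv, ← map_mul, ← map_mul, hconj, map_zpow, zpow_natCast])
  refine ⟨?_, conj_genA', by rw [genB_pow, zpow_natCast], fun j hj => ?_,
    exists_eq_pow_mul_zpow hm hn⟩
  · apply Nat.dvd_antisymm (orderOf_dvd_of_pow_eq_one genA_pow)
    have h3 : π (A ^ (orderOf (genA m n s t))) = 1 := by
      rw [map_pow, ← hfa, ← map_pow, pow_orderOf_eq_one, map_one]
    obtain ⟨l, hl, hl'⟩ := hker _ ((QuotientGroup.eq_one_iff _).1 h3)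
    rw [map_pow, CyclicByInt.rightHom_genA, one_pow] at hl
    have h4 : (n : ℤ) * l = 0 := (ofAdd_eq_one.1 hl.symm)
    have h5 : l = 0 := (mul_eq_zero.1 h4).resolve_left (by exact_mod_cast hn)
    rw [h5, zpow_zero, ← zpow_natCast] at hl'
    exact Int.natCast_dvd_natCast.1 ((CyclicByInt.genA_zpow_eq_one_iff u _).1 hl')
  · obtain ⟨i, hi⟩ := Subgroup.mem_zpowers_iff.1 hj
    have h3 : π (B ^ j * A ^ (-i)) = 1 := by
      rw [map_mul, map_pow, map_zpow, zpow_neg, ← hfa, ← hfb, ← map_pow, ← map_zpow, hi,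
        mul_inv_cancel]
    obtain ⟨l, hl, -⟩ := hker _ ((QuotientGroup.eq_one_iff _).1 h3)
    rw [map_mul, map_pow, map_zpow, CyclicByInt.rightHom_genA,
      CyclicByInt.rightHom_genB, one_zpow, mul_one, ← ofAdd_nsmul] at hl
    have h4 : j • (1 : ℤ) = n * l := Multiplicative.ofAdd.injective hl
    exact Int.natCast_dvd_natCast.1 ⟨l, by simpa using h4⟩

end MetacyclicGroup

end Presented

/-! ### Comparing two factorizations, and minimality for `ε = 1`. -/

section Converse

variable {G : Type*} [Group G]

/-- A homomorphism onto `(ℤ / g)²` that sends `a` and `b` to the standard generators. -/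
structure SplitHom (a b : G) (g : ℕ) where
  hom : G →* Multiplicative (ZMod g × ZMod g)
  map_a : hom a = Multiplicative.ofAdd (1, 0)
  map_b : hom b = Multiplicative.ofAdd (0, 1)

theorem MetacyclicGroup.nonempty_splitHom {m n s t g : ℕ} (hm : g ∣ m) (hn : g ∣ n) (hs : g ∣ s)
    (ht : (g : ℤ) ∣ (t : ℤ) - 1) :
    Nonempty (SplitHom (MetacyclicGroup.genA m n s t) (MetacyclicGroup.genB m n s t) g) := by
  have hz : ∀ {c : ℕ}, g ∣ c → (c : ZMod g) = 0 := fun h => (ZMod.natCast_eq_zero_iff _ _).2 h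
  obtain ⟨f, hfa, hfb⟩ := MetacyclicGroup.exists_hom (m := m) (n := n) (s := s) (t := t)
    (x := Multiplicative.ofAdd ((1, 0) : ZMod g × ZMod g)) (y := Multiplicative.ofAdd (0, 1))
    (by
      rw [← ofAdd_nsmul, ofAdd_eq_one]
      ext <;> simp [hz hm])
    (by
      rw [← ofAdd_nsmul, ← ofAdd_nsmul]
      congr 1
      ext <;> simp [hz hn, hz hs])
    (by
      have h1 : (t : ZMod g) = 1 := by
        have := (ZMod.intCast_eq_intCast_iff_dvd_sub 1 t g).2 ht
        simpa using this.symm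
      rw [mul_comm, mul_inv_cancel_left, ← ofAdd_nsmul]
      congr 1
      ext <;> simp [h1])
  exact ⟨⟨f, hfa, hfb⟩⟩

namespace SplitHom

variable {a b : G} {g : ℕ} (f : SplitHom a b g)

theorem map_mul_pow (j : ℕ) (i : ℤ) :
    f.hom (b ^ j * a ^ i) = Multiplicative.ofAdd ((i : ZMod g), (j : ZMod g)) := by
  rw [map_mul, map_pow, map_zpow, f.map_a, f.map_b, ← ofAdd_nsmul, ← ofAdd_zsmul, ← ofAdd_add]
  congr 1
  ext <;> simp

theorem pow_eq_one (x : G) : f.hom x ^ g = 1 := by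
  rw [← ofAdd_toAdd (f.hom x), ← ofAdd_nsmul, ofAdd_eq_one]
  ext <;> simp

/-- The images of `a'` and `b'` have order at most `g`, and products of their powers fill a group of
order `g ^ 2`. -/
theorem orderOf_eq [Finite G] (hg : g ≠ 0) {a' b' : G}
    (hgen : ∀ y : G, ∃ (j : ℕ) (i : ℤ), y = b' ^ j * a' ^ i) : orderOf (f.hom a') = g := by
  have : NeZero g := ⟨hg⟩
  have hle : ∀ x : G, orderOf (f.hom x) ≤ g := fun x =>
    Nat.le_of_dvd (Nat.pos_of_ne_zero hg) (orderOf_dvd_of_pow_eq_one (f.pow_eq_one x))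
  refine le_antisymm (hle a') ?_
  have hsurj : Function.Surjective (fun p : Subgroup.zpowers (f.hom b') ×
      Subgroup.zpowers (f.hom a') => (p.1 : Multiplicative (ZMod g × ZMod g)) * p.2) := by
    intro z
    obtain ⟨w, rfl⟩ : ∃ w, f.hom w = z := by
      refine ⟨b ^ (Multiplicative.toAdd z).2.val * a ^ ((Multiplicative.toAdd z).1.val : ℤ), ?_⟩
      rw [f.map_mul_pow]
      simp
    obtain ⟨j, i, rfl⟩ := hgen w
    refine ⟨(⟨f.hom b' ^ j, Subgroup.npow_mem_zpowers _ j⟩,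
      ⟨f.hom a' ^ i, Subgroup.zpow_mem_zpowers _ i⟩), ?_⟩
    simp
  have h := Nat.card_le_card_of_surjective _ hsurj
  rw [Nat.card_prod, Nat.card_zpowers, Nat.card_zpowers,
    Nat.card_congr (Multiplicative.toAdd (α := ZMod g × ZMod g)), Nat.card_prod,
    Nat.card_zmod] at h
  exact Nat.le_of_mul_le_mul_left (h.trans (Nat.mul_le_mul_right _ (hle b')))
    (Nat.pos_of_ne_zero hg)

end SplitHom

theorem zpow_mul_of_conj {a b : G} {t : ℤ} (h : b⁻¹ * a * b = a ^ t) (i y : ℤ) (x : ℕ) :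
    (b ^ x * a ^ y)⁻¹ * a ^ i * (b ^ x * a ^ y) = a ^ (i * t ^ x) := by
  have h1 := zpow_mul_pow_of_conj h i x
  rw [mul_inv_rev, mul_assoc, ← mul_assoc (a ^ i), h1]
  group

theorem dvd_odd_pow_add_one {c t : ℤ} (h : c ∣ t + 1) {x : ℕ} (hx : ¬ 2 ∣ x) : c ∣ t ^ x + 1 := by
  have hodd : Odd x := Nat.not_even_iff_odd.1 fun h => hx h.two_dvd
  exact h.trans (by simpa using hodd.add_dvd_pow_add_pow t 1)

section Compare

variable {a b a' b' : G} {m n m' n' : ℕ} {k t k' t' : ℤ}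

/-- `a ^ (t - 1)` is a commutator, and all commutators lie in `⟨a' ^ (t' - 1)⟩`. -/
theorem MetacyclicData.zpow_gcd_mem (d : MetacyclicData a b m n k t)
    (d' : MetacyclicData a' b' m' n' k' t') :
    a ^ (Int.gcd (t - 1) m : ℤ) ∈ Subgroup.zpowers (a' ^ (t' - 1)) := by
  have h1 : a ^ (t - 1) ∈ Subgroup.zpowers (a' ^ (t' - 1)) := by
    obtain ⟨c, hc⟩ := d'.exists_mul_eq_mul_mul_zpow a b
    have h2 := zpow_mul_pow_of_conj d.conj 1 1
    rw [zpow_one, pow_one, pow_one, one_mul] at h2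
    have h3 : a ^ (t - 1) = (a' ^ (t' - 1)) ^ c := by
      rw [← zpow_mul]
      rw [h2, mul_assoc, mul_right_inj] at hc
      have h4 : a ^ (t - 1) = a⁻¹ * a ^ t := by
        rw [← zpow_neg_one, ← zpow_add]; congr 1; ring
      rw [h4, hc, inv_mul_cancel_left]
    rw [h3]
    exact Subgroup.zpow_mem_zpowers ..
  exact (Subgroup.zpowers_le.2 h1) (zpow_mem_zpowers_zpow d.order dvd_rfl)

/-- The n-th power of any element is a power of `a` whose exponent combines `k` and a geometric sum
of length `n`, both divisible by `δ`. This bounds the order of every possible `b'`. -/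
theorem MetacyclicData.pow_eq_one (d : MetacyclicData a b m n k t)
    (hnil : ∀ p : ℕ, p.Prime → p ∣ m → (p : ℤ) ∣ t - 1) {δ : ℕ} (hδ : δ ∣ m) (hδn : δ ∣ n)
    (hδk : (δ : ℤ) ∣ k) (x : G) : x ^ (n * (m / δ)) = 1 := by
  obtain ⟨j, i, rfl⟩ := d.gen x
  have h1 : (δ : ℤ) ∣ ∑ l ∈ Finset.range n, (t ^ j) ^ l :=
    dvd_geom_sum δ n _ hδn fun p hp hpδ => _root_.dvd_pow_sub_one (hnil p hp (hpδ.trans hδ)) j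
  rw [pow_mul, mul_pow_of_conj d.conj, mul_comm j, pow_mul, d.pow, ← zpow_natCast (a ^ k),
    ← zpow_mul, ← zpow_add, ← zpow_natCast _ (m / δ), ← zpow_mul, zpow_eq_one_iff_dvd d.order]
  have h2 : (m : ℤ) = δ * ((m / δ : ℕ) : ℤ) := by exact_mod_cast (Nat.mul_div_cancel' hδ).symm
  conv_lhs => rw [h2]
  exact mul_dvd_mul_right ((hδk.mul_right _).add (h1.mul_left _)) _

variable [Finite G] {g : ℕ}

/-- `a ^ g` is a power of `a'` killed in `(ℤ/g)²`, where `a'` has order `g`; so the exponent is a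
multiple of `g`. -/
theorem MetacyclicData.zpow_gcd_mem_zpowers_pow (d : MetacyclicData a b m n k t)
    (d' : MetacyclicData a' b' m' n' k' t') (f : SplitHom a b g) (hg : g = Int.gcd (t - 1) m) :
    a ^ g ∈ Subgroup.zpowers (a' ^ g) ∧ g ∣ m' := by
  have hg0 : g ≠ 0 := hg ▸ ne_zero_of_dvd_ne_zero d.m_ne_zero (gcd_sub_one_dvd _ _)
  have hord := f.orderOf_eq hg0 d'.gen
  have h1 := d.zpow_gcd_mem d'
  rw [← hg, zpow_natCast] at h1
  obtain ⟨e, he⟩ := Subgroup.mem_zpowers_iff.1 h1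
  rw [← zpow_mul] at he
  have h2 : f.hom a' ^ ((t' - 1) * e) = 1 := by
    rw [← map_zpow, he, map_pow, f.pow_eq_one]
  rw [← orderOf_dvd_iff_zpow_eq_one, hord] at h2
  constructor
  · obtain ⟨c, hc⟩ := h2
    rw [← he, hc, zpow_mul, zpow_natCast]
    exact Subgroup.zpow_mem_zpowers ..
  · rw [← hord, ← d'.order]
    exact orderOf_map_dvd f.hom a'

theorem MetacyclicData.dvd_of_splitHom (d : MetacyclicData a b m n k t)
    (d' : MetacyclicData a' b' m' n' k' t') (f : SplitHom a b g) (hg : g = Int.gcd (t - 1) m) :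
    m ∣ m' := by
  have hg0 : g ≠ 0 := hg ▸ ne_zero_of_dvd_ne_zero d.m_ne_zero (gcd_sub_one_dvd _ _)
  obtain ⟨h1, h2⟩ := d.zpow_gcd_mem_zpowers_pow d' f hg
  have hgm : g ∣ m := hg ▸ gcd_sub_one_dvd _ _
  have h3 := orderOf_dvd_of_mem_zpowers h1
  rw [orderOf_pow_of_dvd hg0 (d.order ▸ hgm), orderOf_pow_of_dvd hg0 (d'.order ▸ h2), d.order,
    d'.order] at h3
  have := mul_dvd_mul_left g h3
  rwa [Nat.mul_div_cancel' hgm, Nat.mul_div_cancel' h2] at this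

theorem MetacyclicData.zpowers_pow_eq (d : MetacyclicData a b m n k t)
    (d' : MetacyclicData a' b' m n' k' t') (f : SplitHom a b g) (hg : g = Int.gcd (t - 1) m) :
    Subgroup.zpowers (a ^ g) = Subgroup.zpowers (a' ^ g) := by
  have hg0 : g ≠ 0 := hg ▸ ne_zero_of_dvd_ne_zero d.m_ne_zero (gcd_sub_one_dvd _ _)
  have hgm : g ∣ m := hg ▸ gcd_sub_one_dvd _ _
  refine Subgroup.eq_of_le_of_card_ge
    (Subgroup.zpowers_le.2 (d.zpow_gcd_mem_zpowers_pow d' f hg).1) ?_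
  rw [Nat.card_zpowers, Nat.card_zpowers, orderOf_pow_of_dvd hg0 (d'.order ▸ hgm),
    orderOf_pow_of_dvd hg0 (d.order ▸ hgm), d.order, d'.order]

/-- One divisibility compares the subgroups `⟨a ^ g⟩ = ⟨a' ^ g⟩` and `⟨a' ^ (t' - 1)⟩`; the other
holds because `a' ^ (t' - 1)` is a commutator and dies in `(ℤ/g)²`. -/
theorem MetacyclicData.gcd_eq (d : MetacyclicData a b m n k t)
    (d' : MetacyclicData a' b' m n' k' t') (f : SplitHom a b g) (hg : g = Int.gcd (t - 1) m) :
    Int.gcd (t' - 1) m = g := by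
  have hg0 : g ≠ 0 := hg ▸ ne_zero_of_dvd_ne_zero d.m_ne_zero (gcd_sub_one_dvd _ _)
  apply Nat.dvd_antisymm
  · have h1 := d.zpow_gcd_mem d'
    rw [← hg, zpow_natCast] at h1
    have h2 : a' ^ (g : ℤ) ∈ Subgroup.zpowers (a ^ g) := by
      rw [d.zpowers_pow_eq d' f hg, zpow_natCast]; exact Subgroup.mem_zpowers _
    exact Int.natCast_dvd_natCast.1
      (gcd_dvd_of_zpow_mem d'.order ((Subgroup.zpowers_le.2 h1) h2))
  · refine Int.dvd_gcd ?_ (Int.natCast_dvd_natCast.2 (hg ▸ gcd_sub_one_dvd _ _))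
    rw [← f.orderOf_eq hg0 d'.gen, orderOf_dvd_iff_zpow_eq_one, ← map_zpow]
    have : a' ^ (t' - 1) = a'⁻¹ * (b'⁻¹ * a' * b') := by
      rw [d'.conj, ← zpow_neg_one, ← zpow_add]; congr 1; ring
    rw [this]
    simp only [map_mul, map_inv]
    rw [mul_comm (f.hom b')⁻¹, inv_mul_cancel_right, inv_mul_cancel]

theorem MetacyclicData.dvd_gcd_of_orderOf_dvd (d : MetacyclicData a b m n k t)
    (d' : MetacyclicData a' b' m n' k' t') {δ : ℕ} (hδ : δ ∣ m) (h : orderOf b' ∣ n * (m / δ)) :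
    δ ∣ Int.gcd k' m := by
  have hm0 := d.m_ne_zero
  have hn : n' = n := by
    have := d.card_eq.symm.trans d'.card_eq
    exact (Nat.eq_of_mul_eq_mul_left (Nat.pos_of_ne_zero hm0) this).symm
  have hgm : Int.gcd k' m ∣ m := Int.natCast_dvd_natCast.1 (Int.gcd_dvd_right ..)
  rw [d'.orderOf_b, hn] at h
  have h1 := Nat.dvd_of_mul_dvd_mul_left (Nat.pos_of_ne_zero d.n_ne_zero) h
  obtain ⟨c, hc⟩ := h1
  refine ⟨c, ?_⟩
  have hpos : 0 < m / Int.gcd k' m :=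
    Nat.div_pos (Nat.le_of_dvd (Nat.pos_of_ne_zero hm0) hgm)
      (Nat.pos_of_ne_zero (ne_zero_of_dvd_ne_zero hm0 hgm))
  apply Nat.eq_of_mul_eq_mul_right hpos
  rw [Nat.mul_div_cancel' hgm, mul_assoc, mul_comm c, ← hc, Nat.mul_div_cancel' hδ]

end Compare

namespace MetacyclicFactorization

variable {F : MetacyclicFactorization G}

theorem isMinimal_of (h1 : ∀ F' : MetacyclicFactorization G, F.m ≤ F'.m)
    (h2 : ∀ F' : MetacyclicFactorization G, F'.m = F.m → F.r ≤ F'.r ∧ F.s ≤ F'.s) :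
    F.IsMinimal := by
  intro F'
  rw [Prod.Lex.toLex_le_toLex]
  rcases (h1 F').lt_or_eq with h | h
  · exact Or.inl h
  · refine Or.inr ⟨h, Prod.Lex.toLex_le_toLex.2 ?_⟩
    obtain ⟨h3, h4⟩ := h2 F' h.symm
    rcases h3.lt_or_eq with h5 | h5
    · exact Or.inl h5
    · exact Or.inr ⟨h5, h4⟩

variable [Finite G] {a b : G} {t : ℤ}

theorem Describes.s_pos {F' : MetacyclicFactorization G} {a' b' : G} {k' t' : ℤ}
    (d' : F'.Describes a' b' k' t') : 0 < F'.s :=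
  Nat.pos_of_ne_zero (ne_zero_of_dvd_ne_zero F'.m_ne_zero d'.s_dvd_m)

theorem Describes.isMinimal_plus (d : F.Describes a b (F.s : ℤ) t)
    (hnil : ∀ p : ℕ, p.Prime → p ∣ F.m → (p : ℤ) ∣ t - 1) (h4 : 4 ∣ F.m → (4 : ℤ) ∣ t - 1)
    (f : SplitHom a b (Int.gcd (t - 1) F.m)) (hsn : F.s ∣ F.n) : F.IsMinimal := by
  refine isMinimal_of (fun F' => ?_) (fun F' hm => ?_)
  · obtain ⟨a', b', k', t', d'⟩ := F'.exists_describes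
    exact Nat.le_of_dvd (Nat.pos_of_ne_zero F'.m_ne_zero) (d.data.dvd_of_splitHom d'.data f rfl)
  · obtain ⟨a', b', k', t', d'⟩ := F'.exists_describes
    have d₁ : MetacyclicData a' b' F.m F'.n k' t' := hm ▸ d'.data
    have hg := d.data.gcd_eq d₁ f rfl
    have h4' : 4 ∣ F'.m → (4 : ℤ) ∣ t' - 1 := by
      intro h
      rw [hm] at h
      have h1 : 4 ∣ Int.gcd (t - 1) F.m := Int.dvd_gcd (h4 h) (Int.natCast_dvd_natCast.2 h)
      rw [← hg] at h1
      exact (Int.natCast_dvd_natCast.2 h1).trans (Int.gcd_dvd_left ..)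
    refine ⟨by rw [(d.plus h4).1, (d'.plus h4').1, hm, hg], Nat.le_of_dvd d'.s_pos ?_⟩
    rw [d'.hs, hm]
    refine d.data.dvd_gcd_of_orderOf_dvd d₁ d.s_dvd_m (orderOf_dvd_of_pow_eq_one ?_)
    exact d.data.pow_eq_one hnil d.s_dvd_m hsn dvd_rfl b'

end MetacyclicFactorization

end Converse

/-! ### Minimality for `ε = -1`: the prime 2. -/

section ConverseMinus

variable {G : Type*} [Group G] {a b a' b' : G} {m n s n' g : ℕ} {t k' t' : ℤ}

theorem oddPart_dvd_geom_sum (hnil : ∀ p : ℕ, p.Prime → p ∣ m → (p : ℤ) ∣ t - 1) {N : ℕ} (hN : oddPart m ∣ N)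
    (j : ℕ) : (oddPart m : ℤ) ∣ ∑ l ∈ Finset.range N, (t ^ j) ^ l :=
  dvd_geom_sum _ N _ hN fun p hp hpm =>
    _root_.dvd_pow_sub_one (hnil p hp (hpm.trans (oddPart_dvd m))) j

namespace MetacyclicData

/-- On `a' ^ N`, which lies in `⟨a⟩`, the element `b'` acts by `t'` and also by `t ^ x`. -/
theorem dvd_mul_sub_pow (d : MetacyclicData a b m n s t) (d' : MetacyclicData a' b' m n' k' t')
    {x : ℕ} {y : ℤ} (hb : b' = b ^ x * a ^ y) {N : ℕ} {w : ℤ} (hN : a' ^ N = a ^ w) :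
    (m : ℤ) ∣ N * (t' - t ^ x) := by
  have h1 : b'⁻¹ * a' ^ (N : ℤ) * b' = a' ^ ((N : ℤ) * t') := by
    have := zpow_mul_of_conj d'.conj N 0 1
    simpa using this
  have h2 : b'⁻¹ * a' ^ (N : ℤ) * b' = a' ^ ((N : ℤ) * t ^ x) := by
    rw [zpow_natCast, hN, hb, zpow_mul_of_conj d.conj, zpow_mul, ← hN, ← zpow_natCast, ← zpow_mul]
  rw [h2, zpow_eq_zpow_iff_dvd d'.order, ← dvd_neg] at h1
  have h3 : (N : ℤ) * (t' - t ^ x) = -(N * t ^ x - N * t') := by ring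
  rwa [h3]

/-- If both exponents of `b` were even, `b` could not be a product of powers of `a'` and `b'`: look
at the second coordinate modulo 2. -/
theorem not_two_dvd_exponent (d' : MetacyclicData a' b' m n' k' t') (f : SplitHom a b g)
    (h2 : 2 ∣ g) {j x : ℕ} {i y : ℤ} (ha : a' = b ^ j * a ^ i) (hb : b' = b ^ x * a ^ y)
    (hj : 2 ∣ j) : ¬ 2 ∣ x := by
  intro hx
  obtain ⟨p, q, hpq⟩ := d'.gen b
  have h := congrArg (fun z => (Multiplicative.toAdd (f.hom z)).2) hpq
  simp only [map_mul, map_pow, map_zpow, f.map_b] at h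
  rw [ha, hb, f.map_mul_pow, f.map_mul_pow, ← ofAdd_nsmul, ← ofAdd_zsmul, ← ofAdd_add,
    toAdd_ofAdd, toAdd_ofAdd] at h
  simp only [Prod.snd_add, nsmul_eq_mul, zsmul_eq_mul] at h
  have h1 : ((1 : ℤ) : ZMod g) = ((p * x + q * j : ℤ) : ZMod g) := by push_cast; exact h
  rw [ZMod.intCast_eq_intCast_iff_dvd_sub] at h1
  have h3 : (2 : ℤ) ∣ (p * x + q * j : ℤ) - 1 := (Int.natCast_dvd_natCast.2 h2).trans h1
  have h4 : (2 : ℤ) ∣ (p * x + q * j : ℤ) :=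
    ((Int.natCast_dvd_natCast.2 hx).mul_left _).add ((Int.natCast_dvd_natCast.2 hj).mul_left _)
  omega

theorem genB_pow_mul_oddPart (d : MetacyclicData a b m n s t) (hs : pPart 2 m ∣ s) {N : ℕ}
    (hN : n * oddPart m ∣ N) : b ^ N = 1 := by
  obtain ⟨c, rfl⟩ := hN
  rw [mul_assoc, pow_mul, d.pow, ← zpow_natCast, ← zpow_mul, zpow_eq_one_iff_dvd d.order]
  obtain ⟨e, rfl⟩ := hs
  refine ⟨e * c, ?_⟩
  conv_rhs => rw [← pPart_mul_oddPart m]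
  push_cast
  ring

variable [Finite G]

theorem exists_zpow_eq_pow_gcd (d : MetacyclicData a b m n s t)
    (d' : MetacyclicData a' b' m n' k' t') (f : SplitHom a b g) (hg : g = Int.gcd (t - 1) m) :
    ∃ w : ℤ, a' ^ g = a ^ (g * w) := by
  have h : a' ^ g ∈ Subgroup.zpowers (a ^ g) := by
    rw [d.zpowers_pow_eq d' f hg]; exact Subgroup.mem_zpowers _
  obtain ⟨w, hw⟩ := Subgroup.mem_zpowers_iff.1 h
  exact ⟨w, by rw [← hw, zpow_mul, zpow_natCast]⟩

theorem dvd_exponent_mul (d : MetacyclicData a b m n s t)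
    (d' : MetacyclicData a' b' m n' k' t') (f : SplitHom a b g) (hg : g = Int.gcd (t - 1) m)
    {j : ℕ} {i : ℤ} (ha : a' = b ^ j * a ^ i) : n ∣ j * g := by
  obtain ⟨w, hw⟩ := d.exists_zpow_eq_pow_gcd d' f hg
  rw [ha, mul_pow_of_conj d.conj] at hw
  refine d.dvd_of_mem _ ?_
  rw [eq_mul_inv_of_mul_eq hw]
  exact mul_mem (Subgroup.zpow_mem_zpowers ..) (inv_mem (Subgroup.zpow_mem_zpowers ..))

theorem two_dvd_exponent (d : MetacyclicData a b m n s t)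
    (d' : MetacyclicData a' b' m n' k' t') (f : SplitHom a b g) (hg : g = Int.gcd (t - 1) m)
    (h4 : 4 ∣ m) (ht : (4 : ℤ) ∣ t + 1) (hs : 4 ∣ s) {j : ℕ} {i : ℤ} (ha : a' = b ^ j * a ^ i) :
    2 ∣ j := by
  by_contra hj
  obtain ⟨q, hq⟩ := d.dvd_exponent_mul d' f hg ha
  have hg2 : 2 ∣ g := hg ▸ Int.dvd_gcd (by omega) (dvd_trans (by norm_num)
    (Int.natCast_dvd_natCast.2 h4))
  obtain ⟨g₁, rfl⟩ := hg2
  set E : ℤ := s * q + i * ∑ l ∈ Finset.range (2 * g₁), (t ^ j) ^ l with hE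
  have hpow : a' ^ (2 * g₁) = a ^ E := by
    rw [ha, mul_pow_of_conj d.conj, hq, pow_mul, d.pow, ← zpow_natCast (a ^ (s : ℤ)), ← zpow_mul,
      ← zpow_add]
  have h4S : (4 : ℤ) ∣ ∑ l ∈ Finset.range (2 * g₁), (t ^ j) ^ l := by
    rw [geom_sum_range_mul]
    refine Dvd.dvd.mul_right ?_ _
    have : ∑ l ∈ Finset.range 2, (t ^ j) ^ l = t ^ j + 1 := by
      simp [Finset.sum_range_succ]; ring
    rw [this]
    exact dvd_odd_pow_add_one ht hj
  have h4E : (4 : ℤ) ∣ E :=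
    ((dvd_trans (by norm_num) (Int.natCast_dvd_natCast.2 hs)).mul_right _).add (h4S.mul_left _)
  have hmem : a ^ ((2 * g₁ : ℕ) : ℤ) ∈ Subgroup.zpowers (a ^ E) := by
    rw [← hpow, ← d.zpowers_pow_eq d' f hg, zpow_natCast]; exact Subgroup.mem_zpowers _
  have h1 := gcd_dvd_of_zpow_mem d.order hmem
  have h2 : 4 ∣ Int.gcd E m := Int.dvd_gcd h4E (Int.natCast_dvd_natCast.2 h4)
  have h3 : (4 : ℤ) ∣ ((2 * g₁ : ℕ) : ℤ) := (Int.natCast_dvd_natCast.2 h2).trans h1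
  have h5 : (4 : ℤ) ∣ t - 1 := by rw [hg] at h3; exact h3.trans (Int.gcd_dvd_left ..)
  omega

/-- If `r` and `s` have the same `2`-part as `m`, then every generator of a normal cyclic factor of
the same order is inverted modulo the `2`-part. -/
theorem pPart_dvd_add_one_of_dvd_s (d : MetacyclicData a b m n s t)
    (d' : MetacyclicData a' b' m n' k' t') (f : SplitHom a b g) (hg : g = Int.gcd (t - 1) m)
    (hnil : ∀ p : ℕ, p.Prime → p ∣ m → (p : ℤ) ∣ t - 1)
    (hr : (pPart 2 m : ℤ) ∣ t + 1) (hs : pPart 2 m ∣ s) (hg4 : ¬ 4 ∣ g)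
    {j x : ℕ} {i y : ℤ} (ha : a' = b ^ j * a ^ i) (hb : b' = b ^ x * a ^ y)
    (hj : 2 ∣ j) (hx : ¬ 2 ∣ x) : (pPart 2 m : ℤ) ∣ t' + 1 := by
  have hm0 := d.m_ne_zero
  have hn0 := d.n_ne_zero
  set M := oddPart m with hM
  set K := oddPart n * M with hK
  have hK2 : ¬ 2 ∣ K := by
    rw [hK, Nat.prime_two.dvd_mul]
    exact not_or.2 ⟨not_two_dvd_oddPart hn0, not_two_dvd_oddPart hm0⟩
  have hg0 : g ≠ 0 := by rintro rfl; exact hg4 (dvd_zero 4)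
  have hnj : pPart 2 n ∣ 2 * j := by
    have h1 : pPart 2 n ∣ j * g := (pPart_dvd 2 n).trans (d.dvd_exponent_mul d' f hg ha)
    have h2 : pPart 2 n ∣ j * pPart 2 g := by
      rw [← pPart_mul_oddPart g, ← mul_assoc] at h1
      exact Nat.Coprime.dvd_of_dvd_mul_right
        (Nat.Coprime.pow_left _ ((Nat.prime_two.coprime_iff_not_dvd).2 (not_two_dvd_oddPart hg0))) h1
    refine h2.trans ?_
    rw [mul_comm]
    refine mul_dvd_mul_right ?_ _
    have h3 : g.factorization 2 < 2 := by
      by_contra! h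
      exact hg4 ((pow_dvd_pow 2 h).trans (pPart_dvd 2 g))
    exact pow_dvd_pow 2 (Nat.lt_succ_iff.1 h3)
  -- `n_2 ∣ 2 * j` and `m_2 ∣ s` give `β ^ 2 = 1`, and `β` commutes with `a` and `b'`.
  set β := b ^ (j * K) with hβ
  have hβ2 : β * β = 1 := by
    rw [hβ, ← pow_add]
    apply d.genB_pow_mul_oddPart hs
    have : j * K + j * K = 2 * j * (oddPart n * M) := by rw [hK]; ring
    rw [this, ← mul_assoc]
    refine mul_dvd_mul_right ?_ _
    conv_lhs => rw [← pPart_mul_oddPart n]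
    exact mul_dvd_mul_right hnj _
  have htβ : (m : ℤ) ∣ t ^ (j * K) - 1 := by
    apply intDvd_of_pPart_two_of_oddPart hm0
    · obtain ⟨c, rfl⟩ := hj
      rw [mul_assoc, pow_mul]
      apply _root_.dvd_pow_sub_one
      have : t ^ 2 - 1 = (t + 1) * (t - 1) := by ring
      rw [this]; exact hr.mul_right _
    · exact dvd_pow_sub_one_of_forall_prime ((dvd_mul_left _ _).mul_left _) fun p hp hpm =>
        hnil p hp (hpm.trans (oddPart_dvd m))
  have hβa : ∀ z : ℤ, a ^ z * β = β * a ^ z := by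
    intro z
    rw [hβ, zpow_mul_pow_of_conj d.conj, mul_right_inj, zpow_eq_zpow_iff_dvd d.order]
    have : z * t ^ (j * K) - z = z * (t ^ (j * K) - 1) := by ring
    rw [this]; exact htβ.mul_left _
  set w : ℤ := i * ∑ l ∈ Finset.range K, (t ^ j) ^ l with hw
  have hwM : (M : ℤ) ∣ w := (oddPart_dvd_geom_sum hnil (dvd_mul_left _ _) j).mul_left _
  have hpow : a' ^ K = β * a ^ w := by rw [ha, mul_pow_of_conj d.conj]
  have hconj : b'⁻¹ * a' ^ K * b' = β * a ^ (w * t ^ x) := by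
    have h1 : b'⁻¹ * β * b' = β := by
      have h2 : β * b' = b' * β := by
        rw [hb, ← mul_assoc, mul_assoc (b ^ x), hβa y, ← mul_assoc, hβ, ← pow_add, ← pow_add,
          add_comm x]
      rw [mul_assoc, h2, inv_mul_cancel_left]
    have h3 : b'⁻¹ * (β * a ^ w) * b' = (b'⁻¹ * β * b') * (b'⁻¹ * a ^ w * b') := by group
    rw [hpow, h3, h1, hb, zpow_mul_of_conj d.conj]
  -- `b'` inverts `a ^ w`: at 2 because `x` is odd, elsewhere because the odd part of `m` divides
  -- `w`.
  have hneg : a ^ (w * t ^ x) = a ^ (-w) := by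
    rw [zpow_eq_zpow_iff_dvd d.order]
    have h1 : w * t ^ x - -w = w * (t ^ x + 1) := by ring
    rw [h1]
    exact intDvd_of_pPart_two_of_oddPart hm0 ((dvd_odd_pow_add_one hr hx).mul_left _)
      (hwM.mul_right _)
  have hinv : b'⁻¹ * a' ^ K * b' = (a' ^ K)⁻¹ := by
    rw [hconj, hneg, hpow, mul_inv_rev, ← zpow_neg, ← hβa,
      inv_eq_of_mul_eq_one_left hβ2]
  have h5 : b'⁻¹ * a' ^ (K : ℤ) * b' = a' ^ ((K : ℤ) * t') := by
    have := zpow_mul_of_conj d'.conj K 0 1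
    simpa using this
  rw [zpow_natCast, hinv, ← zpow_natCast, ← zpow_neg, zpow_eq_zpow_iff_dvd d'.order] at h5
  have h6 : (pPart 2 m : ℤ) ∣ K * (t' + 1) := by
    rw [← dvd_neg]
    have h7 : -((K : ℤ) * (t' + 1)) = -K - K * t' := by ring
    rw [h7]
    exact (Int.natCast_dvd_natCast.2 (pPart_dvd 2 m)).trans h5
  refine IsCoprime.dvd_of_dvd_mul_left ?_ h6
  exact Nat.isCoprime_iff_coprime.2
    (Nat.Coprime.pow_left _ ((Nat.prime_two.coprime_iff_not_dvd).2 hK2))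

end MetacyclicData

namespace MetacyclicFactorization

variable [Finite G] {F : MetacyclicFactorization G}

theorem isCoprime_pPart_two {N : ℕ} (hN : ¬ 2 ∣ N) (c : ℕ) :
    IsCoprime (pPart 2 c : ℤ) (N : ℤ) :=
  Nat.isCoprime_iff_coprime.2
    (Nat.Coprime.pow_left _ ((Nat.prime_two.coprime_iff_not_dvd).2 hN))

theorem Describes.pPart_r_dvd_add_one (d : F.Describes a b (F.s : ℤ) t)
    (hnil : ∀ p : ℕ, p.Prime → p ∣ F.m → (p : ℤ) ∣ t - 1) (h4 : 4 ∣ F.m) (ht : (4 : ℤ) ∣ t + 1)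
    (f : SplitHom a b (Int.gcd (t - 1) F.m)) (N : MinusNumbers F.m F.n F.s F.r)
    (d' : MetacyclicData a' b' F.m n' k' t') : (pPart 2 F.r : ℤ) ∣ t' + 1 := by
  have hm0 := F.m_ne_zero
  have hn0 := d.data.n_ne_zero
  have hs0 : F.s ≠ 0 := d.s_pos.ne'
  have hr : pPart 2 F.r = Int.gcd (t + 1) (pPart 2 F.m) := by
    rw [(d.minus h4 ht).1, pPart_two_minusR hm0]
  have hrm : pPart 2 F.r ∣ pPart 2 F.m := pPart_dvd_pPart 2 hm0 d.r_dvd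
  have hg' := d.data.gcd_eq d' f rfl
  have hg4 : ¬ 4 ∣ Int.gcd (t - 1) F.m := by
    intro h
    have := (Int.natCast_dvd_natCast.2 h).trans (Int.gcd_dvd_left ..)
    omega
  have hg2 : 2 ∣ Int.gcd (t - 1) F.m := Int.dvd_gcd (by omega) (dvd_trans (by norm_num)
    (Int.natCast_dvd_natCast.2 h4))
  have ht' : (4 : ℤ) ∣ t' + 1 := by
    have h1 : (2 : ℤ) ∣ t' - 1 := by
      rw [← hg'] at hg2
      exact (Int.natCast_dvd_natCast.2 hg2).trans (Int.gcd_dvd_left ..)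
    have h2 : ¬ (4 : ℤ) ∣ t' - 1 := fun h => hg4 (by
      rw [← hg']; exact Int.dvd_gcd h (Int.natCast_dvd_natCast.2 h4))
    omega
  have hsmall : ¬ 8 ∣ F.m → (pPart 2 F.r : ℤ) ∣ t' + 1 := by
    intro h8
    refine dvd_trans ?_ ht'
    have : F.m.factorization 2 < 3 := by
      by_contra! h
      exact h8 ((pow_dvd_pow 2 h).trans (pPart_dvd 2 F.m))
    exact Int.natCast_dvd_natCast.2 (hrm.trans (pow_dvd_pow 2 (Nat.lt_succ_iff.1 this)))
  by_cases h8 : 8 ∣ F.m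
  swap
  · exact hsmall h8
  have hs4 : 4 ∣ F.s := by
    have h1 : 2 ^ 3 ≤ pPart 2 F.m :=
      Nat.le_of_dvd (pPart_pos Nat.prime_two _) (prime_pow_dvd_pPart Nat.prime_two hm0 h8)
    have h2 : 2 ^ 2 ≤ pPart 2 F.s := by have := N.pPart_m_le; omega
    exact (pow_dvd_pow 2 ((Nat.pow_le_pow_iff_right (by norm_num)).1 h2)).trans (pPart_dvd 2 F.s)
  obtain ⟨j, i, ha⟩ := d.data.gen a'
  obtain ⟨x, y, hb⟩ := d.data.gen b'
  have hj := d.data.two_dvd_exponent d' f rfl h4 ht hs4 ha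
  have hx := d'.not_two_dvd_exponent f hg2 ha hb hj
  by_cases hne : pPart 2 F.r = pPart 2 F.m
  · have hrt : (pPart 2 F.m : ℤ) ∣ t + 1 := by rw [← hne, hr]; exact Int.gcd_dvd_left ..
    by_cases hn4 : 4 ∣ F.n
    · rw [hne]
      refine d.data.pPart_dvd_add_one_of_dvd_s d' f rfl hnil hrt ?_ hg4 ha hb hj hx
      have h1 : pPart 2 F.m ≤ pPart 2 F.s := hne ▸ N.le hn4 h8
      exact (pow_dvd_pow 2 ((Nat.pow_le_pow_iff_right (by norm_num)).1 h1)).trans (pPart_dvd 2 F.s)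
    -- With `n_2 ≤ 2` and `j` even, an odd power of `a'` already lies in `A`, so nothing is lost at
    -- 2.
    · have hnj : F.n ∣ j * oddPart F.n := by
        conv_lhs => rw [← pPart_mul_oddPart F.n]
        refine mul_dvd_mul_right (dvd_trans ?_ hj) _
        have h3 : F.n.factorization 2 < 2 := by
          by_contra! h
          exact hn4 ((pow_dvd_pow 2 h).trans (pPart_dvd 2 F.n))
        exact pow_dvd_pow 2 (Nat.lt_succ_iff.1 h3)
      obtain ⟨w, hw⟩ : ∃ w : ℤ, a' ^ oddPart F.n = a ^ w := by
        have h1 : a' ^ oddPart F.n ∈ Subgroup.zpowers a := by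
          rw [ha, mul_pow_of_conj d.data.conj]
          exact mul_mem ((d.data.pow_mem_iff _).2 hnj) (Subgroup.zpow_mem_zpowers ..)
        obtain ⟨w, hw⟩ := Subgroup.mem_zpowers_iff.1 h1
        exact ⟨w, hw.symm⟩
      have h1 := intDvd_pPart_of_dvd (p := 2) (d.data.dvd_mul_sub_pow d' hb hw)
      have h2 := (isCoprime_pPart_two (not_two_dvd_oddPart hn0) F.m).dvd_of_dvd_mul_left h1
      have h3 := h2.add (dvd_odd_pow_add_one hrt hx)
      rw [hne]
      have h4 : t' + 1 = t' - t ^ x + (t ^ x + 1) := by ring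
      rw [h4]; exact h3
  -- Using the power `g` costs one factor 2, which `2 r_2 ∣ m_2` pays for.
  · obtain ⟨w, hw⟩ := d.data.exists_zpow_eq_pow_gcd d' f rfl
    have h1 := intDvd_pPart_of_dvd (p := 2) (d.data.dvd_mul_sub_pow d' hb hw)
    have h2r : 2 * pPart 2 F.r ∣ pPart 2 F.m := by
      have hle := Nat.le_of_dvd (pPart_pos Nat.prime_two _) hrm
      have hlt := lt_of_le_of_ne hle hne
      rw [pPart, pPart] at hlt ⊢
      rw [← pow_succ']
      exact pow_dvd_pow 2 ((Nat.pow_lt_pow_iff_right (by norm_num)).1 hlt)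
    obtain ⟨g₁, hg₁⟩ := hg2
    have hg₁' : ¬ 2 ∣ g₁ := by
      rintro ⟨c, rfl⟩
      exact hg4 ⟨c, by rw [hg₁]; ring⟩
    rw [hg₁] at h1
    have h5 : (2 * pPart 2 F.r : ℤ) ∣ 2 * (g₁ * (t' - t ^ x)) := by
      refine dvd_trans (by exact_mod_cast h2r) (h1.trans ?_)
      push_cast
      rw [mul_assoc]
    have h6 := Int.dvd_of_mul_dvd_mul_left two_ne_zero h5
    have h7 := (isCoprime_pPart_two hg₁' F.r).dvd_of_dvd_mul_left h6
    have h8 : (pPart 2 F.r : ℤ) ∣ t + 1 := by rw [hr]; exact Int.gcd_dvd_left ..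
    have h9 := h7.add (dvd_odd_pow_add_one h8 hx)
    have h10 : t' + 1 = t' - t ^ x + (t ^ x + 1) := by ring
    rw [h10]; exact h9

theorem gcd_sub_one_oddPart (m : ℕ) (z : ℤ) :
    Int.gcd z (oddPart m) = Nat.gcd (Int.gcd z m) (oddPart m) := by
  apply Nat.dvd_antisymm
  · refine Nat.dvd_gcd (Int.dvd_gcd (Int.gcd_dvd_left ..) ?_)
      (Int.natCast_dvd_natCast.1 (Int.gcd_dvd_right ..))
    exact (Int.gcd_dvd_right ..).trans (Int.natCast_dvd_natCast.2 (oddPart_dvd m))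
  · exact Int.dvd_gcd ((Int.natCast_dvd_natCast.2 (Nat.gcd_dvd_left ..)).trans
      (Int.gcd_dvd_left ..)) (Int.natCast_dvd_natCast.2 (Nat.gcd_dvd_right ..))

theorem Describes.pPart_two_s_dvd (d : F.Describes a b (F.s : ℤ) t)
    (hnil : ∀ p : ℕ, p.Prime → p ∣ F.m → (p : ℤ) ∣ t - 1) (h4 : 4 ∣ F.m) (ht : (4 : ℤ) ∣ t + 1)
    (f : SplitHom a b (Int.gcd (t - 1) F.m)) (N : MinusNumbers F.m F.n F.s F.r)
    (d' : MetacyclicData a' b' F.m n' k' t') (hs : pPart 2 F.m ∣ F.s) :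
    pPart 2 F.m ∣ Int.gcd k' F.m := by
  have hm0 := F.m_ne_zero
  have hn0 := d.data.n_ne_zero
  have hr : pPart 2 F.r = Int.gcd (t + 1) (pPart 2 F.m) := by
    rw [(d.minus h4 ht).1, pPart_two_minusR hm0]
  have hg2 : 2 ∣ Int.gcd (t - 1) F.m := Int.dvd_gcd (by omega) (dvd_trans (by norm_num)
    (Int.natCast_dvd_natCast.2 h4))
  obtain ⟨j, i, ha⟩ := d.data.gen a'
  obtain ⟨x, y, hb⟩ := d.data.gen b'
  have hs4 : 4 ∣ F.s := (four_dvd_pPart_two hm0 h4).trans hs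
  have hj := d.data.two_dvd_exponent d' f rfl h4 ht hs4 ha
  have hx := d'.not_two_dvd_exponent f hg2 ha hb hj
  have hsm : pPart 2 F.s = pPart 2 F.m := Nat.dvd_antisymm (pPart_dvd_pPart 2 hm0 d.s_dvd_m)
    (prime_pow_dvd_pPart Nat.prime_two d.s_pos.ne' hs)
  have hdiv : F.m / pPart 2 F.m = oddPart F.m := rfl
  refine d.data.dvd_gcd_of_orderOf_dvd d' (pPart_dvd 2 F.m) ?_
  rw [hdiv]
  apply orderOf_dvd_of_pow_eq_one
  have h2n : 2 ∣ F.n := two_dvd_n_of_minus d h4 ht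
  obtain ⟨n₁, hn₁⟩ := h2n
  have hn₁0 : n₁ ≠ 0 := by rintro rfl; exact hn0 hn₁
  rw [hb, mul_pow_of_conj d.data.conj, d.data.genB_pow_mul_oddPart hs (dvd_mul_left _ _), one_mul,
    zpow_eq_one_iff_dvd d.data.order]
  refine Dvd.dvd.mul_left ?_ _
  apply intDvd_of_pPart_two_of_oddPart hm0
  swap
  · exact oddPart_dvd_geom_sum hnil (dvd_mul_left _ _) x
  rw [hn₁, mul_assoc, geom_sum_range_mul]
  have h2 : ∑ l ∈ Finset.range 2, (t ^ x) ^ l = t ^ x + 1 := by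
    simp [Finset.sum_range_succ]; ring
  rw [h2]
  have hrt : (pPart 2 F.r : ℤ) ∣ t ^ x + 1 :=
    dvd_odd_pow_add_one (by rw [hr]; exact Int.gcd_dvd_left ..) hx
  have hn₁t : (pPart 2 n₁ : ℤ) ∣ ∑ l ∈ Finset.range (n₁ * oddPart F.m), ((t ^ x) ^ 2) ^ l := by
    refine dvd_geom_sum _ _ _ ((pPart_dvd 2 n₁).mul_right _) fun p hp hpd => ?_
    have h3 : p = 2 := (Nat.prime_dvd_prime_iff_eq hp Nat.prime_two).1 (hp.dvd_of_dvd_pow hpd)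
    rw [h3, ← pow_mul]
    exact _root_.dvd_pow_sub_one (hnil 2 Nat.prime_two (dvd_trans (by norm_num) h4)) _
  refine dvd_trans ?_ (mul_dvd_mul hrt hn₁t)
  have hpn : pPart 2 F.n = 2 * pPart 2 n₁ := by
    rw [hn₁, pPart_mul 2 two_ne_zero hn₁0]
    congr 1
    exact pPart_pow_self (e := 1) Nat.prime_two
  have hrm : pPart 2 F.r ∣ pPart 2 F.m := pPart_dvd_pPart 2 hm0 d.r_dvd
  have h5 : pPart 2 F.m ≤ pPart 2 F.n * pPart 2 F.r := by
    have h6 := (le_max_right _ _).trans N.max_le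
    have h7 := Nat.mul_le_mul_right (pPart 2 F.r) h6
    rwa [Nat.div_mul_cancel hrm] at h7
  -- This is where `s_2 ≠ n_2 r_2` enters: strictness recovers the factor 2 lost by pairing the
  -- terms of the sum.
  have h8 : pPart 2 F.m < pPart 2 F.n * pPart 2 F.r :=
    lt_of_le_of_ne h5 fun h => N.ne (hsm.trans h)
  have h9 : 2 ^ (F.m.factorization 2) < 2 ^ (1 + n₁.factorization 2 + F.r.factorization 2) := by
    rw [hpn] at h8
    rw [pow_add, pow_add, pow_one]
    exact h8
  have h10 := (Nat.pow_lt_pow_iff_right (by norm_num)).1 h9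
  rw [pPart, pPart, pPart]
  rw [← Nat.cast_mul, ← pow_add, Int.natCast_dvd_natCast]
  exact pow_dvd_pow 2 (by omega)

theorem Describes.isMinimal_minus (d : F.Describes a b (F.s : ℤ) t)
    (hnil : ∀ p : ℕ, p.Prime → p ∣ F.m → (p : ℤ) ∣ t - 1) (h4 : 4 ∣ F.m) (ht : (4 : ℤ) ∣ t + 1)
    (f : SplitHom a b (Int.gcd (t - 1) F.m)) (N : MinusNumbers F.m F.n F.s F.r) :
    F.IsMinimal := by
  have hm0 := F.m_ne_zero
  have hs0 := d.s_pos.ne'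
  refine isMinimal_of (fun F' => ?_) (fun F' hm => ?_)
  · obtain ⟨a', b', k', t', d'⟩ := F'.exists_describes
    exact Nat.le_of_dvd (Nat.pos_of_ne_zero F'.m_ne_zero) (d.data.dvd_of_splitHom d'.data f rfl)
  obtain ⟨a', b', k', t', d'⟩ := F'.exists_describes
  have d₁ : MetacyclicData a' b' F.m F'.n k' t' := hm ▸ d'.data
  have hg := d.data.gcd_eq d₁ f rfl
  have hrt := d.pPart_r_dvd_add_one hnil h4 ht f N d₁
  have hr0 : F.r ≠ 0 := ne_zero_of_dvd_ne_zero hm0 d.r_dvd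
  have ht' : (4 : ℤ) ∣ t' + 1 := by
    have h1 : 4 ∣ F.r := (d.minus h4 ht).1 ▸ four_dvd_minusR hm0 h4 ht
    exact (Int.natCast_dvd_natCast.2 (four_dvd_pPart_two hr0 h1)).trans hrt
  have h4' : 4 ∣ F'.m := hm ▸ h4
  constructor
  · rw [(d'.minus h4' ht').1, (d.minus h4 ht).1, hm, minusR, minusR]
    rw [gcd_sub_one_oddPart, gcd_sub_one_oddPart, hg]
    refine Nat.mul_le_mul_left _ (Nat.le_of_dvd (Nat.pos_of_ne_zero ?_) ?_)
    · simp [Int.gcd_eq_zero_iff, (pPart_pos Nat.prime_two F.m).ne']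
    · rw [(d.minus h4 ht).1, pPart_two_minusR hm0] at hrt
      exact Int.dvd_gcd hrt (Int.gcd_dvd_right ..)
  · apply Nat.le_of_dvd d'.s_pos
    rw [← pPart_mul_oddPart F.s]
    refine (coprime_pPart_oddPart hs0).mul_dvd_of_dvd_of_dvd ?_ ?_
    · by_cases hs : pPart 2 F.m ∣ F.s
      · rw [d'.hs, hm]
        exact (pPart_dvd_pPart 2 hm0 d.s_dvd_m).trans (d.pPart_two_s_dvd hnil h4 ht f N d₁ hs)
      -- Here `2 s_2 ∣ m_2`, while `m_2` divides `2 s'_2` because `4 ∣ t' + 1`.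
      · have h1 : 2 * pPart 2 F.s ∣ 2 * pPart 2 F'.s := by
          refine dvd_trans ?_ (hm ▸ d'.pPart_two_m_dvd ht')
          rw [pPart, pPart, ← pow_succ']
          refine pow_dvd_pow 2 ?_
          by_contra! hlt
          exact hs ((pow_dvd_pow 2 (Nat.lt_succ_iff.1 hlt)).trans (pPart_dvd 2 F.s))
        exact (Nat.dvd_of_mul_dvd_mul_left two_pos h1).trans (pPart_dvd _ _)
    · rw [d'.hs, hm]
      have hso : oddPart F.s ∣ F.m := (oddPart_dvd _).trans d.s_dvd_m
      refine d.data.dvd_gcd_of_orderOf_dvd d₁ hso (orderOf_dvd_of_pow_eq_one ?_)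
      exact d.data.pow_eq_one hnil hso (N.oddPart_s_dvd.trans (oddPart_dvd _))
        (Int.natCast_dvd_natCast.2 (oddPart_dvd _)) b'

end MetacyclicFactorization

end ConverseMinus

/-! ### Recovering `r` from the congruences on `t`. -/

section Congruences

theorem modEq_add_dvd {m : ℕ} {x c r : ℤ} (h : x ≡ c + r [ZMOD m]) : (m : ℤ) ∣ x - c - r := by
  rw [sub_sub]; exact Int.modEq_iff_dvd.1 h.symm

theorem gcd_eq_of_dvd_sub {q r : ℕ} {z : ℤ} (hr : r ∣ q) (h : (q : ℤ) ∣ z - r) :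
    Int.gcd z q = r := by
  obtain ⟨c, hc⟩ := h
  have hz : z = r + c * q := by linear_combination hc
  rw [hz, Int.gcd_add_mul_right_left, Int.gcd_natCast_natCast, Nat.gcd_eq_left hr]

theorem eq_of_forall_pPart_eq {x y : ℕ} (hx : x ≠ 0) (hy : y ≠ 0)
    (h : ∀ p : ℕ, p.Prime → pPart p x = pPart p y) : x = y :=
  Nat.dvd_antisymm
    (natDvd_of_forall_pPart hx fun p hp =>
      h p (Nat.prime_of_mem_primeFactors hp) ▸ pPart_dvd p y)
    (natDvd_of_forall_pPart hy fun p hp =>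
      h p (Nat.prime_of_mem_primeFactors hp) ▸ pPart_dvd p x)

theorem gcd_sub_one_eq_of_modEq {m r t : ℕ} (hm : m ≠ 0) (hr : r ∣ m)
    (h : ∀ p ∈ m.primeFactors, (t : ℤ) ≡ 1 + (pPart p r : ℤ) [ZMOD (pPart p m : ℤ)]) :
    Int.gcd ((t : ℤ) - 1) m = r := by
  refine eq_of_forall_pPart_eq (ne_zero_of_dvd_ne_zero hm (gcd_sub_one_dvd _ _))
    (ne_zero_of_dvd_ne_zero hm hr) fun p hp => ?_
  by_cases hpm : p ∣ m
  · rw [pPart_gcd hp hm]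
    exact gcd_eq_of_dvd_sub (pPart_dvd_pPart p hm hr)
      (modEq_add_dvd (h p (Nat.mem_primeFactors.2 ⟨hp, hpm, hm⟩)))
  · rw [pPart_of_coprime fun h => hpm (h.trans (gcd_sub_one_dvd _ _)),
      pPart_of_coprime fun h => hpm (h.trans hr)]

theorem four_dvd_of_modEq {m r : ℕ} {t c : ℤ} (hm : m ≠ 0) (hrm : r ∣ m) (h4 : 4 ∣ r)
    (h : t ≡ c + (pPart 2 r : ℤ) [ZMOD (pPart 2 m : ℤ)]) : (4 : ℤ) ∣ t - c := by
  have h1 : (4 : ℤ) ∣ pPart 2 m :=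
    Int.natCast_dvd_natCast.2 (four_dvd_pPart_two hm (h4.trans hrm))
  have h2 : (4 : ℤ) ∣ pPart 2 r :=
    Int.natCast_dvd_natCast.2 (four_dvd_pPart_two (ne_zero_of_dvd_ne_zero hm hrm) h4)
  exact (dvd_sub_left h2).1 (h1.trans (modEq_add_dvd h))

theorem minusR_eq_of_modEq {m r t : ℕ} (hm : m ≠ 0) (hr : r ∣ m)
    (h : ∀ p ∈ m.primeFactors, p ≠ 2 → (t : ℤ) ≡ 1 + (pPart p r : ℤ) [ZMOD (pPart p m : ℤ)])
    (h2 : (t : ℤ) ≡ -1 + (pPart 2 r : ℤ) [ZMOD (pPart 2 m : ℤ)]) : minusR m t = r := by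
  refine eq_of_forall_pPart_eq (ne_zero_of_dvd_ne_zero hm (minusR_dvd m t))
    (ne_zero_of_dvd_ne_zero hm hr) fun p hp => ?_
  rcases eq_or_ne p 2 with rfl | hp2
  · rw [pPart_two_minusR hm]
    refine gcd_eq_of_dvd_sub (pPart_dvd_pPart 2 hm hr) ?_
    have := modEq_add_dvd h2
    rwa [sub_neg_eq_add] at this
  by_cases hpm : p ∣ m
  · rw [pPart_minusR hm hp hp2]
    exact gcd_eq_of_dvd_sub (pPart_dvd_pPart p hm hr)
      (modEq_add_dvd (h p (Nat.mem_primeFactors.2 ⟨hp, hpm, hm⟩) hp2))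
  · rw [pPart_of_coprime fun h => hpm (h.trans (minusR_dvd _ _)),
      pPart_of_coprime fun h => hpm (h.trans hr)]

theorem coprime_of_forall_prime {m t : ℕ} (h : ∀ p : ℕ, p.Prime → p ∣ m → (p : ℤ) ∣ (t : ℤ) - 1) :
    Nat.Coprime t m := by
  refine Nat.coprime_of_dvd fun p hp hpt hpm => ?_
  have h1 : (p : ℤ) ∣ 1 := (dvd_sub_right (Int.natCast_dvd_natCast.2 hpt)).1 (h p hp hpm)
  exact hp.one_lt.ne' (Nat.dvd_one.1 (by exact_mod_cast h1))

end Congruences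

/-! ### Independence of the minimal factorization, and the conditions on `t`. -/

section Uniqueness

variable {G : Type*} [Group G]

namespace MetacyclicFactorization

variable {F F' : MetacyclicFactorization G} {a b a' b' : G} {k t k' t' : ℤ}

theorem Describes.comm_iff (d : F.Describes a b k t) :
    (∀ x y : G, x * y = y * x) ↔ Int.gcd (t - 1) F.m = F.m := by
  have h1 : Int.gcd (t - 1) F.m = F.m ↔ (F.m : ℤ) ∣ t - 1 := by
    constructor
    · intro h
      conv_lhs => rw [← h]
      exact Int.gcd_dvd_left ..
    · intro h
      exact Nat.dvd_antisymm (gcd_sub_one_dvd _ _) (Int.dvd_gcd h dvd_rfl)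
  rw [h1]
  constructor
  · intro h
    have h2 := d.data.conj
    rw [mul_assoc, h a b, inv_mul_cancel_left] at h2
    have h3 : a ^ t = a ^ (1 : ℤ) := by rw [zpow_one, ← h2]
    exact (zpow_eq_zpow_iff_dvd d.data.order _ _).1 h3
  · intro h x y
    obtain ⟨c, hc⟩ := d.data.exists_mul_eq_mul_mul_zpow x y
    rw [hc, (zpow_eq_one_iff_dvd d.data.order _).2 (h.mul_right c), mul_one]

theorem Describes.forall_prime [Group.IsNilpotent G] (d : F.Describes a b k t) :
    ∀ p : ℕ, p.Prime → p ∣ F.m → (p : ℤ) ∣ t - 1 :=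
  fun _ hp hpm => d.data.prime_dvd_sub_one hp hpm

variable [Finite G]

/-- Compare the orders in `⟨a ^ g⟩ ≤ ⟨a' ^ (t' - 1)⟩`. -/
theorem Describes.gcd_dvd_gcd (d : F.Describes a b k t) (d' : F'.Describes a' b' k' t')
    (hm : F'.m = F.m) : Int.gcd (t' - 1) F.m ∣ Int.gcd (t - 1) F.m := by
  have d₁ : MetacyclicData a' b' F.m F'.n k' t' := hm ▸ d'.data
  have h := (Subgroup.zpowers_le.2 (d.data.zpow_gcd_mem d₁))
    (Subgroup.mem_zpowers (a ^ (Int.gcd (t - 1) F.m : ℤ)))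
  have h1 := orderOf_dvd_of_mem_zpowers h
  rw [orderOf_zpow_eq d.data.order F.m_ne_zero, orderOf_zpow_eq d₁.order F.m_ne_zero,
    Int.gcd_natCast_natCast, Nat.gcd_eq_left (gcd_sub_one_dvd _ _)] at h1
  obtain ⟨c, hc⟩ := h1
  have hpos : 0 < F.m / Int.gcd (t - 1) F.m :=
    Nat.div_pos (Nat.le_of_dvd (Nat.pos_of_ne_zero F.m_ne_zero) (gcd_sub_one_dvd _ _))
      (Nat.pos_of_ne_zero (ne_zero_of_dvd_ne_zero F.m_ne_zero (gcd_sub_one_dvd _ _)))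
  refine ⟨c, Nat.eq_of_mul_eq_mul_right hpos ?_⟩
  rw [Nat.mul_div_cancel' (gcd_sub_one_dvd _ _), mul_assoc, mul_comm c, ← hc,
    Nat.mul_div_cancel' (gcd_sub_one_dvd _ _)]

/-- Equal `m` forces equal `gcd(t - 1, m)`, which detects `t` modulo 4 when `4 ∣ m`. -/
theorem eps_eq_of_m_eq (hm : F'.m = F.m) : F'.eps = F.eps := by
  obtain ⟨a, b, k, t, d⟩ := F.exists_describes
  obtain ⟨a', b', k', t', d'⟩ := F'.exists_describes
  have hg : Int.gcd (t - 1) F.m = Int.gcd (t' - 1) F.m :=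
    Nat.dvd_antisymm (hm ▸ d'.gcd_dvd_gcd d hm.symm) (d.gcd_dvd_gcd d' hm)
  have hiff : F'.eps = 1 ↔ F.eps = 1 := by
    rw [d.eps_eq_one_iff, d'.eps_eq_one_iff, hm]
    refine imp_congr_right fun h4 => ?_
    have h : ∀ z : ℤ, (4 : ℤ) ∣ z ↔ 4 ∣ Int.gcd z F.m := fun z =>
      ⟨fun h => Int.dvd_gcd h (Int.natCast_dvd_natCast.2 h4), fun h =>
        (Int.natCast_dvd_natCast.2 h).trans (Int.gcd_dvd_left ..)⟩
    rw [h, h, hg]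
  rcases d.eps_eq with h | h <;> rcases d'.eps_eq with h' | h' <;> simp_all

theorem IsMinimal.invariants_eq (h : F.IsMinimal) (h' : F'.IsMinimal) :
    F'.m = F.m ∧ F'.r = F.r ∧ F'.s = F.s ∧ F'.n = F.n := by
  have h1 := le_antisymm (h' F) (h F')
  have h2 : (F'.m, toLex (F'.r, F'.s)) = (F.m, toLex (F.r, F.s)) := toLex.injective h1
  have hm := (Prod.mk.inj h2).1
  have h3 : (F'.r, F'.s) = (F.r, F.s) := toLex.injective (Prod.mk.inj h2).2
  refine ⟨hm, (Prod.mk.inj h3).1, (Prod.mk.inj h3).2, ?_⟩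
  have h4 : F'.m * F'.n = F.m * F.n := by
    rw [m, n, m, n, Subgroup.card_mul_index, Subgroup.card_mul_index]
  rw [hm] at h4
  exact Nat.eq_of_mul_eq_mul_left (Nat.pos_of_ne_zero F.m_ne_zero) h4

theorem IsMinimal.m_eq_one_iff (h : F.IsMinimal) : F.m = 1 ↔ IsCyclic G := by
  constructor
  · intro h1
    obtain ⟨a, b, k, t, d⟩ := F.exists_describes
    have ha : a = 1 := by rw [← orderOf_eq_one_iff, d.data.order, h1]
    refine ⟨b, fun g => ?_⟩
    obtain ⟨j, i, rfl⟩ := d.data.gen g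
    rw [ha, one_zpow, mul_one]
    exact Subgroup.npow_mem_zpowers _ j
  · rintro ⟨b, hb⟩
    have hN : (Subgroup.zpowers (1 : G)).Normal := by
      rw [Subgroup.zpowers_one_eq_bot]; infer_instance
    have hle := h.m_le (ofGenerators 1 b hN fun g => by
      obtain ⟨j, hj⟩ := (mem_powers_iff_mem_zpowers).2 (hb g)
      exact ⟨j, 0, by simpa using hj.symm⟩)
    rw [m_ofGenerators, orderOf_one] at hle
    have := F.m_ne_zero
    omega

variable [Group.IsNilpotent G]

theorem isLeast_tSet_iff (F : MetacyclicFactorization G) (x : ℕ) :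
    IsLeast F.tSet x ↔ x < F.m ∧ ∀ p ∈ F.m.primeFactors,
      (x : ℤ) ≡ F.eps ^ (p - 1) + (pPart p F.r : ℤ) [ZMOD (pPart p F.m : ℤ)] := by
  obtain ⟨a, b, k, t, d⟩ := F.exists_describes
  exact d.isLeast_tSet_iff d.forall_prime x

end MetacyclicFactorization

variable [Finite G]

theorem IsMetacyclicInvariants.unique [Group.IsNilpotent G] {m n s t m₁ n₁ s₁ t₁ : ℕ}
    (h : IsMetacyclicInvariants G m n s t) (h₁ : IsMetacyclicInvariants G m₁ n₁ s₁ t₁) :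
    m₁ = m ∧ n₁ = n ∧ s₁ = s ∧ t₁ = t := by
  obtain ⟨F, hF, rfl, rfl, rfl, ht⟩ := h
  obtain ⟨F', hF', rfl, rfl, rfl, ht'⟩ := h₁
  obtain ⟨hm, hr, hs, hn⟩ := hF.invariants_eq hF'
  refine ⟨hm, hn, hs, ?_⟩
  rw [F'.isLeast_tSet_iff, hm, hr, MetacyclicFactorization.eps_eq_of_m_eq hm,
    ← F.isLeast_tSet_iff] at ht'
  exact ht'.unique ht

namespace MetacyclicFactorization

variable [Group.IsNilpotent G] {F : MetacyclicFactorization G} {t : ℕ}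

theorem IsMinimal.plus_of_eps (hF : F.IsMinimal) (he : F.eps = 1) (ht : IsLeast F.tSet t) :
    F.r = Int.gcd ((t : ℤ) - 1) F.m ∧ (4 ∣ F.m → (4 : ℤ) ∣ (t : ℤ) - 1) ∧
      ((∀ x y : G, x * y = y * x) ↔ F.r = F.m) ∧
      (F.r = F.m → F.m ≠ 1 → AbelianCondition F.m F.n F.s t) ∧
      (F.r ≠ F.m → PlusCondition F.m F.n F.s t) := by
  obtain ⟨a, b, k, t₀, d⟩ := F.exists_describes
  obtain ⟨hlt, hmod⟩ := (F.isLeast_tSet_iff t).1 ht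
  have hmod' : ∀ p ∈ F.m.primeFactors,
      (t : ℤ) ≡ 1 + (pPart p F.r : ℤ) [ZMOD (pPart p F.m : ℤ)] := by
    intro p hp
    have := hmod p hp
    rwa [he, one_pow] at this
  have h4 := d.eps_eq_one_iff.1 he
  have hr := (d.plus h4).1
  have hg := gcd_sub_one_eq_of_modEq F.m_ne_zero d.r_dvd hmod'
  obtain ⟨hsn, hlcm⟩ := hF.plus_conditions d d.forall_prime h4
  have h4r : 4 ∣ F.m → 4 ∣ F.r := fun h =>
    hr ▸ Int.dvd_gcd (h4 h) (Int.natCast_dvd_natCast.2 h)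
  refine ⟨hg.symm, fun h => ?_, by rw [d.comm_iff, hr], fun hrm hm1 => ?_, fun hrm => ?_⟩
  · exact (Int.natCast_dvd_natCast.2 (h4r h)).trans (by rw [← hg]; exact Int.gcd_dvd_left ..)
  · have hs : F.s = F.m := Nat.dvd_antisymm d.s_dvd_m
      ((Nat.dvd_lcm_left _ _).trans (by rw [hrm] at hlcm; exact hlcm))
    refine ⟨?_, hs, hs ▸ hsn⟩
    have h1 : (F.m : ℤ) ∣ (t : ℤ) - 1 := by
      conv_lhs => rw [← hrm, ← hg]
      exact Int.gcd_dvd_left ..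
    have hm0 := F.m_ne_zero
    -- `t = 0` satisfies the congruence only for `m = 1`, which is excluded.
    rcases Nat.eq_zero_or_pos t with h0 | h0
    · rw [h0] at h1
      have h2 : (F.m : ℤ) ∣ 1 := by simpa using h1
      exact absurd (Nat.dvd_one.1 (by exact_mod_cast h2)) hm1
    · by_contra hne
      have := Int.le_of_dvd (by omega) h1
      omega
  · exact ⟨F.r, d.r_dvd, hrm, d.primeFactors_r d.forall_prime, fun p hp => by
      rw [← Int.natCast_modEq_iff]; push_cast; exact hmod' p hp, hlcm, hsn, h4r⟩

theorem IsMinimal.minus_of_eps (hF : F.IsMinimal) (he : F.eps ≠ 1) (ht : IsLeast F.tSet t) :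
    4 ∣ F.m ∧ (4 : ℤ) ∣ (t : ℤ) + 1 ∧ F.eps = -1 ∧ MinusCondition F.m F.n F.s t := by
  obtain ⟨a, b, k, t₀, d⟩ := F.exists_describes
  obtain ⟨hlt, hmod⟩ := (F.isLeast_tSet_iff t).1 ht
  have hm0 := F.m_ne_zero
  obtain ⟨h4, ht₀⟩ := d.plus_or_minus.resolve_left fun h => he (d.eps_eq_one_iff.2 h)
  have he' := (d.minus h4 ht₀).2
  have hr := (d.minus h4 ht₀).1
  have h4r : 4 ∣ F.r := hr ▸ four_dvd_minusR hm0 h4 ht₀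
  have h2m : 2 ∈ F.m.primeFactors :=
    Nat.mem_primeFactors.2 ⟨Nat.prime_two, dvd_trans (by norm_num) h4, hm0⟩
  have hmod2 : (t : ℤ) ≡ -1 + (pPart 2 F.r : ℤ) [ZMOD (pPart 2 F.m : ℤ)] := by
    have := hmod 2 h2m
    rwa [he', show 2 - 1 = 1 from rfl, pow_one] at this
  have N := hF.minus_conditions d d.forall_prime h4 ht₀
  have h4t := four_dvd_of_modEq hm0 d.r_dvd h4r hmod2
  rw [sub_neg_eq_add] at h4t
  refine ⟨h4, h4t, he', F.r, ?_, d.primeFactors_r d.forall_prime, h4r, fun p hp hp2 => ?_, hmod2,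
    N.oddPart_dvd, N.oddPart_s_dvd, N.max_le, N.pPart_m_le, N.ne, N.le⟩
  · conv_lhs => rw [← oddPart_mul_pPart F.r]
    exact mul_dvd_mul N.oddPart_r_dvd (pPart_dvd_pPart 2 hm0 d.r_dvd)
  · rw [← Int.natCast_modEq_iff]
    have := hmod p hp
    rw [d.eps_pow (Nat.prime_of_mem_primeFactors hp) hp2] at this
    push_cast
    exact this

end MetacyclicFactorization

end Uniqueness

/-! ### Parameters satisfying the conditions are realized. -/

section Existence

variable {m n s t r : ℕ}

/-- The group with the given parameters is finite and nilpotent with these invariants. -/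
def HasInvariants (m n s t : ℕ) : Prop :=
  Finite (MetacyclicGroup m n s t) ∧ Group.IsNilpotent (MetacyclicGroup m n s t) ∧
    IsMetacyclicInvariants (MetacyclicGroup m n s t) m n s t

/-- Allowing `r = m` lets this cover the cyclic and abelian cases as well. -/
theorem hasInvariants_plus (hm : m ≠ 0) (hn : n ≠ 0) (hsm : s ∣ m) (htm : t < m) (hrm : r ∣ m)
    (hpf : r.primeFactors = m.primeFactors)
    (ht : ∀ p ∈ m.primeFactors, (t : ℤ) ≡ 1 + (pPart p r : ℤ) [ZMOD (pPart p m : ℤ)])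
    (hlcm : Nat.lcm r (m / r) ∣ s) (hsn : s ∣ n) (h4 : 4 ∣ m → 4 ∣ r) : HasInvariants m n s t := by
  have hg := gcd_sub_one_eq_of_modEq hm hrm ht
  have hrt : (r : ℤ) ∣ (t : ℤ) - 1 := by rw [← hg]; exact Int.gcd_dvd_left ..
  have hnil : ∀ p : ℕ, p.Prime → p ∣ m → (p : ℤ) ∣ (t : ℤ) - 1 := fun p hp hpm =>
    (Int.natCast_dvd_natCast.2 (Nat.dvd_of_mem_primeFactors
      (hpf.symm ▸ Nat.mem_primeFactors.2 ⟨hp, hpm, hm⟩))).trans hrt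
  have hrs : r ∣ s := (Nat.dvd_lcm_left _ _).trans hlcm
  have hms : m / r ∣ s := (Nat.dvd_lcm_right _ _).trans hlcm
  have hmr : (m : ℤ) = ((m / r : ℕ) : ℤ) * r := by exact_mod_cast (Nat.div_mul_cancel hrm).symm
  have h4t : 4 ∣ m → (4 : ℤ) ∣ (t : ℤ) - 1 := fun h => (Int.natCast_dvd_natCast.2 (h4 h)).trans hrt
  have d := MetacyclicGroup.metacyclicData (s := s) hm hn (coprime_of_forall_prime hnil)
    (by
      rw [← geom_sum_mul, hmr]
      refine mul_dvd_mul (dvd_geom_sum _ _ _ (hms.trans hsn) fun p hp hpd => ?_) hrt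
      exact hnil p hp (hpd.trans (Nat.div_dvd_of_dvd hrm)))
    (by rw [hmr]; exact mul_dvd_mul (Int.natCast_dvd_natCast.2 hms) hrt)
  have hfin := MetacyclicGroup.finite (s := s) (t := t) hm hn
  have hN := d.isNilpotent hnil
  obtain ⟨F, hFm, hFn, dF⟩ := d.exists_factorization
  have hFs : F.s = s := by rw [dF.hs, hFm, Int.gcd_natCast_natCast, Nat.gcd_eq_left hsm]
  obtain ⟨f⟩ := MetacyclicGroup.nonempty_splitHom hrm (hrs.trans hsn) hrs hrt
  have h4F : 4 ∣ F.m → (4 : ℤ) ∣ (t : ℤ) - 1 := by rw [hFm]; exact h4t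
  have hgF : r = Int.gcd ((t : ℤ) - 1) F.m := by rw [hFm, hg]
  rw [hgF] at f
  have dF' : F.Describes (MetacyclicGroup.genA m n s t) (MetacyclicGroup.genB m n s t) F.s t := by
    have e : (F.s : ℤ) = s := by rw [hFs]
    rw [e]; exact dF
  refine ⟨hfin, hN, F, ?_, hFm, hFn, hFs, ?_⟩
  · exact dF'.isMinimal_plus (by rw [hFm]; exact hnil) h4F f (by rw [hFs, hFn]; exact hsn)
  · rw [F.isLeast_tSet_iff, (dF'.plus h4F).1, (dF'.plus h4F).2, ← hgF, hFm]
    simpa using ⟨htm, fun p hp hpm h => ht p (Nat.mem_primeFactors.2 ⟨hp, hpm, h⟩)⟩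

theorem hasInvariants_minus (hm : m ≠ 0) (hn : n ≠ 0) (hsm : s ∣ m) (htm : t < m)
    (h : MinusCondition m n s t) : HasInvariants m n s t := by
  obtain ⟨r, hr, hpf, h4r, hodd, h2, hmo, hso, hmax, hms, hne, hle⟩ := h
  have hs0 : s ≠ 0 := ne_zero_of_dvd_ne_zero hm hsm
  have hro : oddPart r ∣ oddPart s := by
    have h1 := oddPart_dvd_oddPart hr
    rwa [pPart, oddPart_mul_of_not_dvd (not_two_dvd_oddPart hs0)] at h1
  have hr2 : pPart 2 r ∣ pPart 2 m := by
    have h1 := pPart_dvd_pPart 2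
      (mul_ne_zero (oddPart_pos hs0).ne' (pPart_pos Nat.prime_two m).ne') hr
    rw [show pPart 2 m = 2 ^ m.factorization 2 from rfl,
      pPart_mul_of_not_dvd Nat.prime_two (not_two_dvd_oddPart hs0)] at h1
    exact h1
  have hrm : r ∣ m := by
    rw [← oddPart_mul_pPart r, ← oddPart_mul_pPart m]
    exact mul_dvd_mul (hro.trans (oddPart_dvd_oddPart hsm)) hr2
  have hr0 : r ≠ 0 := ne_zero_of_dvd_ne_zero hm hrm
  have h4 : 4 ∣ m := h4r.trans hrm
  have hodd' : ∀ p ∈ m.primeFactors, p ≠ 2 →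
      (t : ℤ) ≡ 1 + (pPart p r : ℤ) [ZMOD (pPart p m : ℤ)] := by
    intro p hp hp2
    have := Int.natCast_modEq_iff.2 (hodd p hp hp2)
    push_cast at this
    exact this
  have hR := minusR_eq_of_modEq hm hrm hodd' h2
  have ht4 : (4 : ℤ) ∣ (t : ℤ) + 1 := by
    have := four_dvd_of_modEq hm hrm h4r h2
    rwa [sub_neg_eq_add] at this
  have hrot : (oddPart r : ℤ) ∣ (t : ℤ) - 1 := by
    rw [← hR, oddPart_minusR hm]; exact Int.gcd_dvd_left ..
  have hr2t : (pPart 2 r : ℤ) ∣ (t : ℤ) + 1 := by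
    rw [← hR, pPart_two_minusR hm]; exact Int.gcd_dvd_left ..
  have h2t : (2 : ℤ) ∣ (t : ℤ) - 1 := by omega
  have hnil : ∀ p : ℕ, p.Prime → p ∣ m → (p : ℤ) ∣ (t : ℤ) - 1 := by
    intro p hp hpm
    rcases eq_or_ne p 2 with rfl | hp2
    · exact h2t
    · have h1 : p ∣ r := Nat.dvd_of_mem_primeFactors
        (hpf.symm ▸ Nat.mem_primeFactors.2 ⟨hp, hpm, hm⟩)
      refine (Int.natCast_dvd_natCast.2 ((dvd_pPart hp hr0 h1).trans ?_)).trans hrot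
      rw [← pPart_oddPart hp hp2 hr0]
      exact pPart_dvd _ _
  have h2n : 2 ∣ n := by
    have h1 := (le_max_left _ _).trans hmax
    have h3 : n.factorization 2 ≠ 0 := fun h => by rw [pPart, h] at h1; omega
    exact (dvd_pow_self 2 h3).trans (pPart_dvd 2 n)
  obtain ⟨n₁, hn₁⟩ := h2n
  have hn₁0 : n₁ ≠ 0 := by rintro rfl; exact hn hn₁
  have hmo' : (oddPart m : ℤ) = ((oddPart m / oddPart r : ℕ) : ℤ) * oddPart r := by
    exact_mod_cast (Nat.div_mul_cancel (oddPart_dvd_oddPart hrm)).symm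
  have h1 : (m : ℤ) ∣ (t : ℤ) ^ n - 1 := by
    apply intDvd_of_pPart_two_of_oddPart hm
    · have hpn : pPart 2 n = 2 * pPart 2 n₁ := by
        rw [hn₁, pPart_mul 2 two_ne_zero hn₁0]
        congr 1
        exact pPart_pow_self (e := 1) Nat.prime_two
      have h5 : pPart 2 m ∣ pPart 2 n * pPart 2 r := by
        have h6 := Nat.mul_le_mul_right (pPart 2 r) ((le_max_right _ _).trans hmax)
        rw [Nat.div_mul_cancel hr2] at h6
        rw [pPart, pPart, pPart, ← pow_add] at *
        exact pow_dvd_pow 2 ((Nat.pow_le_pow_iff_right (by norm_num)).1 h6)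
      refine (Int.natCast_dvd_natCast.2 h5).trans ?_
      rw [hpn, hn₁, pow_mul, ← geom_sum_mul]
      -- The required `n_2 r_2` is collected as `n_2 / 2` from the sum in `t ^ 2`, 2 from `t - 1`
      -- and `r_2` from `t + 1`.
      have h7 : (t : ℤ) ^ 2 - 1 = ((t : ℤ) - 1) * (t + 1) := by ring
      rw [h7, mul_comm 2, mul_assoc, Nat.cast_mul, Nat.cast_mul]
      refine mul_dvd_mul (dvd_geom_sum _ _ _ (pPart_dvd 2 n₁) fun p hp hpd => ?_)
        (mul_dvd_mul h2t hr2t)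
      rw [(Nat.prime_dvd_prime_iff_eq hp Nat.prime_two).1 (hp.dvd_of_dvd_pow hpd)]
      exact dvd_pow_sub_one h2t 2
    · rw [hmo', ← geom_sum_mul]
      refine mul_dvd_mul (dvd_geom_sum _ _ _ ((hmo.trans hso).trans (oddPart_dvd n))
        fun p hp hpd => ?_) hrot
      exact hnil p hp ((hpd.trans (Nat.div_dvd_of_dvd (oddPart_dvd_oddPart hrm))).trans
        (oddPart_dvd m))
  have h3 : (m : ℤ) ∣ s * ((t : ℤ) - 1) := by
    apply intDvd_of_pPart_two_of_oddPart hm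
    · have h5 : pPart 2 m ∣ pPart 2 s * 2 := by
        rw [mul_comm, pPart, pPart, ← pow_succ'] at *
        exact pow_dvd_pow 2 ((Nat.pow_le_pow_iff_right (by norm_num)).1 hms)
      refine (Int.natCast_dvd_natCast.2 h5).trans ?_
      rw [Nat.cast_mul]
      exact mul_dvd_mul (Int.natCast_dvd_natCast.2 (pPart_dvd 2 s)) h2t
    · rw [hmo']
      exact mul_dvd_mul (Int.natCast_dvd_natCast.2 (hmo.trans (oddPart_dvd s))) hrot
  have d := MetacyclicGroup.metacyclicData (s := s) hm hn (coprime_of_forall_prime hnil) h1 h3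
  have hfin := MetacyclicGroup.finite (s := s) (t := t) hm hn
  have hN := d.isNilpotent hnil
  obtain ⟨F, hFm, hFn, dF⟩ := d.exists_factorization
  have hFs : F.s = s := by rw [dF.hs, hFm, Int.gcd_natCast_natCast, Nat.gcd_eq_left hsm]
  have h4F : 4 ∣ F.m := by rw [hFm]; exact h4
  have hFr : F.r = r := by rw [(dF.minus h4F ht4).1, hFm, hR]
  -- `gcd (t - 1) m` divides `n` and `s`
  have hgd : ∀ c : ℕ, 2 ∣ c → oddPart r ∣ c → Int.gcd ((t : ℤ) - 1) m ∣ c := by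
    intro c hc2 hco
    have hg0 := ne_zero_of_dvd_ne_zero hm (gcd_sub_one_dvd m t)
    rw [← pPart_mul_oddPart (Int.gcd ((t : ℤ) - 1) m)]
    refine (coprime_pPart_oddPart hg0).mul_dvd_of_dvd_of_dvd (dvd_trans ?_ hc2)
      (dvd_trans ?_ hco)
    · have h5 : ((2 : ℤ) ^ (Int.gcd ((t : ℤ) - 1) m).factorization 2) ∣ (t : ℤ) - 1 := by
        have := (Int.natCast_dvd_natCast.2 (pPart_dvd 2 (Int.gcd ((t : ℤ) - 1) m))).trans
          (Int.gcd_dvd_left ..)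
        rwa [pPart, Nat.cast_pow] at this
      have h6 := two_pow_dvd_of_dvd_add_two (y := 2) (by omega) h5 fun _ => by omega
      rw [pPart]
      exact_mod_cast h6
    · rw [← hR, oddPart_minusR hm]
      exact Int.dvd_gcd ((Int.natCast_dvd_natCast.2 (oddPart_dvd _)).trans (Int.gcd_dvd_left ..))
        (Int.natCast_dvd_natCast.2 (oddPart_dvd_oddPart (gcd_sub_one_dvd m t)))
  have h2s : 2 ∣ s := by
    have h5 := Nat.le_of_dvd (pPart_pos Nat.prime_two m) (four_dvd_pPart_two hm h4)
    have h6 : s.factorization 2 ≠ 0 := fun h => by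
      have h7 : pPart 2 s = 1 := by rw [pPart, h, pow_zero]
      omega
    exact (dvd_pow_self 2 h6).trans (pPart_dvd 2 s)
  obtain ⟨f⟩ := MetacyclicGroup.nonempty_splitHom (gcd_sub_one_dvd m t)
    (hgd n ⟨n₁, hn₁⟩ ((hro.trans hso).trans (oddPart_dvd n)))
    (hgd s h2s (hro.trans (oddPart_dvd s))) (Int.gcd_dvd_left ((t : ℤ) - 1) m)
  have hgF : Int.gcd ((t : ℤ) - 1) m = Int.gcd ((t : ℤ) - 1) F.m := by rw [hFm]
  rw [hgF] at f
  have dF' : F.Describes (MetacyclicGroup.genA m n s t) (MetacyclicGroup.genB m n s t) F.s t := by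
    have e : (F.s : ℤ) = s := by rw [hFs]
    rw [e]; exact dF
  refine ⟨hfin, hN, F, ?_, hFm, hFn, hFs, ?_⟩
  · refine dF'.isMinimal_minus (by rw [hFm]; exact hnil) h4F ht4 f ?_
    rw [hFm, hFn, hFs, hFr]
    exact ⟨hso, hro, hmo, hmax, hms, hne, hle⟩
  · rw [F.isLeast_tSet_iff, hFr, hFm]
    refine ⟨htm, fun p hp => ?_⟩
    rcases eq_or_ne p 2 with rfl | hp2
    · rw [(dF'.minus h4F ht4).2]; simpa using h2
    · rw [dF'.eps_pow (Nat.prime_of_mem_primeFactors hp) hp2]; exact hodd' p hp hp2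

theorem hasInvariants_of_conditions (hm : m ≠ 0) (hn : n ≠ 0) (h : NilpotentConditions m n s t) :
    HasInvariants m n s t := by
  obtain ⟨hsm, htm, rfl | ⟨rfl, rfl, hsn⟩ | ⟨r, hrm, -, hpf, ht, hlcm, hsn, h4⟩ | h⟩ := h
  · have hs1 : s = 1 := Nat.dvd_one.1 hsm
    subst hs1
    exact hasInvariants_plus (r := 1) hm hn hsm htm dvd_rfl rfl (by simp) (by simp) (one_dvd _)
      (by simp)
  · refine hasInvariants_plus (r := s) hm hn hsm htm dvd_rfl rfl (fun p _ => ?_) ?_ hsn id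
    · rw [Int.modEq_iff_dvd]; simp
    · rw [Nat.div_self (Nat.pos_of_ne_zero hm), Nat.lcm_one_right]
  · refine hasInvariants_plus hm hn hsm htm hrm hpf (fun p hp => ?_) hlcm hsn h4
    have := Int.natCast_modEq_iff.2 (ht p hp)
    push_cast at this
    exact this
  · exact hasInvariants_minus hm hn hsm htm h

end Existence

/-! ### Which condition holds for which group. -/

section Classification

variable {G : Type*} [Group G] [Finite G] [Group.IsNilpotent G] {m n s t : ℕ}

theorem IsMetacyclicInvariants.classification (h : IsMetacyclicInvariants G m n s t) :
    (m = 1 ↔ IsCyclic G) ∧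
      (AbelianCondition m n s t ↔ (∀ x y : G, x * y = y * x) ∧ ¬ IsCyclic G) ∧
      (PlusCondition m n s t ↔ (∃ x y : G, x * y ≠ y * x) ∧
        ∀ F : MetacyclicFactorization G, F.IsMinimal → F.eps = 1) ∧
      (MinusCondition m n s t ↔
        ∀ F : MetacyclicFactorization G, F.IsMinimal → F.eps = -1) := by
  obtain ⟨F, hF, rfl, rfl, rfl, ht⟩ := h
  obtain ⟨a, b, k, t₀, d⟩ := F.exists_describes
  have hm0 := F.m_ne_zero
  have htm := ((F.isLeast_tSet_iff t).1 ht).1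
  -- All minimal factorizations share `m`, hence `ε`.
  have heps : ∀ c, (∀ F' : MetacyclicFactorization G, F'.IsMinimal → F'.eps = c) ↔ F.eps = c :=
    fun c => ⟨fun h => h F hF, fun h F' hF' => by
      rw [MetacyclicFactorization.eps_eq_of_m_eq (hF.invariants_eq hF').1, h]⟩
  have hcyc := hF.m_eq_one_iff
  have hplus : F.eps = 1 → _ := fun he => hF.plus_of_eps he ht
  have hminus : F.eps ≠ 1 → _ := fun he => hF.minus_of_eps he ht
  have hcomm_eps : (∀ x y : G, x * y = y * x) → F.eps = 1 := by
    intro h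
    have h1 := d.comm_iff.1 h
    refine d.eps_eq_one_iff.2 fun h4 => ?_
    refine dvd_trans (Int.natCast_dvd_natCast.2 h4) ?_
    conv_lhs => rw [← h1]
    exact Int.gcd_dvd_left ..
  refine ⟨hcyc, ?_, ?_, ?_⟩
  · constructor
    · rintro ⟨rfl, hs, hn⟩
      have hm1 : F.m ≠ 1 := by omega
      refine ⟨?_, fun h => hm1 (hcyc.2 h)⟩
      have he : F.eps = 1 := by
        by_contra he
        obtain ⟨-, h, -⟩ := hminus he
        norm_num at h
      obtain ⟨hr, -, hc, -⟩ := hplus he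
      refine hc.2 ?_
      rw [hr]
      simp
    · rintro ⟨hc, hnc⟩
      obtain ⟨-, -, hc', h, -⟩ := hplus (hcomm_eps hc)
      exact h (hc'.1 hc) fun h1 => hnc (hcyc.1 h1)
  · rw [heps]
    constructor
    · rintro ⟨r, hrm, hne, hpf, hmod, -, -, h4⟩
      have hmod' : ∀ p ∈ F.m.primeFactors,
          (t : ℤ) ≡ 1 + (pPart p r : ℤ) [ZMOD (pPart p F.m : ℤ)] := by
        intro p hp
        have := Int.natCast_modEq_iff.2 (hmod p hp)
        push_cast at this
        exact this
      have hg := gcd_sub_one_eq_of_modEq hm0 hrm hmod'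
      have he : F.eps = 1 := by
        by_contra he
        obtain ⟨h4m, h, -⟩ := hminus he
        have h1 : (4 : ℤ) ∣ (t : ℤ) - 1 := by
          refine dvd_trans (Int.natCast_dvd_natCast.2 (h4 h4m)) ?_
          rw [← hg]; exact Int.gcd_dvd_left ..
        omega
      obtain ⟨hr, -, hc, -⟩ := hplus he
      refine ⟨?_, he⟩
      by_contra! h
      exact hne (by rw [← hg, ← hr, hc.1 h])
    · rintro ⟨⟨x, y, hxy⟩, he⟩
      obtain ⟨-, -, hc, -, h⟩ := hplus he
      exact h fun h1 => hxy (hc.2 h1 x y)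
  · rw [heps]
    constructor
    · rintro ⟨r, hr, -, h4r, -, h2, -⟩
      have hs0 := d.s_pos.ne'
      have h4m : 4 ∣ F.m := by
        refine h4r.trans (hr.trans ?_)
        conv_rhs => rw [← oddPart_mul_pPart F.m]
        exact mul_dvd_mul_right (oddPart_dvd_oddPart d.s_dvd_m) _
      have hr0 : r ≠ 0 := by
        rintro rfl
        exact mul_ne_zero (oddPart_pos hs0).ne' (pPart_pos Nat.prime_two F.m).ne'
          (Nat.eq_zero_of_zero_dvd hr)
      have ht4 : (4 : ℤ) ∣ (t : ℤ) - -1 :=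
        (dvd_sub_left (Int.natCast_dvd_natCast.2 (four_dvd_pPart_two hr0 h4r))).1
          ((Int.natCast_dvd_natCast.2 (four_dvd_pPart_two hm0 h4m)).trans (modEq_add_dvd h2))
      by_contra he
      have he1 : F.eps = 1 := d.eps_eq.resolve_right he
      obtain ⟨-, h, -⟩ := hplus he1
      have := h h4m
      omega
    · intro he
      obtain ⟨-, -, -, h⟩ := hminus (by rw [he]; norm_num)
      exact h

theorem IsMetacyclicInvariants.conditions (h : IsMetacyclicInvariants G m n s t) :
    NilpotentConditions m n s t := by
  obtain ⟨F, hF, rfl, rfl, rfl, ht⟩ := h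
  obtain ⟨a, b, k, t₀, d⟩ := F.exists_describes
  refine ⟨d.s_dvd_m, ((F.isLeast_tSet_iff t).1 ht).1, ?_⟩
  by_cases hm1 : F.m = 1
  · exact Or.inl hm1
  by_cases he : F.eps = 1
  · obtain ⟨-, -, -, h1, h2⟩ := hF.plus_of_eps he ht
    by_cases hr : F.r = F.m
    · exact Or.inr (Or.inl (h1 hr hm1))
    · exact Or.inr (Or.inr (Or.inl (h2 hr)))
  · exact Or.inr (Or.inr (Or.inr (hF.minus_of_eps he ht).2.2.2))

end Classification

theorem mainTheorem7 (m n s t : ℕ) (hm : 0 < m) (hn : 0 < n) (hs : 0 < s) :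
    ((∃ (G : Type) (_ : Group G), Finite G ∧ Group.IsNilpotent G ∧
        IsMetacyclicInvariants G m n s t) ↔ NilpotentConditions m n s t) ∧
    (NilpotentConditions m n s t →
      Finite (MetacyclicGroup m n s t) ∧ Group.IsNilpotent (MetacyclicGroup m n s t) ∧
      ∀ m₁ n₁ s₁ t₁ : ℕ, IsMetacyclicInvariants (MetacyclicGroup m n s t) m₁ n₁ s₁ t₁ ↔
        m₁ = m ∧ n₁ = n ∧ s₁ = s ∧ t₁ = t) ∧
    (∀ (G : Type) [Group G], Finite G → Group.IsNilpotent G → IsMetacyclicInvariants G m n s t →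
      (m = 1 ↔ IsCyclic G) ∧
      (AbelianCondition m n s t ↔ (∀ x y : G, x * y = y * x) ∧ ¬ IsCyclic G) ∧
      (PlusCondition m n s t ↔ (∃ x y : G, x * y ≠ y * x) ∧
        ∀ F : MetacyclicFactorization G, F.IsMinimal → F.eps = 1) ∧
      (MinusCondition m n s t ↔
        ∀ F : MetacyclicFactorization G, F.IsMinimal → F.eps = -1)) := by
  refine ⟨⟨?_, fun h => ?_⟩, fun h => ?_, fun G _ _ _ h => h.classification⟩
  · rintro ⟨G, _, _, _, h⟩
    exact h.conditions
  · obtain ⟨h1, h2, h3⟩ := hasInvariants_of_conditions hm.ne' hn.ne' h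
    exact ⟨MetacyclicGroup m n s t, inferInstance, h1, h2, h3⟩
  · obtain ⟨h1, h2, h3⟩ := hasInvariants_of_conditions hm.ne' hn.ne' h
    refine ⟨h1, h2, fun m₁ n₁ s₁ t₁ => ⟨fun h₁ => h3.unique h₁, ?_⟩⟩
    rintro ⟨rfl, rfl, rfl, rfl⟩
    exact h3
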